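/- Let a temporal graph be a sequence $G_1,\dots,G_\ell$ ($\ell\ge 1$) of graphs (layers) on a common set $V$ of $n\ge 1$ vertices, $G_i=(V,E_i)$. A cluster editing set for $G_i$ is a set $M_i\subseteq\binom V2$ such that every connected component of $G_i'=(V,E_i\oplus M_i)$ is a clique, where $\oplus$ is the symmetric difference. \textsc{Temporal Cluster Editing} asks, given a temporal graph and $k,d\in\mathbb N$, whether there are cluster editing sets $M_1,\dots,M_\ell$ for $G_1,\dots,G_\ell$ with $|M_i|\le k$ for all $i$, and sets $D_1,\dots,D_{\ell-1}\subseteq V$ with $|D_i|\le d$, such that $G_i'[V\setminus D_i]=G_{i+1}'[V\setminus D_i]$ for all $1\le i<\ell$. **Theorem.** On a random access machine (words of length logarithmic in the input length, the input numbers and the time bound; unit cost per operation; layers given as adjacency matrices), \textsc{Temporal Cluster Editing} can be solved in $O(\ell\cdot n^{4k+2}\log n)$ time, where the constant in the $O$ is absolute and $\log n$ is read as $1$ for $n=1$. Moreover, the problem is in XP with respect to the parameter $k$ (solvable in time $f(k)\cdot|x|^{g(k)}$ on inputs $x$ for some computable $f,g$) and fixed-parameter tractable with respect to $n$ (solvable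 in time $f(n)\cdot|x|^{O(1)}$ for some computable $f$). -/

import Mathlib

/-! ## A random access machine with words of bounded length

Programs are written in structured form over finitely many registers and a random access memory.
Every operation costs one step. On a machine of word length `w`, a computation that produces a
number `≥ 2 ^ w` gets stuck. -/

namespace WordRAM

/-- The arithmetic operations and comparisons of the machine. -/
inductive BinOp
  | add | sub | mul | div | mod | lt | eq

/-- Truncated subtraction; a comparison gives `1` (true) or `0` (false). -/
def BinOp.eval : BinOp → ℕ → ℕ → ℕ
  | .add, a, b => a + b
  | .sub, a, b => a - b
  | .mul, a, b => a * b
  | .div, a, b => a / b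
  | .mod, a, b => a % b
  | .lt, a, b => if a < b then 1 else 0
  | .eq, a, b => if a = b then 1 else 0

/-- Expressions: constants, registers, memory cells (indirect addressing) and operations. -/
inductive Expr
  | const (a : ℕ)
  | reg (r : ℕ)
  | load (addr : Expr)
  | bin (o : BinOp) (e₁ e₂ : Expr)

/-- Programs. `ite` and `loop` (a while-loop) test whether an expression is nonzero. -/
inductive Prog
  | skip
  | assign (r : ℕ) (e : Expr)
  | store (addr e : Expr)
  | seq (p q : Prog)
  | ite (e : Expr) (p q : Prog)
  | loop (e : Expr) (p : Prog)

/-- A configuration: the contents of the registers and of the memory. -/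
structure State where
  regs : ℕ → ℕ
  mem : ℕ → ℕ

/-- `a` if it fits into a word of length `w`. -/
def word (w a : ℕ) : Option ℕ := if a < 2 ^ w then some a else none

/-- The value of an expression on a machine of word length `w`; `none` on overflow. -/
def Expr.eval (w : ℕ) (s : State) : Expr → Option ℕ
  | .const a => word w a
  | .reg r => some (s.regs r)
  | .load addr => (addr.eval w s).map s.mem
  | .bin o e₁ e₂ =>
      (e₁.eval w s).bind fun a => (e₂.eval w s).bind fun b => word w (o.eval a b)

/-- The number of steps needed to evaluate an expression. -/
def Expr.cost : Expr → ℕ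
  | .const _ => 1
  | .reg _ => 1
  | .load addr => addr.cost + 1
  | .bin _ e₁ e₂ => e₁.cost + e₂.cost + 1

/-- `Exec w p s s' t`: on a machine of word length `w`, the program `p` started in `s` halts in
`s'` after exactly `t` steps. -/
inductive Exec (w : ℕ) : Prog → State → State → ℕ → Prop
  | skip (s : State) : Exec w .skip s s 1
  | assign {s : State} {r : ℕ} {e : Expr} {a : ℕ} (h : e.eval w s = some a) :
      Exec w (.assign r e) s ⟨Function.update s.regs r a, s.mem⟩ (e.cost + 1)
  | store {s : State} {addr e : Expr} {i a : ℕ}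
      (hi : addr.eval w s = some i) (ha : e.eval w s = some a) :
      Exec w (.store addr e) s ⟨s.regs, Function.update s.mem i a⟩ (addr.cost + e.cost + 1)
  | seq {s s' s'' : State} {p q : Prog} {t t' : ℕ}
      (hp : Exec w p s s' t) (hq : Exec w q s' s'' t') :
      Exec w (.seq p q) s s'' (t + t')
  | ite_true {s s' : State} {e : Expr} {p q : Prog} {a t : ℕ}
      (he : e.eval w s = some a) (ha : a ≠ 0) (hp : Exec w p s s' t) :
      Exec w (.ite e p q) s s' (e.cost + 1 + t)
  | ite_false {s s' : State} {e : Expr} {p q : Prog} {t : ℕ}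
      (he : e.eval w s = some 0) (hq : Exec w q s s' t) :
      Exec w (.ite e p q) s s' (e.cost + 1 + t)
  | loop_true {s s' s'' : State} {e : Expr} {p : Prog} {a t t' : ℕ}
      (he : e.eval w s = some a) (ha : a ≠ 0) (hp : Exec w p s s' t)
      (hl : Exec w (.loop e p) s' s'' t') :
      Exec w (.loop e p) s s'' (e.cost + 1 + t + t')
  | loop_false {s : State} {e : Expr} {p : Prog} (he : e.eval w s = some 0) :
      Exec w (.loop e p) s s (e.cost + 1)

/-- Initially memory cell `j` holds the `j`-th input number; everything else is `0`. -/
def startState (input : List ℕ) : State where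
  regs := fun _ => 0
  mem := fun j => input.getD j 0

/-- The program `P` decides the problem `L` (whose instances `x` are presented to the machine as
`enc x`) in at most `T x` steps, answering in register `0`. The word length only has to be large
enough compared to the logarithms of the input length, of the input numbers and of the time
bound. -/
def DecidesInTime {I : Type*} (P : Prog) (enc : I → List ℕ) (L : I → Prop) (T : I → ℕ) : Prop :=
  ∃ c : ℕ, ∀ (x : I) (w : ℕ),
    c * Nat.size ((enc x).length + (enc x).sum + T x) ≤ w →
      ∃ (s : State) (t : ℕ), Exec w P (startState (enc x)) s t ∧ t ≤ T x ∧
        (L x → s.regs 0 = 1) ∧ (¬ L x → s.regs 0 = 0)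

/-- The size of an input in bits (one extra symbol separates consecutive numbers). -/
def bitSize (input : List ℕ) : ℕ := (input.map fun a => Nat.size a + 1).sum

/-- Fixed-parameter tractability with respect to the parameter `κ`: time
`f (κ x) * |x| ^ O(1)`. -/
def InFPT {I : Type*} (enc : I → List ℕ) (κ : I → ℕ) (L : I → Prop) : Prop :=
  ∃ (P : Prog) (f : ℕ → ℕ) (c : ℕ), Computable f ∧
    DecidesInTime P enc L fun x => f (κ x) * bitSize (enc x) ^ c

/-- Membership in XP with respect to the parameter `κ`: time `f (κ x) * |x| ^ g (κ x)`. -/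
def InXP {I : Type*} (enc : I → List ℕ) (κ : I → ℕ) (L : I → Prop) : Prop :=
  ∃ (P : Prog) (f g : ℕ → ℕ), Computable f ∧ Computable g ∧
    DecidesInTime P enc L fun x => f (κ x) * bitSize (enc x) ^ g (κ x)

end WordRAM

/-! ## Temporal Cluster Editing -/

namespace TCE

/-- A cluster graph: every connected component is a clique. -/
def IsClusterGraph {V : Type*} (G : SimpleGraph V) : Prop :=
  ∀ K : G.ConnectedComponent, G.IsClique K.supp

/-- The graph `(V, E ⊕ M)`. -/
def edit {V : Type*} (G : SimpleGraph V) (M : Finset (Sym2 V)) : SimpleGraph V :=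
  SimpleGraph.fromEdgeSet (symmDiff G.edgeSet (M : Set (Sym2 V)))

/-- `M` is a set of unordered pairs of distinct vertices that turns `G` into a cluster graph. -/
def IsClusterEditingSet {V : Type*} (G : SimpleGraph V) (M : Finset (Sym2 V)) : Prop :=
  (∀ e ∈ M, ¬ e.IsDiag) ∧ IsClusterGraph (edit G M)

/-- `M` is a clustering of the temporal graph with the layers `G i`. -/
def IsClustering {V : Type*} {ℓ : ℕ} (G : Fin ℓ → SimpleGraph V)
    (M : Fin ℓ → Finset (Sym2 V)) : Prop :=
  ∀ i, IsClusterEditingSet (G i) (M i)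

/-- At most `k` edits in each layer. -/
def IsBounded {V : Type*} {ℓ : ℕ} (k : ℕ) (M : Fin ℓ → Finset (Sym2 V)) : Prop :=
  ∀ i, (M i).card ≤ k

/-- There are vertex sets `D i` of size at most `d`, one for each pair of consecutive layers, such
that the two edited layers agree outside `D i`. -/
def IsTemporallyConsistent {V : Type*} {ℓ : ℕ} (d : ℕ) (G : Fin ℓ → SimpleGraph V)
    (M : Fin ℓ → Finset (Sym2 V)) : Prop :=
  ∃ D : ℕ → Finset V, ∀ (i : ℕ) (h : i + 1 < ℓ), (D i).card ≤ d ∧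
    (edit (G ⟨i, Nat.lt_of_succ_lt h⟩) (M ⟨i, Nat.lt_of_succ_lt h⟩)).induce ((D i : Set V)ᶜ) =
      (edit (G ⟨i + 1, h⟩) (M ⟨i + 1, h⟩)).induce ((D i : Set V)ᶜ)

/-- An instance of Temporal Cluster Editing: a temporal graph with `ℓ ≥ 1` layers on `n ≥ 1`
vertices, and the numbers `k` and `d`. -/
structure Instance where
  n : ℕ
  ℓ : ℕ
  n_pos : 0 < n
  ℓ_pos : 0 < ℓ
  layers : Fin ℓ → SimpleGraph (Fin n)
  k : ℕ
  d : ℕ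

/-- There is a temporally `d`-consistent `k`-bounded clustering. -/
def Instance.IsYes (I : Instance) : Prop :=
  ∃ M : Fin I.ℓ → Finset (Sym2 (Fin I.n)),
    IsClustering I.layers M ∧ IsBounded I.k M ∧ IsTemporallyConsistent I.d I.layers M

open Classical in
/-- The input of the machine: `n`, `ℓ`, `k`, `d`, followed by the adjacency matrices of the
layers, row by row. -/
noncomputable def Instance.encode (I : Instance) : List ℕ :=
  [I.n, I.ℓ, I.k, I.d] ++
    (List.finRange I.ℓ).flatMap fun i =>
      (List.finRange I.n).flatMap fun u =>
        (List.finRange I.n).map fun v => if (I.layers i).Adj u v then 1 else 0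

end TCE

/-! The algorithm is a dynamic program over the layers. Only `b = min k (n * n)` edits per layer
matter, since there are at most `n * n` pairs. An edit set of at most `b` pairs is coded by a number
`t` with `b` digits in base `n * n`, so there are `S = n ^ (2 * b)` codes. A code is reachable in
layer `i` if it turns the layer into a cluster graph and, for `i > 0`, some reachable code of layer
`i - 1` gives a graph that agrees with it outside at most `d` vertices (`Instance.Reach`). The
instance is a yes-instance iff some code is reachable in the last layer (`Instance.isYes_iff`).
There are fewer than `ℓ * S ^ 2` pairs of codes to compare, so a comparison in `O(n ^ 2)` steps
gives `O(ℓ * n ^ (4 * b + 2))`, even without the logarithm.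

Two cluster graphs are two partitions of the vertices, and they agree on `X` iff the partitions
induced on `X` coincide. A largest such `X` has the size of a maximum weight matching between the
classes of the two partitions, where a pair of classes has as weight the size of its intersection;
the graphs are consistent iff `n - |X| ≤ d` (`consistent_iff`).

The matching is found by the Hungarian method. Each vertex serves as an edge between its two
classes, so there are only `n` edges and a search takes `O(n)` steps. The potentials start with
total `n`: each left class gets its size, each right class gets `0`. From an unmatched left class
with positive potential, a search along tight edges either ends at an unmatched right class, or
reaches a left class of potential `0` which may lose its partner, or fails. In the first two cases
an augmentation settles the root; in the third, a change of the potentials lowers their total by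
`1`. Hence there are at most `2 * n` phases, and `O(n ^ 2)` steps in all (`runs_hungarian`).
Optimality is linear programming duality (`card_le_of_agree`, `exists_agree`).

The program is written for a machine with separate arrays and verified with a Hoare-style logic with
time bounds (`Runs`). `Big.exec` transfers each run, step for step, to the word RAM: if all stored
numbers are at most `B`, intermediate results are bounded by a fixed power of `B + 2`, so words of
length `O(log B)` suffice. The XP and FPT claims follow from the same program, with `b ≤ k` for the
one and `b ≤ n * n` for the other. -/

/-! ## An array machine

Programs over registers and sixteen infinite arrays with read access to the input. Numbers are
unbounded, but every stored number has to be at most a given bound `B`. -/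

namespace ArrayMachine

open WordRAM

/-- Expressions: constants, registers, array entries, input numbers and operations. -/
inductive Ex
  | c (k : ℕ)
  | v (r : ℕ)
  | get (j : Fin 16) (e : Ex)
  | inp (e : Ex)
  | op (o : BinOp) (e₁ e₂ : Ex)

/-- Programs. -/
inductive Cm
  | skip
  | set (r : ℕ) (e : Ex)
  | put (j : Fin 16) (i e : Ex)
  | seq (p q : Cm)
  | ite (e : Ex) (p q : Cm)
  | loop (e : Ex) (p : Cm)

infixr:60 " ;; " => Cm.seq

/-- The contents of the registers and of the arrays. -/
@[ext]
structure Store where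
  r : ℕ → ℕ
  a : Fin 16 → ℕ → ℕ

/-- Assignment to a register. -/
def Store.setR (σ : Store) (r x : ℕ) : Store := ⟨Function.update σ.r r x, σ.a⟩

/-- Assignment to an array entry. -/
def Store.setA (σ : Store) (j : Fin 16) (i x : ℕ) : Store :=
  ⟨σ.r, Function.update σ.a j (Function.update (σ.a j) i x)⟩

@[simp] theorem Store.setR_r (σ : Store) (r x r' : ℕ) :
    (σ.setR r x).r r' = if r' = r then x else σ.r r' := by
  simp [Store.setR, Function.update_apply]

@[simp] theorem Store.setR_a (σ : Store) (r x : ℕ) : (σ.setR r x).a = σ.a := rfl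

@[simp] theorem Store.setA_r (σ : Store) (j : Fin 16) (i x : ℕ) : (σ.setA j i x).r = σ.r := rfl

@[simp] theorem Store.setA_a (σ : Store) (j : Fin 16) (i x : ℕ) (j' : Fin 16) :
    (σ.setA j i x).a j' = if j' = j then Function.update (σ.a j) i x else σ.a j' := by
  by_cases h : j' = j
  · subst h; simp [Store.setA]
  · simp [Store.setA, h]

/-- The value of an expression. -/
@[simp] def Ex.val (inp : ℕ → ℕ) (σ : Store) : Ex → ℕ
  | .c k => k
  | .v r => σ.r r
  | .get j e => σ.a j (e.val inp σ)
  | .inp e => inp (e.val inp σ)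
  | .op o e₁ e₂ => o.eval (e₁.val inp σ) (e₂.val inp σ)

/-- Array `j` occupies the cells `base + 16 * i + j`, where register `0` of the word RAM holds
`base`, the length of the input. -/
def Ex.compile : Ex → Expr
  | .c k => .const k
  | .v r => .reg (r + 1)
  | .get j e => .load (.bin .add (.bin .add (.reg 0) (.bin .mul (.const 16) e.compile)) (.const j))
  -- Cells from `base` on belong to the arrays, so the loaded value is multiplied by the truth value
  -- of "address `< base`". This gives `0` outside the input, in accordance with `getD _ 0`.
  | .inp e => .bin .mul (.load e.compile) (.bin .lt e.compile (.reg 0))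
  | .op o e₁ e₂ => .bin o e₁.compile e₂.compile

/-- Translation into a program of the word RAM. -/
def Cm.compile : Cm → Prog
  | .skip => .skip
  | .set r e => .assign (r + 1) e.compile
  | .put j i e =>
      .store (.bin .add (.bin .add (.reg 0) (.bin .mul (.const 16) i.compile)) (.const j)) e.compile
  | .seq p q => .seq p.compile q.compile
  | .ite e p q => .ite e.compile p.compile q.compile
  | .loop e p => .loop e.compile p.compile

/-- The number of steps for evaluating an expression. -/
@[simp] def Ex.cost : Ex → ℕ
  | .c _ => 1
  | .v _ => 1
  | .get _ e => e.cost + 7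
  | .inp e => 2 * e.cost + 4
  | .op _ e₁ e₂ => e₁.cost + e₂.cost + 1

theorem Ex.cost_compile (e : Ex) : e.compile.cost = e.cost := by
  induction e with
  | c k => rfl
  | v r => rfl
  | get j e ih => simp only [compile, Expr.cost, cost, ih]; omega
  | inp e ih => simp only [compile, Expr.cost, cost, ih]; omega
  | op o e₁ e₂ h₁ h₂ => simp only [compile, Expr.cost, cost, h₁, h₂]

/-- Big-step semantics: `Big B inp p σ σ' t` says that `p` started in `σ` halts in `σ'` after `t`
steps and stores only numbers `≤ B`. -/
inductive Big (B : ℕ) (inp : ℕ → ℕ) : Cm → Store → Store → ℕ → Prop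
  | skip (σ) : Big B inp .skip σ σ 1
  | set (σ) (r : ℕ) (e : Ex) (h : e.val inp σ ≤ B) :
      Big B inp (.set r e) σ (σ.setR r (e.val inp σ)) (e.cost + 1)
  | put (σ) (j : Fin 16) (i e : Ex) (h : e.val inp σ ≤ B) :
      Big B inp (.put j i e) σ (σ.setA j (i.val inp σ) (e.val inp σ)) (i.cost + 6 + e.cost + 1)
  | seq {p q σ σ' σ'' t t'} (hp : Big B inp p σ σ' t) (hq : Big B inp q σ' σ'' t') :
      Big B inp (.seq p q) σ σ'' (t + t')
  | ite_true {e p q σ σ' t} (he : e.val inp σ ≠ 0) (hp : Big B inp p σ σ' t) :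
      Big B inp (.ite e p q) σ σ' (e.cost + 1 + t)
  | ite_false {e p q σ σ' t} (he : e.val inp σ = 0) (hq : Big B inp q σ σ' t) :
      Big B inp (.ite e p q) σ σ' (e.cost + 1 + t)
  | loop_true {e p σ σ' σ'' t t'} (he : e.val inp σ ≠ 0) (hp : Big B inp p σ σ' t)
      (hl : Big B inp (.loop e p) σ' σ'' t') :
      Big B inp (.loop e p) σ σ'' (e.cost + 1 + t + t')
  | loop_false {e p σ} (he : e.val inp σ = 0) : Big B inp (.loop e p) σ σ (e.cost + 1)

/-! ### Simulation by the word RAM -/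

/-- The state `s` of the word RAM represents the store `σ`, and all its numbers are `≤ B`. -/
structure Rep (B : ℕ) (input : List ℕ) (s : State) (σ : Store) : Prop where
  base : s.regs 0 = input.length
  regs : ∀ r, s.regs (r + 1) = σ.r r
  arrs : ∀ (j : Fin 16) i, s.mem (input.length + 16 * i + j) = σ.a j i
  inp : ∀ x < input.length, s.mem x = input.getD x 0
  regs_le : ∀ r, s.regs r ≤ B
  mem_le : ∀ x, s.mem x ≤ B

/-- An exponent for bounding the numbers in the evaluation of an expression. -/
def exprDeg : Expr → ℕ
  | .const a => a
  | .reg _ => 1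
  | .load e => exprDeg e + 1
  | .bin _ e₁ e₂ => exprDeg e₁ + exprDeg e₂ + 1

/-- An exponent for bounding the numbers in the execution of a program. -/
def progDeg : Prog → ℕ
  | .skip => 0
  | .assign _ e => exprDeg e
  | .store a e => exprDeg a + exprDeg e
  | .seq p q => progDeg p + progDeg q
  | .ite e p q => exprDeg e + progDeg p + progDeg q
  | .loop e p => exprDeg e + progDeg p

/-- The extra factor `C ≥ 2` pays for addition: both powers are at least `1`, so their sum is at
most twice their product. -/
theorem binOp_eval_le (o : BinOp) {a b x y C : ℕ} (hC : 2 ≤ C) (ha : a ≤ C ^ x) (hb : b ≤ C ^ y) :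
    o.eval a b ≤ C ^ (x + y + 1) := by
  have hx : 1 ≤ C ^ x := Nat.one_le_pow _ _ (by omega)
  have hy : 1 ≤ C ^ y := Nat.one_le_pow _ _ (by omega)
  have hxy : C ^ x * C ^ y * 2 ≤ C ^ (x + y + 1) := by
    rw [pow_succ, pow_add]; gcongr
  have h1 : C ^ x + C ^ y ≤ C ^ x * C ^ y * 2 := by nlinarith
  have h2 : a * b ≤ C ^ x * C ^ y := Nat.mul_le_mul ha hb
  cases o <;> simp only [BinOp.eval]
  · omega
  · omega
  · omega
  · have := Nat.div_le_self a b; omega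
  · have := Nat.mod_le a b; omega
  · split_ifs <;> omega
  · split_ifs <;> omega

/-- Evaluation without bounds. -/
def exprVal (s : State) : Expr → ℕ
  | .const a => a
  | .reg r => s.regs r
  | .load e => s.mem (exprVal s e)
  | .bin o e₁ e₂ => o.eval (exprVal s e₁) (exprVal s e₂)

/-- Evaluation cannot overflow. The exponent `exprDeg e` depends on the program text only, because
every register or memory access returns a number `≤ B` again; a constant `a` is covered by `a ≤ 2 ^
a`. -/
theorem expr_eval_eq {B w D : ℕ} (hw : (B + 2) ^ D < 2 ^ w) {s : State}
    (hr : ∀ r, s.regs r ≤ B) (hm : ∀ x, s.mem x ≤ B) (e : Expr) (he : exprDeg e ≤ D) :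
    e.eval w s = some (exprVal s e) ∧ exprVal s e ≤ (B + 2) ^ exprDeg e := by
  have hmono {x : ℕ} (hx : x ≤ D) : (B + 2) ^ x < 2 ^ w :=
    (Nat.pow_le_pow_right (by omega) hx).trans_lt hw
  induction e with
  | const a =>
    have h : a ≤ (B + 2) ^ a :=
      (Nat.lt_two_pow_self).le.trans (Nat.pow_le_pow_left (by omega) a)
    refine ⟨?_, h⟩
    have : a < 2 ^ w := h.trans_lt (hmono he)
    simp [Expr.eval, word, exprVal, this]
  | reg r =>
    refine ⟨rfl, ?_⟩
    have := hr r
    simp only [exprVal, exprDeg, pow_one]; omega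
  | load e ih =>
    simp only [exprDeg] at he
    obtain ⟨h1, h2⟩ := ih (by omega)
    refine ⟨by simp [Expr.eval, h1, exprVal], ?_⟩
    have := hm (exprVal s e)
    have h3 : (B + 2) ^ 1 ≤ (B + 2) ^ (exprDeg e + 1) :=
      Nat.pow_le_pow_right (by omega) (by omega)
    have h4 : (B + 2) ^ 1 = B + 2 := pow_one _
    simp only [exprVal, exprDeg]; omega
  | bin o e₁ e₂ ih₁ ih₂ =>
    have he' := he
    simp only [exprDeg] at he
    obtain ⟨h1, h2⟩ := ih₁ (by omega)
    obtain ⟨h3, h4⟩ := ih₂ (by omega)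
    have h5 := binOp_eval_le o (by omega) h2 h4
    refine ⟨?_, h5⟩
    have : o.eval (exprVal s e₁) (exprVal s e₂) < 2 ^ w := h5.trans_lt (hmono he')
    simp [Expr.eval, h1, h3, exprVal, word, this]

theorem Rep.exprVal {B : ℕ} {input : List ℕ} {s : State} {σ : Store} (h : Rep B input s σ)
    (e : Ex) : exprVal s e.compile = e.val (fun x => input.getD x 0) σ := by
  induction e with
  | c k => rfl
  | v r => exact h.regs r
  | get j e ih =>
    simp only [Ex.compile, ArrayMachine.exprVal, BinOp.eval, ih, h.base, h.arrs, Ex.val]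
  | inp e ih =>
    simp only [Ex.compile, ArrayMachine.exprVal, BinOp.eval, ih, h.base, Ex.val]
    split_ifs with hx
    · rw [h.inp _ hx, mul_one]
    · rw [List.getD_eq_default _ _ (by omega), mul_zero]
  | op o e₁ e₂ h₁ h₂ => simp only [Ex.compile, ArrayMachine.exprVal, Ex.val, h₁, h₂]

theorem Rep.setR {B : ℕ} {input : List ℕ} {s : State} {σ : Store} (h : Rep B input s σ)
    (r x : ℕ) (hx : x ≤ B) :
    Rep B input ⟨Function.update s.regs (r + 1) x, s.mem⟩ (σ.setR r x) where
  base := by simpa using h.base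
  regs r' := by
    by_cases hr : r' = r
    · subst hr; simp
    · simp [hr, h.regs]
  arrs := h.arrs
  inp := h.inp
  regs_le r' := by
    by_cases hr : r' = r + 1
    · subst hr; simpa using hx
    · simpa [hr] using h.regs_le r'
  mem_le := h.mem_le

/-- As `j < 16`, the address determines the pair `(i, j)`, and it lies behind the input. So a write
changes one array entry and no input cell. -/
theorem Rep.setA {B : ℕ} {input : List ℕ} {s : State} {σ : Store} (h : Rep B input s σ)
    (j : Fin 16) (i x : ℕ) (hx : x ≤ B) :
    Rep B input ⟨s.regs, Function.update s.mem (input.length + 16 * i + j) x⟩ (σ.setA j i x) where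
  base := h.base
  regs := h.regs
  arrs j' i' := by
    have hj := j.2
    have hj' := j'.2
    by_cases hjj : j' = j
    · subst hjj
      by_cases hi : i' = i
      · subst hi; simp
      · have : input.length + 16 * i' + (j' : ℕ) ≠ input.length + 16 * i + j' := by omega
        simp only [Function.update_of_ne this, Store.setA_a, if_true, Function.update_of_ne hi,
          h.arrs]
    · have : (j' : ℕ) ≠ j := fun e => hjj (Fin.ext e)
      have : input.length + 16 * i' + (j' : ℕ) ≠ input.length + 16 * i + j := by omega
      simp only [Function.update_of_ne this, Store.setA_a, hjj, if_false, h.arrs]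
  inp y hy := by
    have : y ≠ input.length + 16 * i + j := by omega
    simp only [Function.update_of_ne this, h.inp y hy]
  regs_le := h.regs_le
  mem_le y := by
    by_cases hy : y = input.length + 16 * i + j
    · subst hy; simpa using hx
    · simpa only [Function.update_of_ne hy] using h.mem_le y

/-- The costs in `Big` are those of the compiled code, so the step count `t` is preserved exactly
and time bounds proved for the array machine need no conversion. -/
theorem Big.exec {B w D : ℕ} {input : List ℕ} (hw : (B + 2) ^ D < 2 ^ w) {p : Cm} {σ σ' : Store}
    {t : ℕ} (h : Big B (fun x => input.getD x 0) p σ σ' t) (hD : progDeg p.compile ≤ D)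
    {s : State} (hs : Rep B input s σ) :
    ∃ s', Exec w p.compile s s' t ∧ Rep B input s' σ' := by
  have hev {s : State} {σ : Store} (hs : Rep B input s σ) (e : Ex) (he : exprDeg e.compile ≤ D) :
      e.compile.eval w s = some (e.val (fun x => input.getD x 0) σ) := by
    rw [← hs.exprVal]; exact (expr_eval_eq hw hs.regs_le hs.mem_le _ he).1
  induction h generalizing s with
  | skip σ => exact ⟨s, .skip s, hs⟩
  | set σ r e hb =>
    refine ⟨_, ?_, hs.setR r _ hb⟩
    rw [← e.cost_compile]
    exact .assign (hev hs e hD)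
  | put σ j i e hb =>
    simp only [Cm.compile, progDeg] at hD
    refine ⟨_, ?_, hs.setA j _ _ hb⟩
    have h1 : i.cost + 6 = (Expr.bin .add (.bin .add (.reg 0) (.bin .mul (.const 16) i.compile))
        (.const j)).cost := by
      simp only [Expr.cost, i.cost_compile]; omega
    rw [h1, ← e.cost_compile]
    refine .store ?_ (hev hs e (by omega))
    rw [(expr_eval_eq hw hs.regs_le hs.mem_le _ (by simp only [exprDeg] at hD ⊢; omega)).1]
    simp only [ArrayMachine.exprVal, BinOp.eval, hs.base, hs.exprVal]
  | seq _ _ ih₁ ih₂ =>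
    simp only [Cm.compile, progDeg] at hD
    obtain ⟨s₁, h₁, hs₁⟩ := ih₁ (by omega) hs
    obtain ⟨s₂, h₂, hs₂⟩ := ih₂ (by omega) hs₁
    exact ⟨s₂, .seq h₁ h₂, hs₂⟩
  | @ite_true e _ _ _ _ _ he _ ih =>
    simp only [Cm.compile, progDeg] at hD
    obtain ⟨s₁, h₁, hs₁⟩ := ih (by omega) hs
    rw [← e.cost_compile]
    exact ⟨s₁, .ite_true (hev hs e (by omega)) he h₁, hs₁⟩
  | @ite_false e _ _ _ _ _ he _ ih =>
    simp only [Cm.compile, progDeg] at hD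
    obtain ⟨s₁, h₁, hs₁⟩ := ih (by omega) hs
    rw [← e.cost_compile]
    exact ⟨s₁, .ite_false (he ▸ hev hs e (by omega)) h₁, hs₁⟩
  | @loop_true e _ _ _ _ _ _ he _ _ ih₁ ih₂ =>
    have hD' := hD
    simp only [Cm.compile, progDeg] at hD
    obtain ⟨s₁, h₁, hs₁⟩ := ih₁ (by omega) hs
    obtain ⟨s₂, h₂, hs₂⟩ := ih₂ hD' hs₁
    rw [← e.cost_compile]
    exact ⟨s₂, .loop_true (hev hs e (by omega)) he h₁ h₂, hs₂⟩
  | @loop_false e _ _ he =>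
    simp only [Cm.compile, progDeg] at hD
    rw [← e.cost_compile]
    exact ⟨s, .loop_false (he ▸ hev hs e (by omega)), hs⟩

/-! ### Program logic -/

/-- The registers a program may change. -/
@[simp] def Cm.wr : Cm → List ℕ
  | .skip => []
  | .set r _ => [r]
  | .put _ _ _ => []
  | .seq p q => p.wr ++ q.wr
  | .ite _ p q => p.wr ++ q.wr
  | .loop _ p => p.wr

/-- The arrays a program may change. -/
@[simp] def Cm.wa : Cm → List (Fin 16)
  | .skip => []
  | .set _ _ => []
  | .put j _ _ => [j]
  | .seq p q => p.wa ++ q.wa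
  | .ite _ p q => p.wa ++ q.wa
  | .loop _ p => p.wa

/-- `σ'` agrees with `σ` outside the registers `R` and the arrays `A`. -/
structure Frame (R : List ℕ) (A : List (Fin 16)) (σ σ' : Store) : Prop where
  r : ∀ r, r ∉ R → σ'.r r = σ.r r
  a : ∀ j, j ∉ A → σ'.a j = σ.a j

theorem Frame.refl {R A} (σ : Store) : Frame R A σ σ := ⟨fun _ _ => rfl, fun _ _ => rfl⟩

theorem Frame.trans {R A σ σ' σ''} (h : Frame R A σ σ') (h' : Frame R A σ' σ'') :
    Frame R A σ σ'' :=
  ⟨fun r hr => (h'.r r hr).trans (h.r r hr), fun j hj => (h'.a j hj).trans (h.a j hj)⟩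

theorem Frame.mono {R R' A A' σ σ'} (h : Frame R A σ σ') (hR : R ⊆ R') (hA : A ⊆ A') :
    Frame R' A' σ σ' :=
  ⟨fun r hr => h.r r fun h' => hr (hR h'), fun j hj => h.a j fun h' => hj (hA h')⟩

theorem Frame.setR {R A σ σ'} (h : Frame R A σ σ') {r : ℕ} (hr : r ∈ R) (x : ℕ) :
    Frame R A σ (σ'.setR r x) :=
  ⟨fun r' hr' => by
    have : r' ≠ r := by rintro rfl; exact hr' hr
    simp [this, h.r r' hr'], h.a⟩

/-- What a program leaves alone can be read off its text. Later, the preservation of a register or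
array is mostly settled by `decide` on the lists `wr` and `wa`. -/
theorem Big.frame {B inp p σ σ' t} (h : Big B inp p σ σ' t) : Frame p.wr p.wa σ σ' := by
  induction h with
  | skip σ => exact .refl σ
  | set σ r e _ => exact Frame.setR (.refl σ) (by simp) _
  | put σ j i e _ => exact ⟨fun _ _ => rfl, fun j' hj' => by simp at hj'; simp [hj']⟩
  | seq _ _ ih₁ ih₂ => exact (ih₁.mono (by simp) (by simp)).trans (ih₂.mono (by simp) (by simp))
  | ite_true _ _ ih => exact ih.mono (by simp) (by simp)
  | ite_false _ _ ih => exact ih.mono (by simp) (by simp)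
  | loop_true _ _ _ ih₁ ih₂ => exact ih₁.trans ih₂
  | loop_false _ => exact .refl _

/-- Total correctness with a time bound: `p` started in `σ` halts after at most `T` steps in a
store satisfying `Q`. -/
def Runs (B : ℕ) (inp : ℕ → ℕ) (p : Cm) (σ : Store) (T : ℕ) (Q : Store → Prop) : Prop :=
  ∃ σ' t, Big B inp p σ σ' t ∧ t ≤ T ∧ Q σ'

/-- Weakest precondition of a loop-free program. -/
@[simp] def Cm.wp (B : ℕ) (inp : ℕ → ℕ) : Cm → (Store → Prop) → Store → Prop
  | .skip, Q, σ => Q σ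
  | .set r e, Q, σ => e.val inp σ ≤ B ∧ Q (σ.setR r (e.val inp σ))
  | .put j i e, Q, σ => e.val inp σ ≤ B ∧ Q (σ.setA j (i.val inp σ) (e.val inp σ))
  | .seq p q, Q, σ => p.wp B inp (q.wp B inp Q) σ
  | .ite e p q, Q, σ => (e.val inp σ ≠ 0 → p.wp B inp Q σ) ∧ (e.val inp σ = 0 → q.wp B inp Q σ)
  | .loop _ _, _, _ => False

/-- An upper bound for the running time of a loop-free program. -/
@[simp] def Cm.cost : Cm → ℕ
  | .skip => 1
  | .set _ e => e.cost + 1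
  | .put _ i e => i.cost + 6 + e.cost + 1
  | .seq p q => p.cost + q.cost
  | .ite e p q => e.cost + 1 + (p.cost + q.cost)
  | .loop _ _ => 0

variable {B : ℕ} {inp : ℕ → ℕ}

theorem Runs.mono {p σ T T' Q Q'} (h : Runs B inp p σ T Q) (hT : T ≤ T')
    (hQ : ∀ σ', Frame p.wr p.wa σ σ' → Q σ' → Q' σ') : Runs B inp p σ T' Q' := by
  obtain ⟨σ', t, h1, h2, h3⟩ := h
  exact ⟨σ', t, h1, h2.trans hT, hQ σ' h1.frame h3⟩

theorem Runs.of_wp {p σ T Q} (h : p.wp B inp Q σ) (hT : p.cost ≤ T) : Runs B inp p σ T Q := by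
  suffices h : Runs B inp p σ p.cost Q from h.mono hT fun _ _ h => h
  clear hT
  induction p generalizing σ Q with
  | skip => exact ⟨σ, 1, .skip σ, le_rfl, h⟩
  | set r e => exact ⟨_, _, .set σ r e h.1, le_rfl, h.2⟩
  | put j i e => exact ⟨_, _, .put σ j i e h.1, le_rfl, h.2⟩
  | seq p q ihp ihq =>
    obtain ⟨σ₁, t₁, h1, h2, h3⟩ := ihp h
    obtain ⟨σ₂, t₂, h4, h5, h6⟩ := ihq h3
    exact ⟨σ₂, _, .seq h1 h4, by simp only [Cm.cost]; omega, h6⟩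
  | ite e p q ihp ihq =>
    by_cases he : e.val inp σ = 0
    · obtain ⟨σ₁, t₁, h1, h2, h3⟩ := ihq (h.2 he)
      exact ⟨σ₁, _, .ite_false he h1, by simp only [Cm.cost]; omega, h3⟩
    · obtain ⟨σ₁, t₁, h1, h2, h3⟩ := ihp (h.1 he)
      exact ⟨σ₁, _, .ite_true he h1, by simp only [Cm.cost]; omega, h3⟩
  | loop e p _ => exact h.elim

theorem Runs.seq {p q σ T T₁ T₂ Q} (R : Store → Prop) (h₁ : Runs B inp p σ T₁ R)
    (h₂ : ∀ σ', Frame p.wr p.wa σ σ' → R σ' → Runs B inp q σ' T₂ Q) (hT : T₁ + T₂ ≤ T) :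
    Runs B inp (p ;; q) σ T Q := by
  obtain ⟨σ₁, t₁, h1, h2, h3⟩ := h₁
  obtain ⟨σ₂, t₂, h4, h5, h6⟩ := h₂ σ₁ h1.frame h3
  exact ⟨σ₂, _, .seq h1 h4, by omega, h6⟩

theorem Runs.ite {e p q σ T T₁ Q} (h₁ : e.val inp σ ≠ 0 → Runs B inp p σ T₁ Q)
    (h₂ : e.val inp σ = 0 → Runs B inp q σ T₁ Q) (hT : e.cost + 1 + T₁ ≤ T) :
    Runs B inp (.ite e p q) σ T Q := by
  by_cases he : e.val inp σ = 0
  · obtain ⟨σ₁, t₁, h1, h2, h3⟩ := h₂ he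
    exact ⟨σ₁, _, .ite_false he h1, by omega, h3⟩
  · obtain ⟨σ₁, t₁, h1, h2, h3⟩ := h₁ he
    exact ⟨σ₁, _, .ite_true he h1, by omega, h3⟩

/-- The rule for while-loops, with an invariant that bounds the number of iterations. -/
theorem Runs.loop_of_index {e p σ T Tb Q} (Inv : ℕ → Store → Prop) (m : ℕ) (h0 : Inv m σ)
    (hbody : ∀ k σ', Frame p.wr p.wa σ σ' → Inv k σ' → e.val inp σ' ≠ 0 →
      Runs B inp p σ' Tb fun σ'' => ∃ k' < k, Inv k' σ'')
    (hQ : ∀ k σ', Frame p.wr p.wa σ σ' → Inv k σ' → e.val inp σ' = 0 → Q σ')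
    (hT : m * (Tb + e.cost + 1) + e.cost + 1 ≤ T) : Runs B inp (.loop e p) σ T Q := by
  suffices h : ∀ k σ', Frame p.wr p.wa σ σ' → Inv k σ' →
      Runs B inp (.loop e p) σ' (k * (Tb + e.cost + 1) + e.cost + 1) Q from
    (h m σ (.refl σ) h0).mono hT fun _ _ h => h
  intro k
  induction k using Nat.strong_induction_on with
  | _ k ih =>
    intro σ₁ hf hI
    by_cases he : e.val inp σ₁ = 0
    · exact ⟨σ₁, _, .loop_false he, by omega, hQ k σ₁ hf hI he⟩
    · obtain ⟨σ₂, t₂, h1, h2, k', h3, h4⟩ := hbody k σ₁ hf hI he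
      obtain ⟨σ₃, t₃, h5, h6, h7⟩ := ih k' h3 σ₂ (hf.trans h1.frame) h4
      refine ⟨σ₃, _, .loop_true he h1 h5, ?_, h7⟩
      have : (k' + 1) * (Tb + e.cost + 1) ≤ k * (Tb + e.cost + 1) :=
        Nat.mul_le_mul_right _ (by omega)
      rw [add_mul] at this
      omega

/-- The rule for while-loops, with an invariant and a decreasing measure. -/
theorem Runs.loop {e p σ T Tb Q} (Inv : Store → Prop) (m : Store → ℕ) (h0 : Inv σ)
    (hbody : ∀ σ', Frame p.wr p.wa σ σ' → Inv σ' → e.val inp σ' ≠ 0 →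
      Runs B inp p σ' Tb fun σ'' => Inv σ'' ∧ m σ'' < m σ')
    (hQ : ∀ σ', Frame p.wr p.wa σ σ' → Inv σ' → e.val inp σ' = 0 → Q σ')
    (hT : m σ * (Tb + e.cost + 1) + e.cost + 1 ≤ T) : Runs B inp (.loop e p) σ T Q := by
  refine Runs.loop_of_index (fun k σ' => Inv σ' ∧ m σ' = k) (m σ) ⟨h0, rfl⟩ ?_
    (fun k σ' hf h he => hQ σ' hf h.1 he) hT
  rintro k σ' hf ⟨hI, rfl⟩ he
  exact (hbody σ' hf hI he).mono le_rfl fun σ'' _ h => ⟨_, h.2, h.1, rfl⟩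

/-- A for-loop: register `i` runs from `0` to the content of register `b` (exclusively). -/
def Cm.for_ (i b : ℕ) (p : Cm) : Cm :=
  .set i (.c 0) ;; .loop (.op .lt (.v i) (.v b)) (p ;; .set i (.op .add (.v i) (.c 1)))

@[simp] theorem Cm.wr_for (i b : ℕ) (p : Cm) : (Cm.for_ i b p).wr = i :: (p.wr ++ [i]) := rfl

@[simp] theorem Cm.wa_for (i b : ℕ) (p : Cm) : (Cm.for_ i b p).wa = p.wa := by simp [Cm.for_]

/-- The body may change neither the counter nor the bound, so the loop makes exactly `N` rounds.
Each round pays `4` for the increment and `4` for the test beyond `Tb`; the final `6` are the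
initialization and the last test. The frame given to the body refers to the store before the whole
loop. -/
theorem Runs.for_ {i b p σ T Tb Q} (N : ℕ) (Inv : ℕ → Store → Prop)
    (hN : σ.r b = N) (hNB : N ≤ B) (hi : i ∉ p.wr) (hb : b ∉ i :: p.wr)
    (h0 : Inv 0 (σ.setR i 0))
    (hbody : ∀ k < N, ∀ σ', Frame (i :: p.wr) p.wa σ σ' → σ'.r i = k → Inv k σ' →
      Runs B inp p σ' Tb fun σ'' => Inv (k + 1) (σ''.setR i (k + 1)))
    (hQ : ∀ σ', Frame (i :: p.wr) p.wa σ σ' → Inv N σ' → Q σ')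
    (hT : N * (Tb + 8) + 6 ≤ T) : Runs B inp (Cm.for_ i b p) σ T Q := by
  have hib : b ≠ i := fun h => hb (by simp [h])
  refine Runs.seq (T₁ := 2) (T₂ := N * (Tb + 8) + 4)
    (fun σ' => σ' = σ.setR i 0) (Runs.of_wp (by simp) (by simp)) ?_ (by omega)
  rintro _ - rfl
  refine Runs.loop (Tb := Tb + 4)
    (fun σ' => Frame (i :: p.wr) p.wa σ σ' ∧ σ'.r i ≤ N ∧ Inv (σ'.r i) σ')
    (fun σ' => N - σ'.r i) ⟨Frame.setR (.refl σ) (by simp) _, by simp, by simpa using h0⟩ ?_ ?_ ?_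
  · rintro σ' - ⟨hf, hle, hI⟩ he
    have hb' : σ'.r b = N := (hf.r b hb).trans hN
    have hlt : σ'.r i < N := by
      by_contra hc
      simp [BinOp.eval, hb', hc] at he
    refine Runs.seq (T₁ := Tb) (T₂ := 4) (fun σ'' => Inv (σ'.r i + 1) (σ''.setR i (σ'.r i + 1)))
      (hbody _ hlt σ' hf rfl hI) ?_ le_rfl
    intro σ'' hf' hI'
    have hi'' := hf'.r i hi
    refine Runs.of_wp ?_ (by simp)
    simp only [Cm.wp, Ex.val, BinOp.eval, hi'']
    refine ⟨by omega, ⟨?_, by simp; omega, by simpa using hI'⟩, by simp; omega⟩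
    exact (hf.trans (hf'.mono (by simp) (by simp))).setR (by simp) _
  · rintro σ' - ⟨hf, hle, hI⟩ he
    have hb' : σ'.r b = N := (hf.r b hb).trans hN
    have : σ'.r i = N := by
      by_contra hc
      have : σ'.r i < N := by omega
      simp [BinOp.eval, hb', this] at he
    exact hQ σ' hf (this ▸ hI)
  · simp

end ArrayMachine

namespace ArrayMachine

open WordRAM

/-! ### Scanning and tabulating -/

/-- `scanF P h m` starts with `0` and applies `h i` for each `i < m` satisfying `P`. -/
noncomputable def scanF (P : ℕ → Prop) (h : ℕ → ℕ → ℕ) : ℕ → ℕ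
  | 0 => 0
  | i + 1 => open Classical in if P i then h i (scanF P h i) else scanF P h i

/-- One more than the largest `i < m` satisfying `P`, or `0`. -/
noncomputable def lastF (P : ℕ → Prop) : ℕ → ℕ := scanF P fun i _ => i + 1

theorem lastF_le (P : ℕ → Prop) (m : ℕ) : lastF P m ≤ m := by
  induction m with
  | zero => simp [lastF, scanF]
  | succ m ih =>
    rw [lastF, scanF]
    rw [lastF] at ih
    split_ifs <;> omega

theorem lastF_eq_zero {P : ℕ → Prop} {m : ℕ} : lastF P m = 0 ↔ ∀ i < m, ¬ P i := by
  induction m with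
  | zero => simp [lastF, scanF]
  | succ m ih =>
    rw [lastF] at ih ⊢
    rw [scanF]
    split_ifs with h
    · simp only [false_iff, not_forall, not_not]
      exact ⟨m, by omega, h⟩
    · rw [ih]
      refine ⟨fun H i hi => ?_, fun H i hi => H i (by omega)⟩
      obtain rfl | hi' := Nat.eq_or_lt_of_le (Nat.le_of_lt_succ hi)
      · exact h
      · exact H i hi'

theorem lastF_spec {P : ℕ → Prop} {m v : ℕ} (h : lastF P m = v + 1) :
    v < m ∧ P v ∧ ∀ i < m, P i → i ≤ v := by
  induction m with
  | zero => simp [lastF, scanF] at h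
  | succ m ih =>
    rw [lastF] at ih h
    rw [scanF] at h
    split_ifs at h with hP
    · obtain rfl : m = v := by omega
      exact ⟨by omega, hP, fun i hi _ => by omega⟩
    · obtain ⟨h1, h2, h3⟩ := ih h
      refine ⟨by omega, h2, fun i hi hi' => h3 i ?_ hi'⟩
      refine lt_of_le_of_ne (by omega) ?_
      rintro rfl
      exact hP hi'

theorem scanF_last (P : ℕ → Prop) (m : ℕ) : scanF P (fun i _ => i) m = lastF P m - 1 := by
  induction m with
  | zero => simp [lastF, scanF]
  | succ m ih =>
    rw [lastF] at ih ⊢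
    rw [scanF, scanF]
    split_ifs <;> simp_all

open Classical in
theorem scanF_count (P : ℕ → Prop) (m : ℕ) :
    scanF P (fun _ y => y + 1) m = ((Finset.range m).filter P).card := by
  induction m with
  | zero => simp [scanF]
  | succ m ih =>
    rw [scanF, Finset.range_add_one, Finset.filter_insert]
    split_ifs
    · rw [Finset.card_insert_of_notMem (by simp), ih]
    · exact ih

theorem scanF_const (P : ℕ → Prop) (m : ℕ) :
    (scanF P (fun _ _ => 1) m = 1 ∧ ∃ i < m, P i) ∨
      (scanF P (fun _ _ => 1) m = 0 ∧ ¬ ∃ i < m, P i) := by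
  induction m with
  | zero => simp [scanF]
  | succ m ih =>
    rw [scanF]
    by_cases h : P m
    · rw [if_pos h]
      exact .inl ⟨rfl, m, by omega, h⟩
    · rw [if_neg h]
      refine ih.imp (fun ⟨h1, i, h2, h3⟩ => ⟨h1, i, by omega, h3⟩)
        fun ⟨h1, h2⟩ => ⟨h1, fun ⟨i, hi, hP⟩ => h2 ⟨i, lt_of_le_of_ne (by omega) ?_, hP⟩⟩
      rintro rfl
      exact h hP

variable {B : ℕ} {inp : ℕ → ℕ}

/-- Set register `12` to a scan over `u < n`, with `u` in register `10` and `n` in register `b`. -/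
def scan (b : ℕ) (cond h : Ex) : Cm :=
  .set 12 (.c 0) ;; .for_ 10 b (.ite cond (.set 12 h) .skip)

theorem runs_scan {b : ℕ} {cond h : Ex} {σ : Store} {T : ℕ} {Q : Store → Prop} (N : ℕ)
    (P : ℕ → Prop) (hf : ℕ → ℕ → ℕ) (hN : σ.r b = N) (hNB : N ≤ B) (hb : b ∉ [10, 12])
    (hB : ∀ k ≤ N, scanF P hf k ≤ B)
    (hc : ∀ σ', Frame [10, 12] [] σ σ' → ∀ k < N, σ'.r 10 = k →
      (cond.val inp σ' ≠ 0 ↔ P k) ∧ h.val inp σ' = hf k (σ'.r 12))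
    (hQ : ∀ σ', Frame [10, 12] [] σ σ' → σ'.r 12 = scanF P hf N → Q σ')
    (hT : N * (cond.cost + h.cost + 11) + 8 ≤ T) : Runs B inp (scan b cond h) σ T Q := by
  have hb10 : b ≠ 10 := by rintro rfl; simp at hb
  have hb12 : b ≠ 12 := by rintro rfl; simp at hb
  refine Runs.seq (T₁ := 2) (T₂ := N * (cond.cost + h.cost + 11) + 6)
    (fun σ' => σ' = σ.setR 12 0) (Runs.of_wp (by simp) (by simp)) ?_ (by omega)
  rintro _ - rfl
  refine Runs.for_ (Tb := cond.cost + h.cost + 3) N (fun k σ' => σ'.r 12 = scanF P hf k)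
    (by simp [hb12, hN]) hNB (by simp) (by simp [hb10, hb12]) (by simp [scanF]) ?_ ?_
    (by rw [show cond.cost + h.cost + 3 + 8 = cond.cost + h.cost + 11 by omega])
  · intro k hk σ' hfr hi hI
    have hfr' : Frame [10, 12] [] σ σ' :=
      Frame.trans (Frame.setR (.refl σ) (by simp) _) (hfr.mono (by simp) (by simp))
    obtain ⟨h1, h2⟩ := hc σ' hfr' k hk hi
    have hBk := hB (k + 1) hk
    rw [scanF] at hBk
    refine Runs.of_wp ?_ (by simp; omega)
    simp only [Cm.wp, Store.setR_r, h2]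
    refine ⟨fun hne => ?_, fun he => ?_⟩
    · rw [if_pos (h1.1 hne)] at hBk
      simp [scanF, h1.1 hne, hI] at hBk ⊢
      exact hBk
    · have : ¬ P k := fun hP => h1.2 hP he
      simp [scanF, this, hI]
  · intro σ' hfr hI
    exact hQ σ' (Frame.trans (Frame.setR (.refl σ) (by simp) _) (hfr.mono (by simp) (by simp))) hI

/-- Fill array `j` with scans, one for each `v < n`, with `v` in register `11` and `n` in
register `b`. -/
def tabulate (b : ℕ) (j : Fin 16) (cond h : Ex) : Cm :=
  .for_ 11 b (scan b cond h ;; .put j (.v 11) (.v 12))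

@[simp] theorem wr_scan (b : ℕ) (cond h : Ex) : (scan b cond h).wr = [12, 10, 12, 10] := rfl
@[simp] theorem wa_scan (b : ℕ) (cond h : Ex) : (scan b cond h).wa = [] := rfl
@[simp] theorem wr_tabulate (b : ℕ) (j : Fin 16) (cond h : Ex) :
    (tabulate b j cond h).wr = [11, 12, 10, 12, 10, 11] := rfl
@[simp] theorem wa_tabulate (b : ℕ) (j : Fin 16) (cond h : Ex) :
    (tabulate b j cond h).wa = [j] := rfl

theorem runs_tabulate {b : ℕ} {j : Fin 16} {cond h : Ex} {σ : Store} {T : ℕ} {Q : Store → Prop}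
    (N : ℕ) (P : ℕ → ℕ → Prop) (hf : ℕ → ℕ → ℕ) (hN : σ.r b = N) (hNB : N ≤ B)
    (hb : b ∉ [10, 11, 12]) (hB : ∀ i < N, ∀ k ≤ N, scanF (P i) hf k ≤ B)
    (hc : ∀ σ', Frame [10, 11, 12] [j] σ σ' → ∀ i < N, ∀ k < N, σ'.r 11 = i → σ'.r 10 = k →
      (cond.val inp σ' ≠ 0 ↔ P i k) ∧ h.val inp σ' = hf k (σ'.r 12))
    (hQ : ∀ σ', Frame [10, 11, 12] [j] σ σ' → (∀ i < N, σ'.a j i = scanF (P i) hf N) → Q σ')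
    (hT : N * (N * (cond.cost + h.cost + 11) + 25) + 6 ≤ T) :
    Runs B inp (tabulate b j cond h) σ T Q := by
  have hb10 : b ≠ 10 := by rintro rfl; simp at hb
  have hb11 : b ≠ 11 := by rintro rfl; simp at hb
  have hb12 : b ≠ 12 := by rintro rfl; simp at hb
  refine Runs.for_ (Tb := N * (cond.cost + h.cost + 11) + 17) N
    (fun m σ' => ∀ i < m, σ'.a j i = scanF (P i) hf N)
    hN hNB (by simp) (by simp [hb10, hb11, hb12]) (by simp) ?_ ?_ hT
  · intro k hk σ' hfr hi hI
    have hfr' : Frame [10, 11, 12] [j] σ σ' := hfr.mono (by simp) (by simp)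
    refine Runs.seq (T₁ := N * (cond.cost + h.cost + 11) + 8) (T₂ := 9)
      (fun σ'' => σ''.r 12 = scanF (P k) hf N)
      (runs_scan N (P k) hf ((hfr'.r b hb).trans hN) hNB (by simp [hb10, hb12]) (hB k hk) ?_
        (fun _ _ h => h) le_rfl) ?_ le_rfl
    · intro σ'' hfr'' u hu hu'
      refine hc σ'' (hfr'.trans (hfr''.mono (by simp) (by simp))) k hk u hu ?_ hu'
      rw [hfr''.r 11 (by simp), hi]
    · intro σ'' hfr'' hI'
      refine Runs.of_wp ?_ (by simp)
      have h11 : σ''.r 11 = k := by rw [hfr''.r 11 (by simp), hi]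
      simp only [Cm.wp, Ex.val, h11, hI']
      refine ⟨hB k hk N le_rfl, fun i hi' => ?_⟩
      by_cases hik : i = k
      · subst hik; simp
      · have := hI i (by omega)
        simp [Function.update_of_ne hik, hfr''.a j (by simp), this]
  · intro σ' hfr hI
    exact hQ σ' (hfr.mono (by simp) (by simp)) hI

end ArrayMachine

/-! ## Matching two partitions

Two partitions of `{0, …, n - 1}` are given by class functions `f` and `g`. A set on which they
agree corresponds to a matching of classes; its largest size is computed with the Hungarian
method, where each `v < n` is an edge between `f v` and `g v`. -/

namespace PartitionMatching

open Finset

/-- `f` and `g` induce the same partition on `X`. -/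
def Agree (f g : ℕ → ℕ) (X : Finset ℕ) : Prop := ∀ u ∈ X, ∀ v ∈ X, f u = f v ↔ g u = g v

/-- The number of elements in the intersection of the classes of `v`. -/
def weight (n : ℕ) (f g : ℕ → ℕ) (v : ℕ) : ℕ :=
  ((range n).filter fun u => f u = f v ∧ g u = g v).card

/-- The class functions: the class of `a` is named after its largest element `f a`. -/
structure Classes (n : ℕ) (f g : ℕ → ℕ) : Prop where
  f_lt : ∀ v < n, f v < n
  g_lt : ∀ v < n, g v < n
  f_idem : ∀ v < n, f (f v) = f v
  le_f : ∀ v < n, v ≤ f v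

/-- Feasible potentials. -/
def Feasible (n : ℕ) (f g ya yb : ℕ → ℕ) : Prop :=
  ∀ v < n, weight n f g v ≤ ya (f v) + yb (g v)

/-- `ma` and `mb` describe a matching: `ma a = v + 1` if class `a` is matched by the edge `v`, and
`ma a = 0` if it is unmatched. -/
structure Matching (n : ℕ) (f g ma mb : ℕ → ℕ) : Prop where
  left : ∀ a < n, ∀ v, ma a = v + 1 → v < n ∧ f v = a ∧ mb (g v) = v + 1
  right : ∀ b < n, ∀ v, mb b = v + 1 → v < n ∧ g v = b ∧ ma (f v) = v + 1

/-- All matched edges are tight. -/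
def Tight (n : ℕ) (f g ya yb ma : ℕ → ℕ) : Prop :=
  ∀ a < n, ∀ v, ma a = v + 1 → ya (f v) + yb (g v) = weight n f g v

variable {n : ℕ} {f g ya yb ma mb : ℕ → ℕ}

/-- Weak duality. If the partitions agree on `X`, each `f`-class meeting `X` does so inside a single
`g`-class, and different `f`-classes use different `g`-classes. So the part of `X` in an `f`-class
is at most the weight of this pair of classes, hence at most the sum of its potentials, and no
potential is counted twice. -/
theorem card_le_of_agree (hc : Classes n f g) (hf : Feasible n f g ya yb) {X : Finset ℕ}
    (hX : X ⊆ range n) (h : Agree f g X) :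
    X.card ≤ ∑ a ∈ range n, ya a + ∑ b ∈ range n, yb b := by
  have hlt {v : ℕ} (hv : v ∈ X) : v < n := mem_range.1 (hX hv)
  have hex : ∀ a ∈ X.image f, ∃ v ∈ X, f v = a := fun a ha => by simpa using ha
  choose! r hrX hrf using hex
  have hfib : ∀ a ∈ X.image f, (X.filter fun v => f v = a).card ≤ ya a + yb (g (r a)) := by
    intro a ha
    have h1 := hf (r a) (hlt (hrX a ha))
    rw [hrf a ha] at h1
    refine le_trans (card_le_card ?_) h1
    intro v hv
    simp only [mem_filter] at hv ⊢
    refine ⟨hX hv.1, by rw [hv.2, hrf a ha], (h v hv.1 _ (hrX a ha)).1 (by rw [hv.2, hrf a ha])⟩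
  have hinj : Set.InjOn (fun a => g (r a)) (X.image f : Finset ℕ) := by
    intro a ha b hb hab
    have := (h _ (hrX a ha) _ (hrX b hb)).2 hab
    rwa [hrf a ha, hrf b hb] at this
  calc X.card = ∑ a ∈ X.image f, (X.filter fun v => f v = a).card :=
        card_eq_sum_card_image f X
    _ ≤ ∑ a ∈ X.image f, (ya a + yb (g (r a))) := sum_le_sum hfib
    _ = ∑ a ∈ X.image f, ya a + ∑ b ∈ (X.image f).image fun a => g (r a), yb b := by
        rw [sum_add_distrib, sum_image hinj]
    _ ≤ _ := by
        refine Nat.add_le_add (sum_le_sum_of_subset ?_) (sum_le_sum_of_subset ?_)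
        · intro a ha
          obtain ⟨v, hv, rfl⟩ := mem_image.1 ha
          exact mem_range.2 (hc.f_lt v (hlt hv))
        · intro b hb
          obtain ⟨a, ha, rfl⟩ := mem_image.1 hb
          exact mem_range.2 (hc.g_lt _ (hlt (hrX a ha)))

/-- Complementary slackness gives a set of size equal to the value of the potentials. -/
theorem exists_agree (hc : Classes n f g) (hm : Matching n f g ma mb)
    (ht : Tight n f g ya yb ma) (ha : ∀ a < n, ya a = 0 ∨ ma a ≠ 0)
    (hb : ∀ b < n, yb b ≠ 0 → mb b ≠ 0) :
    ∃ X ⊆ range n, Agree f g X ∧ X.card = ∑ a ∈ range n, ya a + ∑ b ∈ range n, yb b := by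
  classical
  set A := (range n).filter fun a => ma a ≠ 0 with hA
  have hAn {a : ℕ} (h : a ∈ A) : a < n := mem_range.1 (mem_filter.1 h).1
  have hl : ∀ a ∈ A, ∃ v, ma a = v + 1 ∧ v < n ∧ f v = a ∧ mb (g v) = v + 1 := by
    intro a h
    obtain ⟨v, hv⟩ := Nat.exists_eq_succ_of_ne_zero (mem_filter.1 h).2
    exact ⟨v, hv, hm.left a (hAn h) v hv⟩
  choose! r h1 h2 h3 h4 using hl
  have hinj : Set.InjOn (fun a => g (r a)) A := by
    intro a ha b hb hab
    have e1 := h4 a ha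
    have e2 := h4 b hb
    simp only at hab
    rw [hab, e2] at e1
    have : r a = r b := by omega
    rw [← h3 a ha, ← h3 b hb, this]
  -- The witness is the union of the intersections of matched pairs of classes. Tightness turns its
  -- size into a sum of potentials, and the unmatched classes contribute `0` to the totals.
  refine ⟨A.biUnion fun a => (range n).filter fun u => f u = f (r a) ∧ g u = g (r a), ?_, ?_, ?_⟩
  · intro u hu
    obtain ⟨a, -, hu⟩ := mem_biUnion.1 hu
    exact (mem_filter.1 hu).1
  · intro u hu v hv
    obtain ⟨a, ha, hu⟩ := mem_biUnion.1 hu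
    obtain ⟨b, hb, hv⟩ := mem_biUnion.1 hv
    obtain ⟨-, hu1, hu2⟩ := mem_filter.1 hu
    obtain ⟨-, hv1, hv2⟩ := mem_filter.1 hv
    rw [hu1, hu2, hv1, hv2, h3 a ha, h3 b hb]
    exact ⟨fun e => by rw [e], fun e => hinj ha hb e⟩
  · rw [card_biUnion]
    · have e1 : ∑ a ∈ A, (filter (fun u => f u = f (r a) ∧ g u = g (r a)) (range n)).card =
          ∑ a ∈ A, (ya a + yb (g (r a))) := by
        refine sum_congr rfl fun a ha => ?_
        have := ht a (hAn ha) _ (h1 a ha)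
        rw [h3 a ha] at this
        rw [this, weight]
      rw [e1, sum_add_distrib]
      congr 1
      · refine sum_subset (filter_subset _ _) fun a h h' => ?_
        have := ha a (mem_range.1 h)
        simp only [hA, mem_filter, h, true_and, not_not] at h'
        simpa [h'] using this
      · rw [← sum_image (g := fun a => g (r a)) (f := yb) hinj]
        refine sum_subset ?_ fun b h h' => ?_
        · intro b h
          obtain ⟨a, h', rfl⟩ := mem_image.1 h
          exact mem_range.2 (hc.g_lt _ (h2 a h'))
        · by_contra hy
          obtain ⟨v, hv⟩ := Nat.exists_eq_succ_of_ne_zero (hb b (mem_range.1 h) hy)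
          obtain ⟨e1, e2, e3⟩ := hm.right b (mem_range.1 h) v hv
          have hmem : f v ∈ A := by
            simp [hA, e3, hc.f_lt v e1]
          have e4 := h1 _ hmem
          rw [e3] at e4
          have : r (f v) = v := by omega
          exact h' (mem_image.2 ⟨f v, hmem, by simp only [this, e2]⟩)
    · intro a ha b hb hab
      refine disjoint_left.2 fun u hu hv => hab ?_
      obtain ⟨-, hu1, -⟩ := mem_filter.1 hu
      obtain ⟨-, hv1, -⟩ := mem_filter.1 hv
      rw [← h3 a ha, ← h3 b hb, ← hu1, ← hv1]

/-- The size of a largest set on which the partitions agree. -/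
def IsMaxAgree (n : ℕ) (f g : ℕ → ℕ) (m : ℕ) : Prop :=
  (∃ X ⊆ range n, Agree f g X ∧ X.card = m) ∧ ∀ X ⊆ range n, Agree f g X → X.card ≤ m

theorem isMaxAgree_of_potentials (hc : Classes n f g) (hm : Matching n f g ma mb)
    (hf : Feasible n f g ya yb) (ht : Tight n f g ya yb ma) (ha : ∀ a < n, ya a = 0 ∨ ma a ≠ 0)
    (hb : ∀ b < n, yb b ≠ 0 → mb b ≠ 0) :
    IsMaxAgree n f g (∑ a ∈ range n, ya a + ∑ b ∈ range n, yb b) :=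
  ⟨exists_agree hc hm ht ha hb, fun _ hX h => card_le_of_agree hc hf hX h⟩

end PartitionMatching

/-! ### Local changes of a matching, alternating trees and improvement of the potentials. -/

namespace PartitionMatching

open Finset

variable {n : ℕ} {f g ya yb ma mb par Q : ℕ → ℕ} {root qh qt p : ℕ}

theorem Matching.unmatch (hc : Classes n f g) (h : Matching n f g ma mb) {v : ℕ} (hv : v < n)
    (hma : ma (f v) = v + 1) :
    Matching n f g (Function.update ma (f v) 0) (Function.update mb (g v) 0) where
  left a ha u hu := by
    by_cases hav : a = f v
    · simp [hav] at hu
    · rw [Function.update_of_ne hav] at hu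
      obtain ⟨h1, h2, h3⟩ := h.left a ha u hu
      refine ⟨h1, h2, ?_⟩
      rw [Function.update_of_ne, h3]
      intro hg
      have h4 := (h.left (f v) (hc.f_lt v hv) v hma).2.2
      rw [← hg, h3] at h4
      obtain rfl : u = v := by omega
      exact hav h2.symm
  right b hb u hu := by
    by_cases hbv : b = g v
    · simp [hbv] at hu
    · rw [Function.update_of_ne hbv] at hu
      obtain ⟨h1, h2, h3⟩ := h.right b hb u hu
      refine ⟨h1, h2, ?_⟩
      rw [Function.update_of_ne, h3]
      intro hg
      rw [hg, hma] at h3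
      obtain rfl : u = v := by omega
      exact hbv h2.symm

theorem Matching.insert (h : Matching n f g ma mb) {v : ℕ} (hv : v < n)
    (hma : ma (f v) = 0) (hmb : mb (g v) = 0) :
    Matching n f g (Function.update ma (f v) (v + 1)) (Function.update mb (g v) (v + 1)) where
  left a ha u hu := by
    by_cases hav : a = f v
    · simp only [hav, Function.update_self, Nat.add_right_cancel_iff] at hu
      subst hu
      exact ⟨hv, hav.symm, by simp⟩
    · rw [Function.update_of_ne hav] at hu
      obtain ⟨h1, h2, h3⟩ := h.left a ha u hu
      refine ⟨h1, h2, ?_⟩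
      rw [Function.update_of_ne, h3]
      intro hg
      rw [hg, hmb] at h3
      omega
  right b hb u hu := by
    by_cases hbv : b = g v
    · simp only [hbv, Function.update_self, Nat.add_right_cancel_iff] at hu
      subst hu
      exact ⟨hv, hbv.symm, by simp⟩
    · rw [Function.update_of_ne hbv] at hu
      obtain ⟨h1, h2, h3⟩ := h.right b hb u hu
      refine ⟨h1, h2, ?_⟩
      rw [Function.update_of_ne, h3]
      intro hg
      rw [hg, hma] at h3
      omega

theorem Matching.replace (hc : Classes n f g) (h : Matching n f g ma mb) {v u : ℕ} (hv : v < n)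
    (hma : ma (f v) = u + 1) (hmb : mb (g v) = 0) :
    Matching n f g (Function.update ma (f v) (v + 1))
      (Function.update (Function.update mb (g u) 0) (g v) (v + 1)) := by
  obtain ⟨h1, h2, h3⟩ := h.left _ (hc.f_lt v hv) u hma
  have h4 := h.unmatch hc h1 (by rw [h2, hma])
  have h5 := h4.insert hv (by simp [h2]) (by
    by_cases hg : g v = g u
    · simp [hg]
    · rw [Function.update_of_ne hg, hmb])
  -- Since `f u = f v`, removing `u` and inserting `v` write the same entry of `ma`, so the two
  -- updates merge.
  rwa [h2, Function.update_idem] at h5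

theorem Tight.update_succ (h : Tight n f g ya yb ma) {v : ℕ}
    (hv : ya (f v) + yb (g v) = weight n f g v) :
    Tight n f g ya yb (Function.update ma (f v) (v + 1)) := by
  intro a ha u hu
  by_cases hav : a = f v
  · simp only [hav, Function.update_self, Nat.add_right_cancel_iff] at hu
    exact hu ▸ hv
  · rw [Function.update_of_ne hav] at hu
    exact h a ha u hu

theorem Tight.update_zero (h : Tight n f g ya yb ma) (a : ℕ) :
    Tight n f g ya yb (Function.update ma a 0) := by
  intro b hb u hu
  by_cases hab : b = a
  · simp [hab] at hu
  · rw [Function.update_of_ne hab] at hu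
    exact h b hb u hu

/-! ### Search for an augmenting path -/

/-- Class `b` was reached along a tight edge from one of the first `i` classes in the queue. -/
def Link (n : ℕ) (f g ya yb par Q : ℕ → ℕ) (i b : ℕ) : Prop :=
  ∃ v < n, par b = v + 1 ∧ g v = b ∧ ya (f v) + yb (g v) = weight n f g v ∧ ∃ j < i, f v = Q j

/-- The queue `Q 0, …, Q (m - 1)` with the pointers `par` describes an alternating tree. -/
structure Tree (n : ℕ) (f g ya yb ma par Q : ℕ → ℕ) (root m : ℕ) : Prop where
  pos : 0 < m
  root_eq : Q 0 = root
  root_free : ma root = 0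
  inj : ∀ i j, i < j → j < m → Q i ≠ Q j
  lt : ∀ i < m, Q i < n
  step : ∀ i, 0 < i → i < m → ∃ v, ma (Q i) = v + 1 ∧ Link n f g ya yb par Q i (g v)

/-- The edges that still have to be looked at, where `p` is the pointer into the current class
`Q (qh - 1)`. -/
def Rem (n : ℕ) (f Q : ℕ → ℕ) (qh p v : ℕ) : Prop :=
  v < n ∧ ((∀ i < qh, f v ≠ Q i) ∨ (0 < qh ∧ f v = Q (qh - 1) ∧ v < p))

open Classical in
/-- The number of edges that still have to be looked at. -/
noncomputable def remCard (n : ℕ) (f Q : ℕ → ℕ) (qh p : ℕ) : ℕ :=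
  ((range n).filter (Rem n f Q qh p)).card

/-- The invariant of the search. -/
structure Search (n : ℕ) (f g ya yb ma par Q : ℕ → ℕ) (root qh qt p : ℕ) : Prop extends
    Tree n f g ya yb ma par Q root qt where
  ya_pos : ∀ i < qt, ya (Q i) ≠ 0
  idem : ∀ i < qt, f (Q i) = Q i
  vis : ∀ b < n, par b ≠ 0 → ∃ i, 0 < i ∧ i < qt ∧ ∃ v, ma (Q i) = v + 1 ∧ g v = b
  qh_le : qh ≤ qt
  cur : ∀ v, p = v + 1 → 0 < qh ∧ v < n ∧ f v = Q (qh - 1)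
  proc : ∀ v < n, ¬ Rem n f Q qh p v →
    par (g v) ≠ 0 ∨ weight n f g v < ya (f v) + yb (g v)
  card : ((range n).filter fun b => par b ≠ 0).card + 1 = qt
  meas : qt + remCard n f Q qh p ≤ n + 1

theorem Search.init {Q : ℕ → ℕ} (hroot : root < n) (hf : f root = root) (hy : ya root ≠ 0)
    (hma : ma root = 0) (hpar : ∀ b < n, par b = 0) (hQ : Q 0 = root) :
    Search n f g ya yb ma par Q root 0 1 0 where
  pos := one_pos
  root_eq := hQ
  root_free := hma
  inj i j h1 h2 := by omega
  lt i hi := by obtain rfl : i = 0 := by omega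
                rwa [hQ]
  step i h1 h2 := by omega
  ya_pos i hi := by obtain rfl : i = 0 := by omega
                    rwa [hQ]
  idem i hi := by obtain rfl : i = 0 := by omega
                  rwa [hQ]
  vis b hb h := absurd (hpar b hb) h
  qh_le := by omega
  cur v h := by omega
  proc v hv h := absurd ⟨hv, .inl fun i hi => by omega⟩ h
  card := by
    rw [filter_false_of_mem, card_empty]
    intro b hb
    simpa using hpar b (mem_range.1 hb)
  meas := by
    classical
    have := card_filter_le (range n) (Rem n f Q 0 0)
    rw [card_range] at this
    unfold remCard
    omega

/-- A class is named after its largest element, so the pointer `Q qh + 1`, which stands for the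
element `Q qh`, is the right start for running down the whole class: taking a class from the queue
neither loses nor adds an edge. -/
theorem Search.rem_fetch (hc : Classes n f g)
    (h : Search n f g ya yb ma par Q root qh qt 0) (hq : qh < qt) (v : ℕ) :
    Rem n f Q (qh + 1) (Q qh + 1) v ↔ Rem n f Q qh 0 v := by
  constructor
  · rintro ⟨hv, h1 | ⟨-, h1, h2⟩⟩
    · exact ⟨hv, .inl fun i hi => h1 i (by omega)⟩
    · refine ⟨hv, .inl fun i hi => ?_⟩
      rw [h1]
      exact (h.inj i qh hi hq).symm
  · rintro ⟨hv, h1 | ⟨-, h1, h2⟩⟩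
    · refine ⟨hv, ?_⟩
      by_cases hQ : f v = Q qh
      · refine .inr ⟨by omega, by simpa using hQ, ?_⟩
        have := hc.le_f v hv
        omega
      · refine .inl fun i hi => ?_
        obtain rfl | hi' := Nat.eq_or_lt_of_le (Nat.le_of_lt_succ hi)
        · exact hQ
        · exact h1 i hi'
    · omega

theorem Search.remCard_fetch (hc : Classes n f g)
    (h : Search n f g ya yb ma par Q root qh qt 0) (hq : qh < qt) :
    remCard n f Q (qh + 1) (Q qh + 1) = remCard n f Q qh 0 := by
  classical
  unfold remCard
  congr 1
  exact filter_congr fun v _ => h.rem_fetch hc hq v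

theorem Search.fetch (hc : Classes n f g)
    (h : Search n f g ya yb ma par Q root qh qt 0) (hq : qh < qt) :
    Search n f g ya yb ma par Q root (qh + 1) qt (Q qh + 1) where
  toTree := h.toTree
  ya_pos := h.ya_pos
  idem := h.idem
  vis := h.vis
  qh_le := hq
  cur v hv := by
    obtain rfl : Q qh = v := by omega
    exact ⟨by omega, h.lt qh hq, by simpa using h.idem qh hq⟩
  proc v hv hr := h.proc v hv (by rwa [← h.rem_fetch hc hq])
  card := h.card
  meas := by rw [h.remCard_fetch hc hq]; exact h.meas

/-- `nx` points to the previous element of the same class. -/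
def IsNext (n : ℕ) (f nx : ℕ → ℕ) : Prop :=
  ∀ v < n, (∀ u, nx v = u + 1 → u < v ∧ f u = f v) ∧ ∀ u < v, f u = f v → u < nx v

/-- Pointers are shifted by one, with `0` as the null pointer. No element of the class lies strictly
between the one behind `nx v` and `v`, so exactly `v` drops out. -/
theorem Search.rem_next {nx : ℕ → ℕ} (hnx : IsNext n f nx) {v : ℕ}
    (h : Search n f g ya yb ma par Q root qh qt (v + 1)) (u : ℕ) :
    Rem n f Q qh (nx v) u ↔ Rem n f Q qh (v + 1) u ∧ u ≠ v := by
  obtain ⟨h1, h2, h3⟩ := h.cur v rfl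
  obtain ⟨h4, h5⟩ := hnx v h2
  have h6 : nx v ≤ v := by
    cases hx : nx v with
    | zero => omega
    | succ w => exact (h4 w hx).1
  constructor
  · rintro ⟨hu, hl | ⟨-, hl, hl'⟩⟩
    · refine ⟨⟨hu, .inl hl⟩, ?_⟩
      rintro rfl
      exact hl _ (by omega) h3
    · exact ⟨⟨hu, .inr ⟨h1, hl, by omega⟩⟩, by omega⟩
  · rintro ⟨⟨hu, hl | ⟨-, hl, hl'⟩⟩, hne⟩
    · exact ⟨hu, .inl hl⟩
    · exact ⟨hu, .inr ⟨h1, hl, h5 u (by omega) (by rw [hl, h3])⟩⟩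

theorem Search.remCard_next {nx : ℕ → ℕ} (hnx : IsNext n f nx) {v : ℕ}
    (h : Search n f g ya yb ma par Q root qh qt (v + 1)) :
    remCard n f Q qh (nx v) + 1 = remCard n f Q qh (v + 1) := by
  classical
  obtain ⟨h1, h2, h3⟩ := h.cur v rfl
  have hmem : v ∈ (range n).filter (Rem n f Q qh (v + 1)) :=
    mem_filter.2 ⟨mem_range.2 h2, h2, .inr ⟨h1, h3, by omega⟩⟩
  have : (range n).filter (Rem n f Q qh (nx v)) =
      ((range n).filter (Rem n f Q qh (v + 1))).erase v := by
    ext u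
    simp only [mem_filter, mem_erase, h.rem_next hnx]
    tauto
  rw [remCard, remCard, this]
  exact card_erase_add_one hmem

theorem cur_next {nx : ℕ → ℕ} (hnx : IsNext n f nx) {v : ℕ} (hv : v < n)
    (hq : 0 < qh) (hf : f v = Q (qh - 1)) :
    ∀ u, nx v = u + 1 → 0 < qh ∧ u < n ∧ f u = Q (qh - 1) := by
  intro u hu
  obtain ⟨h1, h2⟩ := (hnx v hv).1 u hu
  exact ⟨hq, by omega, by rw [h2, hf]⟩

theorem Search.skip {nx : ℕ → ℕ} (hnx : IsNext n f nx) {v : ℕ}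
    (h : Search n f g ya yb ma par Q root qh qt (v + 1))
    (hv : par (g v) ≠ 0 ∨ weight n f g v < ya (f v) + yb (g v)) :
    Search n f g ya yb ma par Q root qh qt (nx v) where
  toTree := h.toTree
  ya_pos := h.ya_pos
  idem := h.idem
  vis := h.vis
  qh_le := h.qh_le
  cur := by
    obtain ⟨h1, h2, h3⟩ := h.cur v rfl
    exact cur_next hnx h2 h1 h3
  proc u hu hr := by
    rw [h.rem_next hnx] at hr
    by_cases huv : u = v
    · exact huv ▸ hv
    · exact h.proc u hu fun hr' => hr ⟨hr', huv⟩
  card := h.card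
  meas := by have := h.remCard_next hnx; have := h.meas; omega

theorem Link.update {par Q par' Q' : ℕ → ℕ} {i b : ℕ} (h : Link n f g ya yb par Q i b)
    (hp : ∀ b, par b ≠ 0 → par' b = par b) (hQ : ∀ j < i, Q' j = Q j) :
    Link n f g ya yb par' Q' i b := by
  obtain ⟨v, h1, h2, h3, h4, j, h5, h6⟩ := h
  exact ⟨v, h1, by rw [hp _ (by omega), h2], h3, h4, j, h5, by rw [hQ j h5, h6]⟩

/-- The invariant on the queue persists when a class is reached for the first time. -/
theorem Search.tree_update {v : ℕ} (h : Search n f g ya yb ma par Q root qh qt (v + 1))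
    (hp : par (g v) = 0) :
    Tree n f g ya yb ma (Function.update par (g v) (v + 1)) Q root qt where
  pos := h.pos
  root_eq := h.root_eq
  root_free := h.root_free
  inj := h.inj
  lt := h.lt
  step i h0 hi := by
    obtain ⟨u, h1, h2⟩ := h.step i h0 hi
    refine ⟨u, h1, h2.update (fun b hb => ?_) fun _ _ => rfl⟩
    rw [Function.update_of_ne]
    rintro rfl
    exact hb hp

theorem Search.link_update {v : ℕ} (h : Search n f g ya yb ma par Q root qh qt (v + 1))
    (ht : ya (f v) + yb (g v) = weight n f g v) :
    Link n f g ya yb (Function.update par (g v) (v + 1)) Q qt (g v) := by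
  obtain ⟨h1, h2, h3⟩ := h.cur v rfl
  have := h.qh_le
  exact ⟨v, h2, by simp, rfl, ht, qh - 1, by omega, h3⟩

/-- The root is unmatched, and every other class in the queue is the partner of a class that has
been visited. So the partner of an unvisited class is new. -/
theorem Search.not_mem {v u : ℕ} (h : Search n f g ya yb ma par Q root qh qt (v + 1))
    (hp : par (g v) = 0) (hu : ma (f u) = u + 1) (hg : g u = g v) : ∀ i < qt, Q i ≠ f u := by
  intro i hi he
  rcases Nat.eq_zero_or_pos i with rfl | hi0
  · rw [h.root_eq] at he
    have := h.root_free
    rw [he] at this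
    omega
  · obtain ⟨w, h1, h2⟩ := h.step i hi0 hi
    rw [he, hu] at h1
    obtain rfl : u = w := by omega
    obtain ⟨x, -, h3, -⟩ := h2
    rw [hg, hp] at h3
    omega

theorem rem_update (hq : qh ≤ qt) (a : ℕ) {p w : ℕ} :
    Rem n f (Function.update Q qt a) qh p w ↔ Rem n f Q qh p w := by
  have hQ : ∀ j < qh, Function.update Q qt a j = Q j := fun j hj =>
    Function.update_of_ne (by omega) _ _
  unfold Rem
  have h1 : (∀ i < qh, f w ≠ Function.update Q qt a i) ↔ ∀ i < qh, f w ≠ Q i :=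
    forall₂_congr fun i hi => by rw [hQ i hi]
  have h2 : (0 < qh ∧ f w = Function.update Q qt a (qh - 1) ∧ w < p) ↔
      (0 < qh ∧ f w = Q (qh - 1) ∧ w < p) :=
    and_congr_right fun h0 => by rw [hQ (qh - 1) (by omega)]
  rw [h1, h2]

theorem remCard_update (hq : qh ≤ qt) (a : ℕ) {p : ℕ} :
    remCard n f (Function.update Q qt a) qh p = remCard n f Q qh p := by
  classical
  unfold remCard
  congr 1
  exact filter_congr fun w _ => rem_update hq a

/-- The tree grows by the tight edge `v` and the matched edge `u`. The queue gets one longer while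
one edge is used up, which keeps `meas` and thus the bound `n + 1` on the queue length. -/
theorem Search.push {nx : ℕ → ℕ} (hc : Classes n f g) (hnx : IsNext n f nx)
    (hm : Matching n f g ma mb) {v u : ℕ}
    (h : Search n f g ya yb ma par Q root qh qt (v + 1)) (hp : par (g v) = 0)
    (ht : ya (f v) + yb (g v) = weight n f g v) (hu : mb (g v) = u + 1) (hy : ya (f u) ≠ 0) :
    Search n f g ya yb ma (Function.update par (g v) (v + 1)) (Function.update Q qt (f u)) root
      qh (qt + 1) (nx v) := by
  obtain ⟨c1, c2, c3⟩ := h.cur v rfl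
  obtain ⟨m1, m2, m3⟩ := hm.right (g v) (hc.g_lt v c2) u hu
  have hnot := h.not_mem hp m3 m2
  have hQ : ∀ j < qt, Function.update Q qt (f u) j = Q j := fun j hj =>
    Function.update_of_ne (by omega) _ _
  have hqt : Function.update Q qt (f u) qt = f u := Function.update_self _ _ _
  have htree := h.tree_update hp
  have hqh := h.qh_le
  have hrem : ∀ p w, Rem n f (Function.update Q qt (f u)) qh p w ↔ Rem n f Q qh p w :=
    fun p w => rem_update hqh _
  refine ⟨⟨by omega, ?_, h.root_free, ?_, ?_, ?_⟩, ?_, ?_, ?_, by omega, ?_, ?_, ?_, ?_⟩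
  · rw [hQ 0 h.pos, h.root_eq]
  · intro i j hij hj
    rw [hQ i (by omega)]
    obtain rfl | hj' := Nat.eq_or_lt_of_le (Nat.le_of_lt_succ hj)
    · rw [hqt]; exact hnot i hij
    · rw [hQ j hj']; exact h.inj i j hij hj'
  · intro i hi
    obtain rfl | hi' := Nat.eq_or_lt_of_le (Nat.le_of_lt_succ hi)
    · rw [hqt]; exact hc.f_lt u m1
    · rw [hQ i hi']; exact h.lt i hi'
  · intro i h0 hi
    obtain rfl | hi' := Nat.eq_or_lt_of_le (Nat.le_of_lt_succ hi)
    · rw [hqt]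
      refine ⟨u, m3, ?_⟩
      rw [m2]
      exact (h.link_update ht).update (fun _ _ => rfl) hQ
    · rw [hQ i hi']
      obtain ⟨w, h1, h2⟩ := htree.step i h0 hi'
      exact ⟨w, h1, h2.update (fun _ _ => rfl) fun j hj => hQ j (by omega)⟩
  · intro i hi
    obtain rfl | hi' := Nat.eq_or_lt_of_le (Nat.le_of_lt_succ hi)
    · rwa [hqt]
    · rw [hQ i hi']; exact h.ya_pos i hi'
  · intro i hi
    obtain rfl | hi' := Nat.eq_or_lt_of_le (Nat.le_of_lt_succ hi)
    · rw [hqt]; exact hc.f_idem u m1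
    · rw [hQ i hi']; exact h.idem i hi'
  · intro b hb hpb
    by_cases hbv : b = g v
    · exact ⟨qt, h.pos, by omega, u, by rw [hqt, m3], by rw [m2, hbv]⟩
    · rw [Function.update_of_ne hbv] at hpb
      obtain ⟨i, h1, h2, w, h3, h4⟩ := h.vis b hb hpb
      exact ⟨i, h1, by omega, w, by rw [hQ i h2, h3], h4⟩
  · rw [hQ (qh - 1) (by omega)]
    exact cur_next hnx c2 c1 c3
  · intro w hw hr
    rw [hrem, h.rem_next hnx] at hr
    by_cases hwv : w = v
    · left; subst hwv; simp
    · rcases h.proc w hw fun hr' => hr ⟨hr', hwv⟩ with h' | h'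
      · left
        by_cases hgw : g w = g v
        · rw [hgw]; simp
        · rwa [Function.update_of_ne hgw]
      · exact .inr h'
  · have : (range n).filter (fun b => Function.update par (g v) (v + 1) b ≠ 0) =
        insert (g v) ((range n).filter fun b => par b ≠ 0) := by
      ext b
      by_cases hbv : b = g v
      · subst hbv; simp [hc.g_lt v c2]
      · simp [hbv]
    rw [this, card_insert_of_notMem (by simp [hp]), h.card]
  · have h1 := h.remCard_next hnx
    have h2 := h.meas
    rw [remCard_update hqh]
    omega

/-- Any prefix of the queue is again a tree, for any matching that is unchanged on it. This serves
to cut the tree during an augmentation, and to take the partner away from a class outside the tree.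
-/
theorem Tree.congr {ma' : ℕ → ℕ} {m : ℕ} (h : Tree n f g ya yb ma par Q root qt) (h0 : 0 < m)
    (hm : m ≤ qt) (he : ∀ i < m, ma' (Q i) = ma (Q i)) :
    Tree n f g ya yb ma' par Q root m where
  pos := h0
  root_eq := h.root_eq
  root_free := by
    have := he 0 h0
    rw [h.root_eq] at this
    rw [this, h.root_free]
  inj i j h1 h2 := h.inj i j h1 (by omega)
  lt i hi := h.lt i (by omega)
  step i h1 h2 := by rw [he i h2]; exact h.step i h1 (by omega)

/-! ### Augmentation -/

/-- The state during an augmentation: class `b` is unmatched and connected to the root by the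
alternating tree with `i` nodes. -/
structure Augment (n : ℕ) (f g ya yb ma mb par Q : ℕ → ℕ) (root i b : ℕ) : Prop where
  matching : Matching n f g ma mb
  tight : Tight n f g ya yb ma
  tree : Tree n f g ya yb ma par Q root i
  link : Link n f g ya yb par Q i b
  free : mb b = 0
  pos : ∀ b' < n, b' ≠ b → yb b' ≠ 0 → mb b' ≠ 0

/-- The start of an augmentation at an unmatched class. -/
theorem Search.found {v : ℕ} (hm : Matching n f g ma mb)
    (ht : Tight n f g ya yb ma) (hpos : ∀ b < n, yb b ≠ 0 → mb b ≠ 0)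
    (h : Search n f g ya yb ma par Q root qh qt (v + 1)) (hp : par (g v) = 0)
    (hv : ya (f v) + yb (g v) = weight n f g v) (hfree : mb (g v) = 0) :
    Augment n f g ya yb ma mb (Function.update par (g v) (v + 1)) Q root qt (g v) :=
  ⟨hm, ht, h.tree_update hp, h.link_update hv, hfree, fun b hb _ => hpos b hb⟩

/-- The start of an augmentation that takes the partner away from a class with potential `0`. -/
theorem Search.swap (hc : Classes n f g) {v u : ℕ} (hm : Matching n f g ma mb)
    (ht : Tight n f g ya yb ma) (hpos : ∀ b < n, yb b ≠ 0 → mb b ≠ 0)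
    (h : Search n f g ya yb ma par Q root qh qt (v + 1)) (hp : par (g v) = 0)
    (hv : ya (f v) + yb (g v) = weight n f g v) (hu : mb (g v) = u + 1) :
    Augment n f g ya yb (Function.update ma (f u) 0) (Function.update mb (g v) 0)
      (Function.update par (g v) (v + 1)) Q root qt (g v) := by
  obtain ⟨c1, c2, c3⟩ := h.cur v rfl
  obtain ⟨m1, m2, m3⟩ := hm.right (g v) (hc.g_lt v c2) u hu
  have hnot := h.not_mem hp m3 m2
  refine ⟨?_, ht.update_zero _, ?_, h.link_update hv, by simp, ?_⟩
  · have := hm.unmatch hc m1 m3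
    rwa [m2] at this
  · exact (h.tree_update hp).congr h.pos le_rfl fun i hi => Function.update_of_ne (hnot i hi) _ _
  · intro b hb hbv hy
    rw [Function.update_of_ne hbv]
    exact hpos b hb hy

/-- The last step of an augmentation. -/
theorem Augment.finish {i b v : ℕ}
    (h : Augment n f g ya yb ma mb par Q root i b) (hv : par b = v + 1) (hma : ma (f v) = 0) :
    Matching n f g (Function.update ma (f v) (v + 1)) (Function.update mb b (v + 1)) ∧
    Tight n f g ya yb (Function.update ma (f v) (v + 1)) ∧
    (∀ b' < n, yb b' ≠ 0 → Function.update mb b (v + 1) b' ≠ 0) ∧ f v = root := by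
  obtain ⟨u, h1, h2, rfl, h4, j, h5, h6⟩ := h.link
  obtain rfl : u = v := by omega
  refine ⟨h.matching.insert h1 hma h.free, h.tight.update_succ h4, fun b' hb hy => ?_, ?_⟩
  · by_cases hbb : b' = g u
    · simp [hbb]
    · rw [Function.update_of_ne hbb]; exact h.pos b' hb hbb hy
  -- All nodes of the tree other than the root are matched, so the unmatched node `f v` is the root.
  · rcases Nat.eq_zero_or_pos j with rfl | hj
    · rw [h6, h.tree.root_eq]
    · obtain ⟨w, hw, -⟩ := h.tree.step j hj h5
      rw [← h6] at hw
      omega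

/-- One step of an augmentation. -/
theorem Augment.step (hc : Classes n f g) {i b v u : ℕ}
    (h : Augment n f g ya yb ma mb par Q root i b) (hv : par b = v + 1)
    (hma : ma (f v) = u + 1) :
    ∃ j < i, Augment n f g ya yb (Function.update ma (f v) (v + 1))
      (Function.update (Function.update mb (g u) 0) b (v + 1)) par Q root j (g u) := by
  -- The node `f v` is `Q j` with `j < i`. Matching it by `v` frees its old partner `g u`, which the
  -- tree links to a node before `j`; so the nodes from `j` on are no longer needed.
  obtain ⟨w, h1, h2, rfl, h4, j, h5, h6⟩ := h.link
  obtain rfl : w = v := by omega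
  have hj : 0 < j := by
    rcases Nat.eq_zero_or_pos j with rfl | hj
    · have := h.tree.root_free
      rw [← h.tree.root_eq, ← h6] at this
      omega
    · exact hj
  obtain ⟨m1, m2, m3⟩ := h.matching.left _ (hc.f_lt _ h1) u hma
  have hne : g u ≠ g w := by
    intro he
    rw [he, h.free] at m3
    omega
  refine ⟨j, h5, h.matching.replace hc h1 hma h.free, h.tight.update_succ h4, ?_, ?_, ?_, ?_⟩
  · refine h.tree.congr hj h5.le fun k hk => Function.update_of_ne ?_ _ _
    rw [h6]
    exact h.tree.inj k j hk h5
  · obtain ⟨x, hx, hl⟩ := h.tree.step j hj h5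
    rw [← h6, hma] at hx
    obtain rfl : u = x := by omega
    exact hl
  · rw [Function.update_of_ne hne, Function.update_self]
  · intro b' hb hbu hy
    by_cases hbb : b' = g w
    · simp [hbb]
    · rw [Function.update_of_ne hbb, Function.update_of_ne hbu]
      exact h.pos b' hb hbb hy

/-! ### Change of the potentials -/

/-- A failed search leads to better potentials. -/
theorem Search.dual (hc : Classes n f g) (hm : Matching n f g ma mb)
    (ht : Tight n f g ya yb ma) (hf : Feasible n f g ya yb)
    (hpos : ∀ b < n, yb b ≠ 0 → mb b ≠ 0)
    (h : Search n f g ya yb ma par Q root qt qt 0) {ya' yb' : ℕ → ℕ}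
    (hya : ∀ a, ya' a = open Classical in if ∃ i < qt, Q i = a then ya a - 1 else ya a)
    (hyb : ∀ b < n, yb' b = if par b ≠ 0 then yb b + 1 else yb b) :
    Feasible n f g ya' yb' ∧ Tight n f g ya' yb' ma ∧ (∀ b < n, yb' b ≠ 0 → mb b ≠ 0) ∧
      ∑ a ∈ range n, ya' a + ∑ b ∈ range n, yb' b + 1 =
        ∑ a ∈ range n, ya a + ∑ b ∈ range n, yb b := by
  classical
  have hmb {b : ℕ} (hb : b < n) (hp : par b ≠ 0) :
      ∃ i, 0 < i ∧ i < qt ∧ ∃ v, ma (Q i) = v + 1 ∧ g v = b ∧ f v = Q i ∧ mb b = v + 1 := by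
    obtain ⟨i, h1, h2, v, h3, h4⟩ := h.vis b hb hp
    obtain ⟨h5, h6, h7⟩ := hm.left _ (h.lt i h2) v h3
    exact ⟨i, h1, h2, v, h3, h4, h6, h4 ▸ h7⟩
  have hy1 {a : ℕ} (ha : ∃ i < qt, Q i = a) : 1 ≤ ya a := by
    obtain ⟨i, hi, rfl⟩ := ha
    exact Nat.one_le_iff_ne_zero.2 (h.ya_pos i hi)
  refine ⟨?_, ?_, ?_, ?_⟩
  · intro v hv
    have h0 := hf v hv
    rw [hya, hyb _ (hc.g_lt v hv)]
    by_cases hQ : ∃ i < qt, Q i = f v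
    · rw [if_pos hQ]
      have h1 := hy1 hQ
      obtain ⟨i, hi, hQ⟩ := hQ
      -- The queue is exhausted, so this edge has been looked at: either its second class was
      -- visited and gains the `1` that the first one loses, or there was slack to absorb the loss.
      have hnr : ¬ Rem n f Q qt 0 v := by
        rintro ⟨-, h' | ⟨-, -, h'⟩⟩
        · exact h' i hi hQ.symm
        · omega
      rcases h.proc v hv hnr with h' | h'
      · rw [if_pos h']; omega
      · split_ifs <;> omega
    · rw [if_neg hQ]
      split_ifs <;> omega
  · intro a ha v hv
    obtain ⟨h1, h2, h3⟩ := hm.left a ha v hv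
    have h0 := ht a ha v hv
    -- A matched edge has both ends in the tree or neither, so the changes of the potentials cancel
    -- along it.
    have hiff : (∃ i < qt, Q i = f v) ↔ par (g v) ≠ 0 := by
      constructor
      · rintro ⟨i, hi, hQ⟩
        rcases Nat.eq_zero_or_pos i with rfl | hi0
        · have := h.root_free
          rw [← h.root_eq, hQ, h2] at this
          omega
        · obtain ⟨w, h4, h5⟩ := h.step i hi0 hi
          rw [hQ, h2, hv] at h4
          obtain rfl : v = w := by omega
          obtain ⟨x, -, h6, -⟩ := h5
          omega
      · intro hp
        obtain ⟨i, -, h4, w, h5, h6, h7, h8⟩ := hmb (hc.g_lt v h1) hp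
        rw [h3] at h8
        obtain rfl : v = w := by omega
        exact ⟨i, h4, h7.symm⟩
    rw [hya, hyb _ (hc.g_lt v h1)]
    by_cases hQ : ∃ i < qt, Q i = f v
    · have := hy1 hQ
      rw [if_pos hQ, if_pos (hiff.1 hQ)]
      omega
    · rw [if_neg hQ, if_neg fun h' => hQ (hiff.2 h')]
      exact h0
  · intro b hb hy
    rw [hyb b hb] at hy
    split_ifs at hy with hp
    · obtain ⟨i, -, -, v, -, -, -, h'⟩ := hmb hb hp
      omega
    · exact hpos b hb hy
  -- The `qt` distinct classes in the queue lose `1` each, and by `h.card` only `qt - 1` visited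
  -- classes gain `1`. The difference is the root.
  · have e1 : ∑ a ∈ range n, ya a = ∑ a ∈ range n, ya' a + qt := by
      have hcard : ((range n).filter fun a => ∃ i < qt, Q i = a).card = qt := by
        have : ((range n).filter fun a => ∃ i < qt, Q i = a) = (range qt).image Q := by
          ext a
          simp only [mem_filter, mem_range, mem_image]
          exact ⟨fun h' => h'.2, fun ⟨i, hi, e⟩ => ⟨e ▸ h.lt i hi, i, hi, e⟩⟩
        rw [this, card_image_of_injOn, card_range]
        intro i hi j hj hij
        simp only [coe_range, Set.mem_Iio] at hi hj
        rcases lt_trichotomy i j with h' | h' | h'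
        · exact absurd hij (h.inj i j h' hj)
        · exact h'
        · exact absurd hij.symm (h.inj j i h' hi)
      rw [← hcard, card_filter, ← sum_add_distrib]
      refine sum_congr rfl fun a _ => ?_
      rw [hya]
      split_ifs with hQ
      · have := hy1 hQ; omega
      · omega
    have e2 : ∑ b ∈ range n, yb' b =
        ∑ b ∈ range n, yb b + ((range n).filter fun b => par b ≠ 0).card := by
      rw [card_filter, ← sum_add_distrib]
      refine sum_congr rfl fun b hb => ?_
      rw [hyb b (mem_range.1 hb)]
      split_ifs <;> omega
    have := h.card
    omega

end PartitionMatching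

/-! ### The matching program

Registers: `0` holds `n`, `16` the value of the potentials, `17` the root. Arrays: `2`, `3` hold the
class functions, `4` the weights, `5` the pointers to previous elements, `6`, `7` the potentials,
`8`, `9` the matching, `10` the search tree, `11` the queue. -/

namespace PartitionMatching

open Finset WordRAM ArrayMachine

/-- The arrays `2`–`5` are set up for the partitions `f` and `g`. -/
structure Setup (n : ℕ) (f g : ℕ → ℕ) (σ : Store) : Prop where
  n_eq : σ.r 0 = n
  f_eq : σ.a 2 = f
  g_eq : σ.a 3 = g
  wt : ∀ v < n, σ.a 4 v = weight n f g v
  next : IsNext n f (σ.a 5)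

theorem Setup.frame {n f g σ σ' R A} (h : Setup n f g σ) (hf : Frame R A σ σ')
    (hR : 0 ∉ R) (h2 : 2 ∉ A) (h3 : 3 ∉ A) (h4 : 4 ∉ A) (h5 : 5 ∉ A) : Setup n f g σ' where
  n_eq := (hf.r 0 hR).trans h.n_eq
  f_eq := (hf.a 2 h2).trans h.f_eq
  g_eq := (hf.a 3 h3).trans h.g_eq
  wt v hv := by rw [hf.a 4 h4, h.wt v hv]
  next := by rw [hf.a 5 h5]; exact h.next

/-- Potentials with a matching of tight edges. -/
structure Potentials (n : ℕ) (f g ya yb ma mb : ℕ → ℕ) (tot : ℕ) : Prop where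
  matching : Matching n f g ma mb
  tight : Tight n f g ya yb ma
  feasible : Feasible n f g ya yb
  pos : ∀ b < n, yb b ≠ 0 → mb b ≠ 0
  idem : ∀ a < n, ya a ≠ 0 → f a = a
  sum : ∑ a ∈ range n, ya a + ∑ b ∈ range n, yb b = tot
  tot_le : tot ≤ n

variable {B : ℕ} {inp : ℕ → ℕ} {n : ℕ} {f g : ℕ → ℕ}

/-- Take the next class from the queue if the current one is exhausted. -/
def fetchCm : Cm :=
  .ite (.op .eq (.v 18) (.c 0))
    (.set 18 (.op .add (.get 11 (.v 19)) (.c 1)) ;; .set 19 (.op .add (.v 19) (.c 1))) .skip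

/-- Look at the edge in register `22`, whose second class is in register `23`. -/
def edgeCm : Cm :=
  .ite (.op .mul (.op .eq (.get 10 (.v 23)) (.c 0))
      (.op .eq (.op .add (.get 6 (.get 2 (.v 22))) (.get 7 (.v 23))) (.get 4 (.v 22))))
    (.put 10 (.v 23) (.op .add (.v 22) (.c 1)) ;;
      .ite (.get 9 (.v 23))
        (.set 24 (.get 2 (.op .sub (.get 9 (.v 23)) (.c 1))) ;;
          .ite (.get 6 (.v 24))
            (.put 11 (.v 20) (.v 24) ;; .set 20 (.op .add (.v 20) (.c 1)))
            (.put 8 (.v 24) (.c 0) ;; .put 9 (.v 23) (.c 0) ;;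
              .set 21 (.op .add (.v 23) (.c 1))))
        (.set 21 (.op .add (.v 23) (.c 1))))
    .skip

/-- The body of the search loop. -/
def searchBody : Cm :=
  fetchCm ;; .set 22 (.op .sub (.v 18) (.c 1)) ;; .set 18 (.get 5 (.v 22)) ;;
    .set 23 (.get 3 (.v 22)) ;; edgeCm

/-- Breadth-first search from the root for an augmenting path. Register `18` is the pointer into
the current class, `19` and `20` are the ends of the queue, `21` points to the end of a path. -/
def searchCm : Cm :=
  .for_ 13 0 (.put 10 (.v 13) (.c 0)) ;;
  (.put 11 (.c 0) (.v 17) ;; .set 19 (.c 0) ;; .set 20 (.c 1) ;; .set 18 (.c 0) ;;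
    .set 21 (.c 0)) ;;
  .loop (.op .mul (.op .eq (.v 21) (.c 0)) (.op .add (.v 18) (.op .lt (.v 19) (.v 20)))) searchBody

/-- The state after a successful search. -/
structure Found (n : ℕ) (f g : ℕ → ℕ) (σ₀ σ : Store) : Prop where
  augment : ∃ b < n, σ.r 21 = b + 1 ∧
    Augment n f g (σ.a 6) (σ.a 7) (σ.a 8) (σ.a 9) (σ.a 10) (σ.a 11) (σ.r 17) (σ.r 20) b
  qt_le : σ.r 20 ≤ n + 1
  keep : ∀ a, σ₀.a 6 a = 0 ∨ σ₀.a 8 a ≠ 0 → σ.a 6 a = 0 ∨ σ.a 8 a ≠ 0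

/-- The state of an unfinished search. -/
structure Searching (n : ℕ) (f g : ℕ → ℕ) (σ₀ σ : Store) : Prop where
  fin : σ.r 21 = 0
  ma : σ.a 8 = σ₀.a 8
  mb : σ.a 9 = σ₀.a 9
  search : Search n f g (σ.a 6) (σ.a 7) (σ.a 8) (σ.a 10) (σ.a 11) (σ.r 17) (σ.r 19) (σ.r 20)
    (σ.r 18)

/-- The number of edges a search still has to look at. -/
noncomputable def searchMeasure (n : ℕ) (f : ℕ → ℕ) (σ : Store) : ℕ :=
  remCard n f (σ.a 11) (σ.r 19) (σ.r 18)

theorem runs_fetch {σ₀ σ : Store} (hB : 2 * n + 2 ≤ B) (hc : Classes n f g)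
    (hs : Searching n f g σ₀ σ) (hcont : σ.r 18 ≠ 0 ∨ σ.r 19 < σ.r 20) :
    Runs B inp fetchCm σ 30 fun σ' =>
      Searching n f g σ₀ σ' ∧ σ'.r 18 ≠ 0 ∧ searchMeasure n f σ' = searchMeasure n f σ := by
  refine Runs.of_wp ?_ (by simp [fetchCm])
  simp only [fetchCm, Cm.wp, Ex.val, BinOp.eval]
  refine ⟨fun h => ?_, fun h => ?_⟩
  · have hp : σ.r 18 = 0 := by by_contra hne; simp [hne] at h
    have hq : σ.r 19 < σ.r 20 := hcont.resolve_left (by simp [hp])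
    have hS := hs.search
    have hlt := hS.lt _ hq
    have hm := hS.meas
    rw [hp] at hS
    refine ⟨by omega, by simp; omega, ⟨by simpa using hs.fin, hs.ma, hs.mb, ?_⟩, by simp, ?_⟩
    · simpa using hS.fetch hc hq
    · simpa [searchMeasure, hp] using hS.remCard_fetch hc hq
  · have hp : σ.r 18 ≠ 0 := by intro he; simp [he] at h
    exact ⟨hs, hp, trivial⟩

/-- There are four cases. An edge that is not tight or leads to a visited class is skipped.
Otherwise its second class is unmatched (`Search.found`), or its partner has positive potential and
joins the queue (`Search.push`), or its partner has potential `0` and is given up (`Search.swap`).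
`σ₀` is the store at the start of the search. -/
theorem runs_edge {σ₀ σ : Store} {tot : ℕ} (hB : 2 * n + 2 ≤ B) (hc : Classes n f g)
    (hset : Setup n f g σ)
    (hpot : Potentials n f g (σ.a 6) (σ.a 7) (σ₀.a 8) (σ₀.a 9) tot) (h6 : σ.a 6 = σ₀.a 6)
    {v : ℕ} (hs : Search n f g (σ.a 6) (σ.a 7) (σ.a 8) (σ.a 10) (σ.a 11) (σ.r 17) (σ.r 19)
      (σ.r 20) (v + 1)) (hfin : σ.r 21 = 0) (hma : σ.a 8 = σ₀.a 8) (hmb : σ.a 9 = σ₀.a 9)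
    (hp : σ.r 18 = σ.a 5 v) (hv : σ.r 22 = v) (hb : σ.r 23 = g v) :
    Runs B inp edgeCm σ 200 fun σ' =>
      (Searching n f g σ₀ σ' ∨ Found n f g σ₀ σ') ∧
        searchMeasure n f σ' < remCard n f (σ.a 11) (σ.r 19) (v + 1) := by
  obtain ⟨c1, c2, c3⟩ := hs.cur v rfl
  have hrem := hs.remCard_next hset.next
  have hmeas := hs.meas
  have hgv := hc.g_lt v c2
  have hfe := hset.f_eq
  rw [← hma, ← hmb] at hpot
  refine Runs.of_wp ?_ (by simp [edgeCm])
  simp only [edgeCm, Cm.wp, Ex.val, BinOp.eval, hv, hb, hfe, hset.wt v c2]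
  refine ⟨fun h => ?_, fun h => ?_⟩
  · have h1 : σ.a 10 (g v) = 0 := by by_contra hne; simp [hne] at h
    have h2 : σ.a 6 (f v) + σ.a 7 (g v) = weight n f g v := by
      by_contra hne; simp [hne] at h
    clear h
    refine ⟨by omega, fun h => ?_, fun h => ?_⟩
    · simp only [Store.setA_a, Store.setA_r, hb, Fin.reduceEq, if_false] at h
      obtain ⟨u, hu⟩ := Nat.exists_eq_succ_of_ne_zero h
      have hu' : σ.a 9 (g v) = u + 1 := hu
      obtain ⟨m1, m2, m3⟩ := hpot.matching.right (g v) hgv u hu'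
      have hfu := hc.f_lt u m1
      simp only [Store.setA_a, Store.setA_r, Store.setR_a, Store.setR_r, hb, hu', hfe,
        Fin.reduceEq, Nat.reduceEqDiff, if_true, if_false, Nat.add_sub_cancel]
      refine ⟨by omega, fun hy => ⟨by omega, by omega, .inl ⟨?_, ?_, ?_, ?_⟩, ?_⟩,
        fun hy => ⟨by omega, by omega, by omega, .inr ⟨?_, ?_, ?_⟩, ?_⟩⟩
      · simpa using hfin
      · simpa using hma
      · simpa using hmb
      · have := hs.push hc hset.next hpot.matching h1 h2 hu' hy
        simpa [hp] using this
      · simp [searchMeasure, hp, remCard_update hs.qh_le]; omega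
      · refine ⟨g v, hgv, by simp, ?_⟩
        have := hs.swap hc hpot.matching hpot.tight hpot.pos h1 h2 hu'
        simpa using this
      · simp; omega
      -- The only class that loses its partner has potential `0`, so complementary slackness
      -- survives.
      · intro a ha
        by_cases hau : a = f u
        · left; simpa [hau] using hy
        · simpa [hau, hma, h6] using ha
      · simp [searchMeasure, hp]; omega
    · simp only [Store.setA_a, Store.setA_r, hb, Fin.reduceEq, if_false] at h
      simp only [Store.setA_r, hb]
      refine ⟨by omega, .inr ⟨⟨g v, hgv, by simp, ?_⟩, ?_, ?_⟩, ?_⟩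
      · have := hs.found hpot.matching hpot.tight hpot.pos h1 h2 h
        simpa using this
      · simp; omega
      · intro a ha
        simpa [hma, h6] using ha
      · simp [searchMeasure, hp]; omega
  · have h' : σ.a 10 (g v) ≠ 0 ∨ weight n f g v < σ.a 6 (f v) + σ.a 7 (g v) := by
      by_contra hne
      push Not at hne
      have := hpot.feasible v c2
      have he : σ.a 6 (f v) + σ.a 7 (g v) = weight n f g v := by omega
      simp [hne.1, he] at h
    refine ⟨.inl ⟨hfin, hma, hmb, ?_⟩, ?_⟩
    · rw [hp]; exact hs.skip hset.next h'
    · simp only [searchMeasure, hp]; omega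

end PartitionMatching

/-! ### Linear time for search, augmentation and change of the potentials. -/

namespace PartitionMatching

open Finset WordRAM ArrayMachine

variable {B : ℕ} {inp : ℕ → ℕ} {n : ℕ} {f g : ℕ → ℕ}

theorem runs_searchBody {σ₀ σ : Store} {tot : ℕ} (hB : 2 * n + 2 ≤ B) (hc : Classes n f g)
    (hset : Setup n f g σ)
    (hpot : Potentials n f g (σ.a 6) (σ.a 7) (σ₀.a 8) (σ₀.a 9) tot) (h6 : σ.a 6 = σ₀.a 6)
    (hs : Searching n f g σ₀ σ) (hcont : σ.r 18 ≠ 0 ∨ σ.r 19 < σ.r 20) :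
    Runs B inp searchBody σ 252 fun σ' =>
      (Searching n f g σ₀ σ' ∨ Found n f g σ₀ σ') ∧ searchMeasure n f σ' < searchMeasure n f σ := by
  refine Runs.seq (T₁ := 30) (T₂ := 222) _ (runs_fetch hB hc hs hcont) ?_ le_rfl
  rintro σ₁ hf₁ ⟨hs₁, hp, hm⟩
  have hset₁ : Setup n f g σ₁ := hset.frame hf₁ (by decide) (by decide) (by decide) (by decide)
    (by decide)
  have h6₁ : σ₁.a 6 = σ.a 6 := hf₁.a 6 (by decide)
  have h7₁ : σ₁.a 7 = σ.a 7 := hf₁.a 7 (by decide)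
  obtain ⟨v, hv⟩ := Nat.exists_eq_succ_of_ne_zero hp
  have hv' : σ₁.r 18 = v + 1 := hv
  have hS := hs₁.search
  rw [hv'] at hS
  obtain ⟨c1, c2, c3⟩ := hS.cur v rfl
  have hgv := hc.g_lt v c2
  have hnx : σ₁.a 5 v ≤ n := by
    cases hx : σ₁.a 5 v with
    | zero => omega
    | succ w => have := ((hset₁.next v c2).1 w hx).1; omega
  refine Runs.seq (T₁ := 4) (T₂ := 218) (fun σ' => σ' = σ₁.setR 22 v)
    (Runs.of_wp (by simp [BinOp.eval, hv']; omega) (by simp)) ?_ le_rfl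
  rintro _ - rfl
  refine Runs.seq (T₁ := 9) (T₂ := 209) (fun σ' => σ' = (σ₁.setR 22 v).setR 18 (σ₁.a 5 v))
    (Runs.of_wp (by simp; omega) (by simp)) ?_ le_rfl
  rintro _ - rfl
  refine Runs.seq (T₁ := 9) (T₂ := 200)
    (fun σ' => σ' = ((σ₁.setR 22 v).setR 18 (σ₁.a 5 v)).setR 23 (g v))
    (Runs.of_wp (by simp [hset₁.g_eq]; omega) (by simp)) ?_ le_rfl
  rintro _ - rfl
  refine (runs_edge (σ₀ := σ₀) (v := v) (tot := tot) hB hc ?_ ?_ ?_ ?_ ?_ ?_ ?_ ?_ ?_ ?_).mono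
    le_rfl fun σ' _ h => ⟨h.1, ?_⟩
  · exact ⟨by simpa using hset₁.n_eq, hset₁.f_eq, hset₁.g_eq, hset₁.wt, hset₁.next⟩
  · simpa [h6₁, h7₁] using hpot
  · simp [h6₁, h6]
  · simpa using hS
  · simpa using hs₁.fin
  · simpa using hs₁.ma
  · simpa using hs₁.mb
  · simp
  · simp
  · simp
  · have := h.2
    rw [← hm, show searchMeasure n f σ₁ = remCard n f (σ₁.a 11) (σ₁.r 19) (v + 1) by
      rw [searchMeasure, hv']]
    simpa using this

theorem remCard_le (n : ℕ) (f Q : ℕ → ℕ) (qh p : ℕ) : remCard n f Q qh p ≤ n := by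
  classical
  refine (card_filter_le _ _).trans ?_
  rw [card_range]

/-- Each round uses up one of the at most `n` remaining edges, so linear time follows from constant
cost per round. -/
theorem runs_search {σ : Store} {tot : ℕ} (hB : 2 * n + 2 ≤ B) (hc : Classes n f g)
    (hset : Setup n f g σ) (hpot : Potentials n f g (σ.a 6) (σ.a 7) (σ.a 8) (σ.a 9) tot)
    (hr : σ.r 17 < n) (hy : σ.a 6 (σ.r 17) ≠ 0) (hma : σ.a 8 (σ.r 17) = 0) :
    Runs B inp searchCm σ (300 * (n + 1)) fun σ' =>
      (Searching n f g σ σ' ∧ σ'.r 18 = 0 ∧ σ'.r 19 = σ'.r 20) ∨ Found n f g σ σ' := by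
  refine Runs.seq (T₁ := n * 17 + 6) (T₂ := n * 262 + 27) (fun σ' => ∀ b < n, σ'.a 10 b = 0)
    (Runs.for_ (Tb := 9) n (fun k σ' => ∀ b < k, σ'.a 10 b = 0) hset.n_eq (by omega)
      (by simp) (by simp) (by simp) ?_ (fun _ _ h => h) le_rfl) ?_ (by omega)
  · intro k hk σ' hf hi hI
    refine Runs.of_wp ?_ (by simp)
    simp only [Cm.wp, Ex.val]
    refine ⟨by omega, fun b hb => ?_⟩
    by_cases hbk : b = k
    · simp [hi, hbk]
    · have := hI b (by omega)
      simp [hi, Function.update_of_ne hbk, this]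
  intro σ₁ hf₁ hpar
  refine Runs.seq (T₁ := 17) (T₂ := n * 262 + 10) (fun σ' => Searching n f g σ σ')
    (Runs.of_wp ?_ (by simp)) ?_ (by omega)
  · have h17 : σ₁.r 17 = σ.r 17 := hf₁.r 17 (by decide)
    have h6 : σ₁.a 6 = σ.a 6 := hf₁.a 6 (by decide)
    have h8 : σ₁.a 8 = σ.a 8 := hf₁.a 8 (by decide)
    simp only [Cm.wp, Ex.val]
    refine ⟨by omega, by omega, by omega, by omega, by omega, by simp, ?_, ?_, ?_⟩
    · simpa using h8
    · simpa using hf₁.a 9 (by decide)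
    · have := Search.init (n := n) (g := g) (ya := σ.a 6) (yb := σ₁.a 7) (ma := σ.a 8)
        (par := σ₁.a 10) (Q := Function.update (σ₁.a 11) 0 (σ.r 17)) hr
        (hpot.idem _ hr hy) hy hma hpar (by simp)
      simpa [h17, h6, h8] using this
  intro σ₂ hf₂ hs₂
  have hf₁₂ := hf₁.mono (R' := searchCm.wr) (A' := searchCm.wa) (by decide) (by decide)
  have hf₂' := hf₁₂.trans (hf₂.mono (R' := searchCm.wr) (A' := searchCm.wa) (by decide) (by decide))
  refine Runs.loop (Tb := 252) (fun σ' => Searching n f g σ σ' ∨ Found n f g σ σ')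
    (searchMeasure n f) (.inl hs₂) ?_ ?_ ?_
  · intro σ₃ hf₃ hI he
    have hf₃' := hf₂'.trans
      (hf₃.mono (R' := searchCm.wr) (A' := searchCm.wa) (by decide) (by decide))
    simp only [Ex.val, BinOp.eval] at he
    rcases hI with hI | hI
    · have hcont : σ₃.r 18 ≠ 0 ∨ σ₃.r 19 < σ₃.r 20 := by
        by_contra hne
        push Not at hne
        simp [hne.1, not_lt.2 hne.2] at he
      refine runs_searchBody (tot := tot) hB hc
        (hset.frame hf₃' (by decide) (by decide) (by decide) (by decide) (by decide)) ?_
        (hf₃'.a 6 (by decide)) hI hcont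
      rw [hf₃'.a 6 (by decide), hf₃'.a 7 (by decide)]
      exact hpot
    · obtain ⟨b, -, hb, -⟩ := hI.augment
      simp [hb] at he
  · intro σ₃ hf₃ hI he
    simp only [Ex.val, BinOp.eval] at he
    rcases hI with hI | hI
    · left
      have h1 := hI.search.qh_le
      have h18 : σ₃.r 18 = 0 := by
        by_contra hne
        simp [hI.fin, hne] at he
      refine ⟨hI, h18, ?_⟩
      by_contra hne
      have : σ₃.r 19 < σ₃.r 20 := by omega
      simp [hI.fin, this] at he
    · exact .inr hI
  · have h1 : searchMeasure n f σ₂ ≤ n := remCard_le n f (σ₂.a 11) (σ₂.r 19) (σ₂.r 18)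
    have h2 := Nat.mul_le_mul_right 262 h1
    simp only [Ex.cost, Nat.reduceAdd]
    exact Nat.add_le_add_right h2 10

/-! ### Augmentation and change of the potentials -/

/-- The body of the augmentation loop. -/
def augmentBody : Cm :=
  .set 23 (.op .sub (.v 18) (.c 1)) ;; .set 22 (.op .sub (.get 10 (.v 23)) (.c 1)) ;;
  .set 24 (.get 8 (.get 2 (.v 22))) ;;
  .ite (.v 24)
    (.put 9 (.get 3 (.op .sub (.v 24) (.c 1))) (.c 0) ;;
      .set 18 (.op .add (.get 3 (.op .sub (.v 24) (.c 1))) (.c 1)))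
    (.set 18 (.c 0)) ;;
  .put 8 (.get 2 (.v 22)) (.op .add (.v 22) (.c 1)) ;; .put 9 (.v 23) (.op .add (.v 22) (.c 1))

/-- Augmentation along the path found by the search. -/
def augmentCm : Cm := .set 18 (.v 21) ;; .loop (.v 18) augmentBody

/-- The state after an augmentation. -/
structure Augmented (n : ℕ) (f g : ℕ → ℕ) (σ₀ σ : Store) : Prop where
  fin : σ.r 18 = 0
  matching : Matching n f g (σ.a 8) (σ.a 9)
  tight : Tight n f g (σ.a 6) (σ.a 7) (σ.a 8)
  pos : ∀ b < n, σ.a 7 b ≠ 0 → σ.a 9 b ≠ 0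
  root : σ.a 8 (σ.r 17) ≠ 0
  keep : ∀ a, σ₀.a 8 a ≠ 0 → σ.a 8 a ≠ 0

theorem runs_augmentBody {σ₀ σ : Store} (hB : 2 * n + 2 ≤ B) (hc : Classes n f g)
    (hset : Setup n f g σ) {i b : ℕ} (hb : b < n) (h18 : σ.r 18 = b + 1)
    (h : Augment n f g (σ.a 6) (σ.a 7) (σ.a 8) (σ.a 9) (σ.a 10) (σ.a 11) (σ.r 17) i b)
    (hkeep : ∀ a, σ₀.a 8 a ≠ 0 → σ.a 8 a ≠ 0) :
    Runs B inp augmentBody σ 150 fun σ' => Augmented n f g σ₀ σ' ∨ ∃ j < i, ∃ b < n,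
      σ'.r 18 = b + 1 ∧
      Augment n f g (σ'.a 6) (σ'.a 7) (σ'.a 8) (σ'.a 9) (σ'.a 10) (σ'.a 11) (σ'.r 17) j b ∧
      ∀ a, σ₀.a 8 a ≠ 0 → σ'.a 8 a ≠ 0 := by
  obtain ⟨v, hv, hpar, hg, -⟩ := h.link
  have hfv := hc.f_lt v hv
  have hfe := hset.f_eq
  have hge := hset.g_eq
  have hma : σ.a 8 (f v) ≤ n := by
    cases hx : σ.a 8 (f v) with
    | zero => omega
    | succ u => exact (h.matching.left _ hfv u hx).1
  refine Runs.of_wp ?_ (by simp [augmentBody])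
  simp only [augmentBody, Cm.wp, Ex.val, BinOp.eval, Store.setR_r, Store.setR_a, h18, hpar,
    Nat.reduceEqDiff, if_true, if_false, Nat.add_sub_cancel, hfe, hge]
  refine ⟨by omega, by omega, by omega, fun h0 => ?_, fun h0 => ?_⟩
  · obtain ⟨u, hu⟩ := Nat.exists_eq_succ_of_ne_zero h0
    have hu' : σ.a 8 (f v) = u + 1 := hu
    have hun := (h.matching.left _ hfv u hu').1
    have hgu := hc.g_lt u hun
    obtain ⟨j, hj, hA⟩ := h.step hc hpar hu'
    simp only [hu', Nat.add_sub_cancel, Store.setA_a, Fin.reduceEq, if_false, hge, hfe,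
      Store.setA_r, Store.setR_a, Store.setR_r, if_true, Nat.reduceEqDiff]
    refine ⟨by omega, by omega, by omega, by omega, .inr ⟨j, hj, g u, hgu, rfl, hA, ?_⟩⟩
    intro a ha
    by_cases hav : a = f v
    · simp [hav]
    · rw [Function.update_of_ne hav]; exact hkeep a ha
  · obtain ⟨h1, h2, h3, h4⟩ := h.finish hpar h0
    simp only [Store.setA_a, Fin.reduceEq, if_false,
      Store.setA_r, Store.setR_a, Store.setR_r, if_true, Nat.reduceEqDiff]
    refine ⟨by omega, by omega, by omega, .inl ⟨by simp, ?_, ?_, ?_, ?_, ?_⟩⟩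
    · simpa using h1
    · simpa using h2
    · simpa using h3
    · simp [h4]
    · intro a ha
      by_cases hav : a = f v
      · simp [hav]
      · simpa [Function.update_of_ne hav] using hkeep a ha

/-- The number of rounds is bounded by the length of the prefix of the queue still in use. This
length is stored in no register, hence the loop rule with an index. -/
theorem runs_augment {σ₀ σ : Store} (hB : 2 * n + 2 ≤ B) (hc : Classes n f g)
    (hset : Setup n f g σ) (h : Found n f g σ₀ σ) :
    Runs B inp augmentCm σ (200 * (n + 2)) (Augmented n f g σ) := by
  obtain ⟨b, hb, h21, hA⟩ := h.augment
  refine Runs.seq (T₁ := 2) (T₂ := (n + 2) * 152 + 2) (fun σ' => σ' = σ.setR 18 (b + 1))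
    (Runs.of_wp (by simp [h21]; omega) (by simp)) ?_ (by omega)
  rintro _ - rfl
  refine Runs.loop_of_index (Tb := 150) (fun k σ' => Augmented n f g σ σ' ∨ ∃ b < n,
      σ'.r 18 = b + 1 ∧
      Augment n f g (σ'.a 6) (σ'.a 7) (σ'.a 8) (σ'.a 9) (σ'.a 10) (σ'.a 11) (σ'.r 17) k b ∧
      ∀ a, σ.a 8 a ≠ 0 → σ'.a 8 a ≠ 0) (σ.r 20)
    (.inr ⟨b, hb, by simp, by simpa using hA, fun a ha => ha⟩) ?_ ?_ ?_
  · rintro k σ' hf (hI | ⟨b, hb, h18, hA, hkeep⟩) he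
    · exact absurd hI.fin he
    · have hset' : Setup n f g σ' := Setup.frame
        (hset.frame (Frame.setR (R := [18]) (A := []) (.refl σ) (by simp) _) (by decide) (by decide)
          (by decide) (by decide) (by decide)) hf (by decide) (by decide) (by decide) (by decide)
        (by decide)
      refine (runs_augmentBody hB hc hset' hb h18 hA hkeep).mono le_rfl ?_
      rintro σ'' - (h | ⟨j, hj, h⟩)
      -- When the path is finished any smaller index will do; `k` is positive because a tree
      -- contains its root.
      · refine ⟨k - 1, ?_, .inl h⟩
        have := hA.tree.pos
        omega
      · exact ⟨j, hj, .inr h⟩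
  · rintro k σ' hf (hI | ⟨b, hb, h18, hA, hkeep⟩) he
    · exact hI
    · simp [h18] at he
  · have := Nat.mul_le_mul_right 152 h.qt_le
    simp only [Ex.cost]
    omega

/-- Change of the potentials after an unsuccessful search. -/
def dualCm : Cm :=
  .for_ 13 20 (.put 6 (.get 11 (.v 13)) (.op .sub (.get 6 (.get 11 (.v 13))) (.c 1))) ;;
  .for_ 13 0 (.ite (.get 10 (.v 13)) (.put 7 (.v 13) (.op .add (.get 7 (.v 13)) (.c 1))) .skip) ;;
  .set 16 (.op .sub (.v 16) (.c 1))

-- The entries of the queue are distinct, so running through it lowers each potential only once. The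
-- number `16` is lowered along with the total it records.
open Classical in
theorem runs_dual {σ : Store} (hB : 2 * n + 2 ≤ B) (hn : σ.r 0 = n) (hq : σ.r 20 ≤ n + 1)
    (h16 : σ.r 16 ≤ n) (h6 : ∀ i < σ.r 20, σ.a 6 (σ.a 11 i) ≤ n) (h7 : ∀ b < n, σ.a 7 b ≤ n)
    (hinj : ∀ i j, i < j → j < σ.r 20 → σ.a 11 i ≠ σ.a 11 j) :
    Runs B inp dualCm σ (100 * (n + 1)) fun σ' =>
      (∀ a, σ'.a 6 a = if ∃ i < σ.r 20, σ.a 11 i = a then σ.a 6 a - 1 else σ.a 6 a) ∧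
      (∀ b < n, σ'.a 7 b = if σ.a 10 b ≠ 0 then σ.a 7 b + 1 else σ.a 7 b) ∧
      σ'.r 16 = σ.r 16 - 1 := by
  refine Runs.seq (T₁ := σ.r 20 * 42 + 6) (T₂ := n * 40 + 10)
    (fun σ' => ∀ a, σ'.a 6 a = if ∃ i < σ.r 20, σ.a 11 i = a then σ.a 6 a - 1 else σ.a 6 a)
    (Runs.for_ (Tb := 34) (σ.r 20)
      (fun k σ' => ∀ a, σ'.a 6 a = if ∃ i < k, σ.a 11 i = a then σ.a 6 a - 1 else σ.a 6 a)
      rfl (by omega) (by simp) (by simp) (by simp) ?_ (fun _ _ h => h) le_rfl) ?_ (by omega)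
  · intro k hk σ' hf hi hI
    have h11 : σ'.a 11 = σ.a 11 := hf.a 11 (by decide)
    refine Runs.of_wp ?_ (by simp)
    have hk6 : σ'.a 6 (σ.a 11 k) = σ.a 6 (σ.a 11 k) := by
      rw [hI, if_neg]
      rintro ⟨i, hik, he⟩
      exact hinj i k hik hk he
    have := h6 k hk
    simp only [Cm.wp, Ex.val, BinOp.eval, hi, h11, hk6]
    refine ⟨by omega, fun a => ?_⟩
    by_cases ha : a = σ.a 11 k
    · subst ha
      have : ∃ i < k + 1, σ.a 11 i = σ.a 11 k := ⟨k, by omega, rfl⟩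
      rw [if_pos this]
      simp
    · have : (∃ i < k + 1, σ.a 11 i = a) ↔ ∃ i < k, σ.a 11 i = a := by
        refine ⟨fun ⟨i, h1, h2⟩ => ⟨i, lt_of_le_of_ne (by omega) ?_, h2⟩,
          fun ⟨i, h1, h2⟩ => ⟨i, by omega, h2⟩⟩
        rintro rfl
        exact ha h2.symm
      simp only [this]
      simpa [Function.update_of_ne ha] using hI a
  intro σ₁ hf₁ hI₁
  have h10 : σ₁.a 10 = σ.a 10 := hf₁.a 10 (by decide)
  have h7e : σ₁.a 7 = σ.a 7 := hf₁.a 7 (by decide)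
  have h16e : σ₁.r 16 = σ.r 16 := hf₁.r 16 (by decide)
  refine Runs.seq (T₁ := n * 40 + 6) (T₂ := 4)
    (fun σ' => ∀ b < n, σ'.a 7 b = if σ.a 10 b ≠ 0 then σ.a 7 b + 1 else σ.a 7 b)
    (Runs.for_ (Tb := 32) n (fun k σ' => ∀ b < n, σ'.a 7 b =
        if b < k ∧ σ.a 10 b ≠ 0 then σ.a 7 b + 1 else σ.a 7 b)
      ((hf₁.r 0 (by decide)).trans hn) (by omega) (by simp) (by simp) (by simp [h7e]) ?_
      ?_ le_rfl) ?_ (by omega)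
  · intro k hk σ' hf hi hI
    have h10' : σ'.a 10 = σ.a 10 := (hf.a 10 (by decide)).trans h10
    refine Runs.of_wp ?_ (by simp)
    have hk7 : σ'.a 7 k = σ.a 7 k := by rw [hI k hk]; simp
    have := h7 k hk
    simp only [Cm.wp, Ex.val, BinOp.eval, hi, h10', hk7]
    refine ⟨fun hne => ⟨by omega, fun b hb => ?_⟩, fun he b hb => ?_⟩
    · by_cases hbk : b = k
      · subst hbk; simp [hne]
      · have : (b < k + 1 ∧ σ.a 10 b ≠ 0) ↔ (b < k ∧ σ.a 10 b ≠ 0) :=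
          and_congr_left fun _ => by omega
        simp only [this]
        simpa [Function.update_of_ne hbk] using hI b hb
    · have : (b < k + 1 ∧ σ.a 10 b ≠ 0) ↔ (b < k ∧ σ.a 10 b ≠ 0) :=
        and_congr_left fun h' => by
          have : b ≠ k := by rintro rfl; exact h' he
          omega
      simp only [this]
      simpa using hI b hb
  · intro σ' hf hI b hb
    rw [hI b hb]
    simp [hb]
  · intro σ₂ hf₂ hI₂
    have h16e₂ : σ₂.r 16 = σ.r 16 := (hf₂.r 16 (by decide)).trans h16e
    have h6e₂ : σ₂.a 6 = σ₁.a 6 := hf₂.a 6 (by decide)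
    refine Runs.of_wp ?_ (by simp)
    simp only [Cm.wp, Ex.val, BinOp.eval, h16e₂]
    refine ⟨by omega, ?_, ?_, ?_⟩
    · simpa [h6e₂] using hI₁
    · simpa using hI₂
    · simp

end PartitionMatching

/-! ### The phases of the Hungarian method and its quadratic running time. -/

namespace PartitionMatching

open Finset WordRAM ArrayMachine

variable {B : ℕ} {inp : ℕ → ℕ} {n : ℕ} {f g : ℕ → ℕ}

/-- One phase of the Hungarian method: search from the root, then either augment and proceed to the
next root, or change the potentials. -/
def phaseCm : Cm :=
  searchCm ;; .ite (.v 21) (augmentCm ;; .set 17 (.op .add (.v 17) (.c 1))) dualCm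

/-- The state of the Hungarian method: all classes before the root are done. -/
structure Progress (n : ℕ) (f g : ℕ → ℕ) (σ : Store) : Prop where
  setup : Setup n f g σ
  pot : Potentials n f g (σ.a 6) (σ.a 7) (σ.a 8) (σ.a 9) (σ.r 16)
  root_le : σ.r 17 ≤ n
  done : ∀ a < σ.r 17, σ.a 6 a = 0 ∨ σ.a 8 a ≠ 0

/-- The potentials stay as they are and the root becomes matched, so it can be advanced. Classes
done earlier stay done: the search gives up only a partner of a class with potential `0`, and the
augmentation unmatches no left class. -/
theorem runs_phase_augment {σ σ₁ : Store} (hB : 2 * n + 2 ≤ B) (hc : Classes n f g)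
    (h : Progress n f g σ) (hr : σ.r 17 < n) (hf₁ : Frame searchCm.wr searchCm.wa σ σ₁)
    (hF : Found n f g σ σ₁) :
    Runs B inp (augmentCm ;; .set 17 (.op .add (.v 17) (.c 1))) σ₁ (200 * (n + 2) + 4) fun σ' =>
      Progress n f g σ' ∧ n - σ'.r 17 + σ'.r 16 < n - σ.r 17 + σ.r 16 := by
  have hset : Setup n f g σ₁ :=
    h.setup.frame hf₁ (by decide) (by decide) (by decide) (by decide) (by decide)
  refine Runs.seq (T₂ := 4) _ (runs_augment hB hc hset hF) ?_ le_rfl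
  intro σ₂ hf₂ hA
  have h17 : σ₂.r 17 = σ.r 17 := (hf₂.r 17 (by decide)).trans (hf₁.r 17 (by decide))
  have h16 : σ₂.r 16 = σ.r 16 := (hf₂.r 16 (by decide)).trans (hf₁.r 16 (by decide))
  have h6 : σ₂.a 6 = σ.a 6 := (hf₂.a 6 (by decide)).trans (hf₁.a 6 (by decide))
  have h6' : σ₁.a 6 = σ.a 6 := hf₁.a 6 (by decide)
  have h7 : σ₂.a 7 = σ.a 7 := (hf₂.a 7 (by decide)).trans (hf₁.a 7 (by decide))
  have hset₂ : Setup n f g σ₂ :=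
    hset.frame hf₂ (by decide) (by decide) (by decide) (by decide) (by decide)
  have hp := h.pot
  have ht := hA.tight
  have hpos := hA.pos
  rw [h6, h7] at ht
  rw [h7] at hpos
  refine Runs.of_wp ?_ (by simp)
  simp only [Cm.wp, Ex.val, BinOp.eval, h17]
  refine ⟨by omega, ⟨⟨?_, hset₂.f_eq, hset₂.g_eq, hset₂.wt, hset₂.next⟩, ?_, ?_, ?_⟩, ?_⟩
  · simpa using hset₂.n_eq
  · simp only [Store.setR_a, Store.setR_r, h6, h7, h16, Nat.reduceEqDiff, if_false]
    exact ⟨hA.matching, ht, hp.feasible, hpos, hp.idem, hp.sum, hp.tot_le⟩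
  · simp; omega
  · simp only [Store.setR_r, if_true, Store.setR_a]
    intro a ha
    rw [h6]
    obtain rfl | ha' := Nat.eq_or_lt_of_le (Nat.le_of_lt_succ ha)
    · right; rw [← h17]; exact hA.root
    · have := hF.keep a (h.done a ha')
      rw [h6'] at this
      exact this.imp_right (hA.keep a)
  · simp [h16]; omega

/-- The root stays, and the total of the potentials falls by `1`. Left potentials only decrease, so
a class that is done stays done. -/
theorem runs_phase_dual {σ σ₁ : Store} (hB : 2 * n + 2 ≤ B) (hc : Classes n f g)
    (h : Progress n f g σ) (hr : σ.r 17 < n) (hf₁ : Frame searchCm.wr searchCm.wa σ σ₁)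
    (hS : Searching n f g σ σ₁) (h18 : σ₁.r 18 = 0) (hq : σ₁.r 19 = σ₁.r 20) :
    Runs B inp dualCm σ₁ (100 * (n + 1)) fun σ' =>
      Progress n f g σ' ∧ n - σ'.r 17 + σ'.r 16 < n - σ.r 17 + σ.r 16 := by
  have hset : Setup n f g σ₁ :=
    h.setup.frame hf₁ (by decide) (by decide) (by decide) (by decide) (by decide)
  have h16 : σ₁.r 16 = σ.r 16 := hf₁.r 16 (by decide)
  have h17 : σ₁.r 17 = σ.r 17 := hf₁.r 17 (by decide)
  have h6 : σ₁.a 6 = σ.a 6 := hf₁.a 6 (by decide)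
  have h7 : σ₁.a 7 = σ.a 7 := hf₁.a 7 (by decide)
  have hs := hS.search
  rw [h18, hq] at hs
  have hp := h.pot
  rw [← h6, ← h7, ← hS.ma, ← hS.mb, ← h16] at hp
  have htot := hp.tot_le
  have hsum := hp.sum
  have hle6 (a : ℕ) (ha : a < n) : σ₁.a 6 a ≤ n := by
    have := single_le_sum (f := σ₁.a 6) (fun _ _ => Nat.zero_le _) (mem_range.2 ha)
    omega
  have hle7 (b : ℕ) (hb : b < n) : σ₁.a 7 b ≤ n := by
    have := single_le_sum (f := σ₁.a 7) (fun _ _ => Nat.zero_le _) (mem_range.2 hb)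
    omega
  refine (runs_dual hB hset.n_eq (by have := hs.meas; omega) htot
    (fun i hi => hle6 _ (hs.lt i hi)) hle7 hs.inj).mono le_rfl ?_
  rintro σ₂ hf₂ ⟨e6, e7, e16⟩
  obtain ⟨d1, d2, d3, d4⟩ :=
    hs.dual hc hp.matching hp.tight hp.feasible hp.pos e6 e7
  have h17' : σ₂.r 17 = σ.r 17 := (hf₂.r 17 (by decide)).trans h17
  have h8 : σ₂.a 8 = σ₁.a 8 := hf₂.a 8 (by decide)
  have h9 : σ₂.a 9 = σ₁.a 9 := hf₂.a 9 (by decide)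
  rw [← h8] at d2
  rw [← h9] at d3
  have hle (a : ℕ) : σ₂.a 6 a ≤ σ₁.a 6 a := by
    rw [e6]; split_ifs <;> omega
  refine ⟨⟨hset.frame hf₂ (by decide) (by decide) (by decide) (by decide) (by decide),
    ⟨?_, d2, d1, d3, ?_, ?_, ?_⟩, ?_, ?_⟩, ?_⟩
  · rw [h8, h9]; exact hp.matching
  · intro a ha hy
    exact hp.idem a ha (by have := hle a; omega)
  · omega
  · omega
  · omega
  · intro a ha
    rw [h17'] at ha
    rw [h8, hS.ma]
    refine (h.done a ha).imp_left fun h0 => ?_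
    have := hle a
    rw [h6] at this
    omega
  · omega

theorem runs_phase {σ : Store} (hB : 2 * n + 2 ≤ B) (hc : Classes n f g)
    (h : Progress n f g σ) (hr : σ.r 17 < n) (hy : σ.a 6 (σ.r 17) ≠ 0)
    (hma : σ.a 8 (σ.r 17) = 0) :
    Runs B inp phaseCm σ (800 * (n + 1)) fun σ' =>
      Progress n f g σ' ∧ n - σ'.r 17 + σ'.r 16 < n - σ.r 17 + σ.r 16 := by
  refine Runs.seq (T₁ := 300 * (n + 1)) (T₂ := 200 * (n + 2) + 6) _
    (runs_search hB hc h.setup h.pot hr hy hma) ?_ (by omega)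
  intro σ₁ hf₁ hI
  refine Runs.ite (T₁ := 200 * (n + 2) + 4) (fun he => ?_) (fun he => ?_) (by simp; omega)
  · rcases hI with ⟨hS, -, -⟩ | hF
    · exact absurd hS.fin he
    · exact runs_phase_augment hB hc h hr hf₁ hF
  · rcases hI with ⟨hS, h18, hq⟩ | hF
    · exact (runs_phase_dual hB hc h hr hf₁ hS h18 hq).mono (by omega) fun _ _ h => h
    · obtain ⟨b, -, hb, -⟩ := hF.augment
      simp [hb] at he

/-- The Hungarian method. -/
def hungarianCm : Cm :=
  .set 17 (.c 0) ;; .loop (.op .lt (.v 17) (.v 0))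
    (.ite (.op .mul (.get 6 (.v 17)) (.op .eq (.get 8 (.v 17)) (.c 0))) phaseCm
      (.set 17 (.op .add (.v 17) (.c 1))))

/-- The measure, namely the number of roots left plus the total of the potentials, is at most `2 *
n` at the start and falls in every round, and a round takes `O(n)` steps. Once all roots are done,
complementary slackness holds and the total is the optimum. -/
theorem runs_hungarian {σ : Store} (hB : 2 * n + 2 ≤ B) (hc : Classes n f g)
    (hset : Setup n f g σ) (hpot : Potentials n f g (σ.a 6) (σ.a 7) (σ.a 8) (σ.a 9) (σ.r 16)) :
    Runs B inp hungarianCm σ (1800 * ((n + 1) * (n + 1))) fun σ' =>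
      IsMaxAgree n f g (σ'.r 16) := by
  refine Runs.seq (T₁ := 2) (T₂ := 1798 * ((n + 1) * (n + 1))) (fun σ' => σ' = σ.setR 17 0)
    (Runs.of_wp (by simp) (by simp)) ?_ (by nlinarith)
  rintro _ - rfl
  refine Runs.loop (Tb := 800 * (n + 1) + 21) (Progress n f g)
    (fun σ' => n - σ'.r 17 + σ'.r 16) ?_ ?_ ?_ ?_
  · exact ⟨⟨by simpa using hset.n_eq, hset.f_eq, hset.g_eq, hset.wt, hset.next⟩,
      by simpa using hpot, by simp, by simp⟩
  · intro σ' hf hI he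
    have hlt : σ'.r 17 < n := by
      by_contra hne
      simp [BinOp.eval, hI.setup.n_eq, hne] at he
    refine Runs.ite (T₁ := 800 * (n + 1)) (fun he => ?_) (fun he => ?_) (by simp; omega)
    · simp only [Ex.val, BinOp.eval] at he
      have hy : σ'.a 6 (σ'.r 17) ≠ 0 := by
        intro h0; simp [h0] at he
      have hma : σ'.a 8 (σ'.r 17) = 0 := by
        by_contra h0; simp [h0] at he
      exact runs_phase hB hc hI hlt hy hma
    · simp only [Ex.val, BinOp.eval] at he
      refine Runs.of_wp ?_ (by simp; omega)
      simp only [Cm.wp, Ex.val, BinOp.eval]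
      refine ⟨by omega, ⟨⟨by simpa using hI.setup.n_eq, hI.setup.f_eq, hI.setup.g_eq,
        hI.setup.wt, hI.setup.next⟩, by simpa using hI.pot, by simp; omega, ?_⟩, by simp; omega⟩
      simp only [Store.setR_r, if_true, Store.setR_a]
      intro a ha
      obtain rfl | ha' := Nat.eq_or_lt_of_le (Nat.le_of_lt_succ ha)
      · by_contra hne
        push Not at hne
        simp [hne.1, hne.2] at he
      · exact hI.done a ha'
  · intro σ' hf hI he
    have hge : n ≤ σ'.r 17 := by
      by_contra hne
      push Not at hne
      simp [BinOp.eval, hI.setup.n_eq, hne] at he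
    rw [← hI.pot.sum]
    exact isMaxAgree_of_potentials hc hI.pot.matching hI.pot.feasible hI.pot.tight
      (fun a ha => hI.done a (by omega)) hI.pot.pos
  · have h16 := hpot.tot_le
    have : n - (σ.setR 17 0).r 17 + (σ.setR 17 0).r 16 ≤ 2 * n := by simp; omega
    have h2 := Nat.mul_le_mul_right (800 * (n + 1) + 25) this
    simp only [Ex.cost, Nat.reduceAdd]
    refine (Nat.add_le_add_right (Nat.add_le_add_right h2 3) 1).trans ?_
    nlinarith

/-- Preparation of weights, pointers and initial potentials. -/
def prepareCm : Cm :=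
  tabulate 0 4 (.op .mul (.op .eq (.get 2 (.v 10)) (.get 2 (.v 11)))
    (.op .eq (.get 3 (.v 10)) (.get 3 (.v 11)))) (.op .add (.v 12) (.c 1)) ;;
  tabulate 0 5 (.op .mul (.op .lt (.v 10) (.v 11)) (.op .eq (.get 2 (.v 10)) (.get 2 (.v 11))))
    (.op .add (.v 10) (.c 1)) ;;
  tabulate 0 6 (.op .eq (.get 2 (.v 10)) (.v 11)) (.op .add (.v 12) (.c 1)) ;;
  .for_ 13 0 (.put 7 (.v 13) (.c 0) ;; .put 8 (.v 13) (.c 0) ;; .put 9 (.v 13) (.c 0)) ;;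
  .set 16 (.v 0)

theorem scanF_count_le (P : ℕ → Prop) (m : ℕ) : scanF P (fun _ y => y + 1) m ≤ m := by
  classical
  rw [scanF_count]
  refine (card_filter_le _ _).trans ?_
  rw [card_range]

/-- Initially a left class has its size as potential, right classes have `0`, and nothing is
matched. This is feasible because an intersection is no larger than the class, and the total is `n`
because the classes partition the vertices. -/
theorem runs_prepare {σ : Store} (hB : 2 * n + 2 ≤ B) (hc : Classes n f g)
    (hn : σ.r 0 = n) (hf2 : σ.a 2 = f) (hg3 : σ.a 3 = g) :
    Runs B inp prepareCm σ (500 * ((n + 1) * (n + 1))) fun σ' =>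
      Setup n f g σ' ∧
        Potentials n f g (σ'.a 6) (σ'.a 7) (σ'.a 8) (σ'.a 9) (σ'.r 16) := by
  classical
  have hmul (b c : Prop) [Decidable b] [Decidable c] :
      (if b then 1 else 0) * (if c then 1 else 0) ≠ 0 ↔ b ∧ c := by
    split_ifs <;> simp_all
  refine Runs.seq (T₁ := n * (n * 49 + 25) + 6) (T₂ := 350 * ((n + 1) * (n + 1)))
    (fun σ' => ∀ v < n, σ'.a 4 v = weight n f g v)
    (runs_tabulate n (fun i k => f k = f i ∧ g k = g i) (fun _ y => y + 1) hn (by omega)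
      (by simp) (fun i _ k hk => (scanF_count_le _ _).trans (by omega)) ?_ ?_
      (by simp)) ?_ (by nlinarith)
  · intro σ' hf i hi k hk h11 h10
    have e2 : σ'.a 2 = f := (hf.a 2 (by decide)).trans hf2
    have e3 : σ'.a 3 = g := (hf.a 3 (by decide)).trans hg3
    simp only [Ex.val, BinOp.eval, h11, h10, e2, e3, hmul, and_true]
  · intro σ' hf h v hv
    rw [h v hv, scanF_count, weight]
    congr
  intro σ₁ hf₁ hI₁
  refine Runs.seq (T₁ := n * (n * 35 + 25) + 6) (T₂ := 250 * ((n + 1) * (n + 1)))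
    (fun σ' => IsNext n f (σ'.a 5))
    (runs_tabulate n (fun i k => k < i ∧ f k = f i) (fun k _ => k + 1)
      ((hf₁.r 0 (by decide)).trans hn) (by omega)
      (by simp) (fun i _ k hk => (lastF_le _ _).trans (by omega)) ?_ ?_
      (by simp)) ?_ (by nlinarith)
  · intro σ' hf i hi k hk h11 h10
    have e2 : σ'.a 2 = f := ((hf.a 2 (by decide)).trans (hf₁.a 2 (by decide))).trans hf2
    simp only [Ex.val, BinOp.eval, h11, h10, e2, hmul, and_true]
  · intro σ' hf h v hv
    rw [h v hv]
    refine ⟨fun u hu => ?_, fun u hu hfu => ?_⟩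
    · exact (lastF_spec hu).2.1
    · change u < lastF (fun k => k < v ∧ f k = f v) n
      have hu' : u < n := by omega
      cases hl : lastF (fun k => k < v ∧ f k = f v) n with
      | zero => exact absurd ⟨hu, hfu⟩ (lastF_eq_zero.1 hl u hu')
      | succ w => have := (lastF_spec hl).2.2 u hu' ⟨hu, hfu⟩; omega
  intro σ₂ hf₂ hI₂
  refine Runs.seq (T₁ := n * (n * 24 + 25) + 6) (T₂ := 150 * ((n + 1) * (n + 1)))
    (fun σ' => ∀ a < n, σ'.a 6 a = ((range n).filter fun v => f v = a).card)
    (runs_tabulate n (fun i k => f k = i) (fun _ y => y + 1)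
      ((hf₂.r 0 (by decide)).trans ((hf₁.r 0 (by decide)).trans hn)) (by omega)
      (by simp) (fun i _ k hk => (scanF_count_le _ _).trans (by omega)) ?_ ?_
      (by simp)) ?_ (by nlinarith)
  · intro σ' hf i hi k hk h11 h10
    have e2 : σ'.a 2 = f := ((hf.a 2 (by decide)).trans
      ((hf₂.a 2 (by decide)).trans (hf₁.a 2 (by decide)))).trans hf2
    simp [BinOp.eval, h11, h10, e2]
  · intro σ' hf h v hv
    rw [h v hv, scanF_count]
    congr
  intro σ₃ hf₃ hI₃
  have hn₃ : σ₃.r 0 = n := (hf₃.r 0 (by decide)).trans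
    ((hf₂.r 0 (by decide)).trans ((hf₁.r 0 (by decide)).trans hn))
  refine Runs.seq (T₁ := n * 35 + 6) (T₂ := 2)
    (fun σ' => ∀ a < n, σ'.a 7 a = 0 ∧ σ'.a 8 a = 0 ∧ σ'.a 9 a = 0)
    (Runs.for_ (Tb := 27) n (fun k σ' => ∀ a < k, σ'.a 7 a = 0 ∧ σ'.a 8 a = 0 ∧ σ'.a 9 a = 0)
      hn₃ (by omega) (by simp) (by simp) (by simp) ?_ (fun _ _ h => h) le_rfl) ?_ (by nlinarith)
  · intro k hk σ' hf hi hI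
    refine Runs.of_wp ?_ (by simp)
    simp only [Cm.wp, Ex.val, hi, Store.setA_r]
    refine ⟨by omega, by omega, by omega, fun a ha => ?_⟩
    by_cases hak : a = k
    · simp [hak]
    · simpa [Function.update_of_ne hak] using hI a (by omega)
  intro σ₄ hf₄ hI₄
  have hn₄ : σ₄.r 0 = n := (hf₄.r 0 (by decide)).trans hn₃
  have e2 : σ₄.a 2 = f := ((hf₄.a 2 (by decide)).trans ((hf₃.a 2 (by decide)).trans
      ((hf₂.a 2 (by decide)).trans (hf₁.a 2 (by decide))))).trans hf2
  have e3 : σ₄.a 3 = g := ((hf₄.a 3 (by decide)).trans ((hf₃.a 3 (by decide)).trans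
      ((hf₂.a 3 (by decide)).trans (hf₁.a 3 (by decide))))).trans hg3
  have e4 : σ₄.a 4 = σ₁.a 4 := (hf₄.a 4 (by decide)).trans ((hf₃.a 4 (by decide)).trans
      (hf₂.a 4 (by decide)))
  have e5 : σ₄.a 5 = σ₂.a 5 := (hf₄.a 5 (by decide)).trans (hf₃.a 5 (by decide))
  have e6 : σ₄.a 6 = σ₃.a 6 := hf₄.a 6 (by decide)
  refine Runs.of_wp ?_ (by simp)
  simp only [Cm.wp, Ex.val, hn₄]
  refine ⟨by omega, ⟨by simpa using hn₄, by simpa using e2, by simpa using e3, ?_, ?_⟩,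
    ⟨⟨?_, ?_⟩, ?_, ?_, ?_, ?_, ?_, ?_⟩⟩
  · simpa [e4] using hI₁
  · simpa [e5] using hI₂
  · intro a ha v hv
    simp [(hI₄ a ha).2.1] at hv
  · intro a ha v hv
    simp [(hI₄ a ha).2.2] at hv
  · intro a ha v hv
    simp [(hI₄ a ha).2.1] at hv
  · intro v hv
    simp only [Store.setR_a, e6, hI₃ _ (hc.f_lt v hv)]
    refine le_add_right (card_le_card fun u hu => ?_)
    simp only [mem_filter] at hu ⊢
    exact ⟨hu.1, hu.2.1⟩
  · intro b hb h
    simp [(hI₄ b hb).1] at h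
  · intro a ha h
    simp only [Store.setR_a, e6, hI₃ a ha] at h
    obtain ⟨v, hv⟩ := card_ne_zero.1 h
    simp only [mem_filter, mem_range] at hv
    rw [← hv.2, hc.f_idem v hv.1]
  · simp only [Store.setR_a, Store.setR_r, if_true, e6]
    rw [sum_congr rfl fun a ha => hI₃ a (mem_range.1 ha),
      sum_congr rfl fun b hb => (hI₄ b (mem_range.1 hb)).1, sum_const_zero, add_zero,
      ← card_eq_sum_card_fiberwise, card_range]
    intro v hv
    simpa using hc.f_lt v (by simpa using hv)
  · simp

/-- Compute the size of a largest set on which the partitions in arrays `2` and `3` agree. -/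
def matchCm : Cm := prepareCm ;; hungarianCm

theorem runs_match {σ : Store} (hB : 2 * n + 2 ≤ B) (hc : Classes n f g)
    (hn : σ.r 0 = n) (hf2 : σ.a 2 = f) (hg3 : σ.a 3 = g) :
    Runs B inp matchCm σ (2300 * ((n + 1) * (n + 1))) fun σ' => IsMaxAgree n f g (σ'.r 16) :=
  Runs.seq _ (runs_prepare hB hc hn hf2 hg3) (fun _ _ h => runs_hungarian hB hc h.1 h.2) (by omega)

end PartitionMatching

/-! ## Coding of edit sets and the dynamic program -/

namespace TCE

open Finset

variable {n : ℕ}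

/-- Digit `j` of `t` in base `n * n`. The digit `u * n + v` stands for the pair of `u` and `v`. -/
def editDigit (n t j : ℕ) : ℕ := t / (n * n) ^ j % (n * n)

/-- One of the first `K` digits of `t` is `e`. -/
def HasDigit (n K t e : ℕ) : Prop := ∃ j < K, editDigit n t j = e

open Classical in
/-- The set of pairs coded by the first `K` digits of `t`. -/
noncomputable def editSet (n K t : ℕ) : Finset (Sym2 (Fin n)) :=
  univ.filter fun z => ∃ u v : Fin n, u ≠ v ∧ z = s(u, v) ∧ HasDigit n K t (u * n + v)

theorem mem_editSet {K t : ℕ} {z : Sym2 (Fin n)} : z ∈ editSet n K t ↔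
    ∃ u v : Fin n, u ≠ v ∧ z = s(u, v) ∧ HasDigit n K t (u * n + v) := by
  simp [editSet]

theorem pair_inj {u v u' v' : Fin n} (h : (u : ℕ) * n + v = u' * n + v') : u = u' ∧ v = v' := by
  have hv := v.2
  have hv' := v'.2
  have hn : 0 < n := by omega
  have h1 : (u : ℕ) = u' := by
    have := congrArg (· / n) h
    simpa [Nat.add_div_of_dvd_right, Nat.div_eq_of_lt hv, Nat.div_eq_of_lt hv', hn,
      Nat.add_comm _ (v : ℕ), Nat.add_comm _ (v' : ℕ), Nat.add_mul_div_right] using this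
  rw [h1] at h
  exact ⟨Fin.ext h1, Fin.ext (by omega)⟩

theorem pair_lt (u v : Fin n) : (u : ℕ) * n + v < n * n := by
  have hu := u.2
  have hv := v.2
  nlinarith

theorem not_isDiag_of_mem_editSet {K t : ℕ} {z : Sym2 (Fin n)} (h : z ∈ editSet n K t) :
    ¬ z.IsDiag := by
  obtain ⟨u, v, huv, rfl, -⟩ := mem_editSet.1 h
  simpa using huv

theorem card_editSet_le (n K t : ℕ) : (editSet n K t).card ≤ K := by
  have h : ∀ z ∈ editSet n K t, ∃ j < K, ∃ u v : Fin n, z = s(u, v) ∧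
      editDigit n t j = u * n + v := by
    intro z hz
    obtain ⟨u, v, -, hz, j, hj, hd⟩ := mem_editSet.1 hz
    exact ⟨j, hj, u, v, hz, hd⟩
  choose! j hj u v hz hd using h
  refine (card_le_card_of_injOn (t := range K) j (fun z h => by simpa using hj z h)
    fun z h z' h' he => ?_).trans (card_range K).le
  have h1 := hd z h
  rw [he, hd z' h'] at h1
  obtain ⟨h2, h3⟩ := pair_inj h1
  rw [hz z h, hz z' h', h2, h3]

theorem hasDigit_succ {K t c e : ℕ} (hn : 0 < n) (hc : c < n * n) :
    HasDigit n (K + 1) (t * (n * n) + c) e ↔ c = e ∨ HasDigit n K t e := by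
  have h0 : editDigit n (t * (n * n) + c) 0 = c := by
    simp [editDigit, Nat.mod_eq_of_lt hc]
  have h1 (j : ℕ) : editDigit n (t * (n * n) + c) (j + 1) = editDigit n t j := by
    rw [editDigit, editDigit, pow_succ', ← Nat.div_div_eq_div_mul]
    congr 2
    rw [Nat.add_comm, Nat.add_mul_div_right _ _ (by positivity), Nat.div_eq_of_lt hc, zero_add]
  constructor
  · rintro ⟨j, hj, he⟩
    cases j with
    | zero => exact .inl (h0.symm.trans he)
    | succ j => exact .inr ⟨j, by omega, (h1 j).symm.trans he⟩
  · rintro (rfl | ⟨j, hj, he⟩)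
    · exact ⟨0, by omega, h0⟩
    · exact ⟨j + 1, by omega, (h1 j).trans he⟩

theorem mem_editSet_succ {K t : ℕ} {a b : Fin n} {z : Sym2 (Fin n)} :
    z ∈ editSet n (K + 1) (t * (n * n) + (a * n + b)) ↔
      (a ≠ b ∧ z = s(a, b)) ∨ z ∈ editSet n K t := by
  have hn : 0 < n := by have := a.2; omega
  simp only [mem_editSet, hasDigit_succ hn (pair_lt a b)]
  constructor
  · rintro ⟨u, v, h1, h2, h3 | h3⟩
    · obtain ⟨rfl, rfl⟩ := pair_inj h3
      exact .inl ⟨h1, h2⟩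
    · exact .inr ⟨u, v, h1, h2, h3⟩
  · rintro (⟨h1, h2⟩ | ⟨u, v, h1, h2, h3⟩)
    · exact ⟨a, b, h1, h2, .inl rfl⟩
    · exact ⟨u, v, h1, h2, .inr h3⟩

theorem exists_editSet_eq (hn : 0 < n) (K : ℕ) (M : Finset (Sym2 (Fin n)))
    (hM : ∀ e ∈ M, ¬ e.IsDiag) (hK : M.card ≤ K) :
    ∃ t < (n * n) ^ K, editSet n K t = M := by
  classical
  induction K generalizing M with
  | zero =>
    obtain rfl : M = ∅ := by simpa using hK
    refine ⟨0, by simp, ?_⟩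
    ext z
    simp [mem_editSet, HasDigit]
  | succ K ih =>
    have hlt {t : ℕ} (ht : t < (n * n) ^ K) (a b : Fin n) :
        t * (n * n) + (a * n + b) < (n * n) ^ (K + 1) := by
      have h1 := pair_lt a b
      have h2 : (t + 1) * (n * n) ≤ (n * n) ^ K * (n * n) := Nat.mul_le_mul_right _ ht
      rw [pow_succ]
      nlinarith
    rcases M.eq_empty_or_nonempty with rfl | ⟨z, hz⟩
    · obtain ⟨t, ht, he⟩ := ih ∅ (by simp) (by simp)
      -- Unused digits are filled with the diagonal pair of `0` and `0`, which `editSet` ignores.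
      refine ⟨_, hlt ht ⟨0, hn⟩ ⟨0, hn⟩, ?_⟩
      ext z
      rw [mem_editSet_succ, he]
      simp
    · obtain ⟨t, ht, he⟩ := ih (M.erase z) (fun e h => hM e (mem_of_mem_erase h))
        (by rw [card_erase_of_mem hz]; omega)
      induction z using Sym2.ind with
      | _ a b =>
        refine ⟨_, hlt ht a b, ?_⟩
        have hab : a ≠ b := by simpa using hM _ hz
        ext w
        rw [mem_editSet_succ, he, mem_erase]
        by_cases hw : w = s(a, b)
        · simp [hw, hab, hz]
        · simp [hw]

theorem edit_adj (G : SimpleGraph (Fin n)) {K t : ℕ} {u v : Fin n} :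
    (edit G (editSet n K t)).Adj u v ↔ u ≠ v ∧
      ¬ (G.Adj u v ↔ (HasDigit n K t (u * n + v) ∨ HasDigit n K t (v * n + u))) := by
  have hmem : u ≠ v → (s(u, v) ∈ editSet n K t ↔
      (HasDigit n K t (u * n + v) ∨ HasDigit n K t (v * n + u))) := by
    intro huv
    rw [mem_editSet]
    constructor
    · rintro ⟨a, b, hab, he, hd⟩
      rcases Sym2.eq_iff.1 he with ⟨rfl, rfl⟩ | ⟨rfl, rfl⟩
      · exact .inl hd
      · exact .inr hd
    · rintro (h | h)
      · exact ⟨u, v, huv, rfl, h⟩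
      · exact ⟨v, u, huv.symm, Sym2.eq_swap, h⟩
  rw [edit, SimpleGraph.fromEdgeSet_adj, Set.mem_symmDiff, SimpleGraph.mem_edgeSet, mem_coe]
  by_cases huv : u = v
  · simp [huv]
  · rw [hmem huv]
    tauto

/-! ### Cluster graphs -/

/-- Cluster graphs are the graphs without an induced path on three vertices: along a walk from `u`,
every vertex reached stays equal or adjacent to `u`. -/
theorem isClusterGraph_iff {V : Type*} {H : SimpleGraph V} :
    IsClusterGraph H ↔ ∀ u v w, H.Adj u v → H.Adj v w → u ≠ w → H.Adj u w := by
  constructor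
  · intro h u v w huv hvw huw
    refine h (H.connectedComponentMk v) ?_ ?_ huw
    · exact SimpleGraph.ConnectedComponent.sound huv.reachable
    · exact SimpleGraph.ConnectedComponent.sound hvw.symm.reachable
  · intro h K u hu v hv huv
    have hr : H.Reachable u v := SimpleGraph.ConnectedComponent.exact
      ((SimpleGraph.ConnectedComponent.mem_supp_iff K u).1 hu |>.trans
        ((SimpleGraph.ConnectedComponent.mem_supp_iff K v).1 hv).symm)
    rw [SimpleGraph.reachable_iff_reflTransGen] at hr
    have : u = v ∨ H.Adj u v := by
      clear huv hu hv
      induction hr with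
      | refl => exact .inl rfl
      | @tail b c _ hbc ih =>
        rcases ih with rfl | ih
        · exact .inr hbc
        · by_cases huc : u = c
          · exact .inl huc
          · exact .inr (h u b c ih hbc huc)
    exact this.resolve_left huv

open ArrayMachine PartitionMatching

/-- `u` is in the closed neighbourhood of `v`. -/
def Nbr (H : SimpleGraph (Fin n)) (v u : ℕ) : Prop :=
  ∃ (hv : v < n) (hu : u < n), u = v ∨ H.Adj ⟨u, hu⟩ ⟨v, hv⟩

/-- The largest vertex in the closed neighbourhood of `v`. -/
noncomputable def label (H : SimpleGraph (Fin n)) (v : ℕ) : ℕ := lastF (Nbr H v) n - 1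

theorem label_spec (H : SimpleGraph (Fin n)) {v : ℕ} (hv : v < n) :
    Nbr H v (label H v) ∧ ∀ u, Nbr H v u → u ≤ label H v := by
  have hne : lastF (Nbr H v) n ≠ 0 := fun h =>
    lastF_eq_zero.1 h v hv ⟨hv, hv, .inl rfl⟩
  obtain ⟨x, hx⟩ := Nat.exists_eq_succ_of_ne_zero hne
  have hx' : label H v = x := by rw [label, hx]; rfl
  obtain ⟨h1, h2, h3⟩ := lastF_spec hx
  rw [hx']
  exact ⟨h2, fun u hu => h3 u hu.2.1 hu⟩

theorem nbr_comm {H : SimpleGraph (Fin n)} {u v : ℕ} : Nbr H u v ↔ Nbr H v u := by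
  unfold Nbr
  constructor
  · rintro ⟨h1, h2, rfl | h3⟩
    · exact ⟨h1, h2, .inl rfl⟩
    · exact ⟨h2, h1, .inr h3.symm⟩
  · rintro ⟨h1, h2, rfl | h3⟩
    · exact ⟨h1, h2, .inl rfl⟩
    · exact ⟨h2, h1, .inr h3.symm⟩

theorem nbr_trans {H : SimpleGraph (Fin n)} (h : IsClusterGraph H) {u v w : ℕ}
    (h1 : Nbr H u v) (h2 : Nbr H v w) : Nbr H u w := by
  obtain ⟨hu, hv, h1⟩ := h1
  obtain ⟨_, hw, h2⟩ := h2
  refine ⟨hu, hw, ?_⟩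
  rcases h1 with rfl | h1
  · exact h2
  · rcases h2 with rfl | h2
    · exact .inr h1
    · by_cases hwu : w = u
      · exact .inl hwu
      · refine .inr (isClusterGraph_iff.1 h _ _ _ h2 h1 fun he => hwu ?_)
        simpa using he

/-- In a cluster graph the closed neighbourhoods are the classes of an equivalence relation, so the
largest element of a class identifies it. -/
theorem label_eq_iff {H : SimpleGraph (Fin n)} (h : IsClusterGraph H) {u v : ℕ} (hu : u < n)
    (hv : v < n) : label H u = label H v ↔ Nbr H u v := by
  obtain ⟨h1, h2⟩ := label_spec H hu
  obtain ⟨h3, h4⟩ := label_spec H hv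
  constructor
  · intro he
    rw [he] at h1
    exact nbr_trans h h1 (nbr_comm.1 h3)
  · intro huv
    exact le_antisymm (h4 _ (nbr_trans h (nbr_comm.1 huv) h1)) (h2 _ (nbr_trans h huv h3))

/-- A test for cluster graphs that looks at pairs only, hence takes quadratic time; triples of
vertices would be too expensive. For the converse, equality of labels is transitive in any graph. -/
theorem isClusterGraph_iff_label {H : SimpleGraph (Fin n)} :
    IsClusterGraph H ↔ ∀ u v : Fin n, u ≠ v → (H.Adj u v ↔ label H u = label H v) := by
  constructor
  · intro h u v huv
    rw [label_eq_iff h u.2 v.2]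
    refine ⟨fun ha => ⟨u.2, v.2, .inr ha.symm⟩, ?_⟩
    rintro ⟨_, _, he | ha⟩
    · exact absurd (Fin.ext he).symm huv
    · exact ha.symm
  · intro h
    rw [isClusterGraph_iff]
    intro u v w huv hvw huw
    rw [h u w huw, (h u v huv.ne).1 huv, (h v w hvw.ne).1 hvw]

theorem classes_label {H H' : SimpleGraph (Fin n)} (h : IsClusterGraph H) :
    Classes n (label H) (label H') where
  f_lt v hv := (label_spec H hv).1.2.1
  g_lt v hv := (label_spec H' hv).1.2.1
  f_idem v hv := by
    have h1 := (label_spec H hv).1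
    exact ((label_eq_iff h hv h1.2.1).2 h1).symm
  le_f v hv := (label_spec H hv).2 v ⟨hv, hv, .inl rfl⟩

theorem adj_iff_label {H : SimpleGraph (Fin n)} (h : IsClusterGraph H) (u v : Fin n) :
    H.Adj u v ↔ u ≠ v ∧ label H u = label H v := by
  by_cases huv : u = v
  · simp [huv]
  · simp [huv, isClusterGraph_iff_label.1 h u v huv]

/-- Two cluster graphs agree outside `D` iff their partitions agree on the complement of `D`. So a
smallest `D` is the complement of a largest set of agreement and has `n - m` elements. -/
theorem consistent_iff {H H' : SimpleGraph (Fin n)} (h : IsClusterGraph H)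
    (h' : IsClusterGraph H') {m d : ℕ} (hm : IsMaxAgree n (label H) (label H') m) :
    (∃ D : Finset (Fin n), D.card ≤ d ∧
      H.induce ((D : Set (Fin n))ᶜ) = H'.induce ((D : Set (Fin n))ᶜ)) ↔ n ≤ d + m := by
  classical
  have hind (D : Finset (Fin n)) :
      H.induce ((D : Set (Fin n))ᶜ) = H'.induce ((D : Set (Fin n))ᶜ) ↔
        ∀ u ∉ D, ∀ v ∉ D, (label H u = label H v ↔ label H' u = label H' v) := by
    rw [SimpleGraph.ext_iff]
    constructor
    · intro he u hu v hv
      by_cases huv : u = v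
      · simp [huv]
      · have := congrFun (congrFun he ⟨u, by simpa using hu⟩) ⟨v, by simpa using hv⟩
        simpa [adj_iff_label h, adj_iff_label h', huv] using this
    · intro he
      funext ⟨u, hu⟩ ⟨v, hv⟩
      have := he u (by simpa using hu) v (by simpa using hv)
      simp [adj_iff_label h, adj_iff_label h', this]
  simp only [hind]
  constructor
  · rintro ⟨D, hD, he⟩
    have h1 := hm.2 (Dᶜ.map Fin.valEmbedding) ?_ ?_
    · rw [card_map, card_compl, Fintype.card_fin] at h1
      omega
    · intro u hu
      obtain ⟨v, -, rfl⟩ := mem_map.1 hu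
      simp
    · intro u hu v hv
      obtain ⟨u, hu', rfl⟩ := mem_map.1 hu
      obtain ⟨v, hv', rfl⟩ := mem_map.1 hv
      exact he u (by simpa using hu') v (by simpa using hv')
  · intro hle
    obtain ⟨X, hX, hA, hcard⟩ := hm.1
    have hX' : ∀ x ∈ X, x < n := fun x hx => mem_range.1 (hX hx)
    have hc := card_attachFin X hX'
    refine ⟨(X.attachFin hX')ᶜ, ?_, fun u hu v hv => ?_⟩
    · rw [card_compl, Fintype.card_fin]
      omega
    · simp only [mem_compl, not_not, mem_attachFin] at hu hv
      exact hA u hu v hv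

/-! ### The dynamic program -/

/-- The number of edits that matter. -/
def Instance.budget (I : Instance) : ℕ := min I.k (I.n * I.n)

/-- Layer `i`. -/
def Instance.layer (I : Instance) (i : ℕ) : SimpleGraph (Fin I.n) :=
  if h : i < I.ℓ then I.layers ⟨i, h⟩ else ⊥

/-- Layer `i` edited according to the code `t`. -/
noncomputable def Instance.edited (I : Instance) (i t : ℕ) : SimpleGraph (Fin I.n) :=
  edit (I.layer i) (editSet I.n I.budget t)

/-- The number of codes of edit sets. -/
def Instance.codes (I : Instance) : ℕ := (I.n * I.n) ^ I.budget

/-- Two graphs agree outside a set of at most `d` vertices. -/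
def AgreeUpTo (d : ℕ) (H H' : SimpleGraph (Fin n)) : Prop :=
  ∃ D : Finset (Fin n), D.card ≤ d ∧
    H.induce ((D : Set (Fin n))ᶜ) = H'.induce ((D : Set (Fin n))ᶜ)

/-- There is a solution for the layers `0, …, i` using the code `t` for layer `i`. -/
def Instance.Reach (I : Instance) : ℕ → ℕ → Prop
  | 0, t => IsClusterGraph (I.edited 0 t)
  | i + 1, t => IsClusterGraph (I.edited (i + 1) t) ∧ ∃ t' < I.codes, I.Reach i t' ∧
      AgreeUpTo I.d (I.edited i t') (I.edited (i + 1) t)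

theorem Instance.Reach.cluster {I : Instance} {i t : ℕ} (h : I.Reach i t) :
    IsClusterGraph (I.edited i t) := by
  cases i with
  | zero => exact h
  | succ i => exact h.1

theorem Instance.Reach.exists_chain {I : Instance} {i t : ℕ} (h : I.Reach i t) :
    ∃ τ : ℕ → ℕ, τ i = t ∧ (∀ j ≤ i, IsClusterGraph (I.edited j (τ j))) ∧
      ∀ j < i, AgreeUpTo I.d (I.edited j (τ j)) (I.edited (j + 1) (τ (j + 1))) := by
  induction i generalizing t with
  | zero =>
    refine ⟨fun _ => t, rfl, fun j hj => ?_, fun j hj => by omega⟩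
    obtain rfl : j = 0 := by omega
    exact h
  | succ i ih =>
    obtain ⟨h1, t', -, h2, h3⟩ := h
    obtain ⟨τ, e1, e2, e3⟩ := ih h2
    refine ⟨Function.update τ (i + 1) t, by simp, fun j hj => ?_, fun j hj => ?_⟩
    · by_cases hji : j = i + 1
      · subst hji; simpa using h1
      · rw [Function.update_of_ne hji]; exact e2 j (by omega)
    · rw [Function.update_of_ne (by omega : j ≠ i + 1)]
      by_cases hji : j = i
      · subst hji
        rw [e1]
        simpa using h3
      · rw [Function.update_of_ne (by omega : j + 1 ≠ i + 1)]
        exact e3 j (by omega)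

/-- Consistency relates consecutive layers only, so it suffices to remember the code chosen for the
last layer treated. Conversely, a chain of codes is read back as a solution. -/
theorem Instance.isYes_iff (I : Instance) :
    I.IsYes ↔ ∃ t < I.codes, I.Reach (I.ℓ - 1) t := by
  have hℓ := I.ℓ_pos
  have hlayer (i : Fin I.ℓ) : I.layer i = I.layers i := by simp [Instance.layer]
  constructor
  · rintro ⟨M, h1, h2, D, h3⟩
    have hcode (i : Fin I.ℓ) : ∃ t < I.codes, editSet I.n I.budget t = M i := by
      refine exists_editSet_eq I.n_pos _ _ (h1 i).1 (le_min (h2 i) ?_)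
      -- There are at most `n * n` unordered pairs, so capping `k` at this number loses no edit set.
      refine (card_le_univ _).trans ?_
      have := Fintype.card_le_of_surjective (fun p : Fin I.n × Fin I.n => s(p.1, p.2))
        (fun z => by induction z using Sym2.ind with | _ a b => exact ⟨(a, b), rfl⟩)
      simpa using this
    choose τ hτ hM using hcode
    have hed (i : ℕ) (hi : i < I.ℓ) :
        I.edited i (τ ⟨i, hi⟩) = edit (I.layers ⟨i, hi⟩) (M ⟨i, hi⟩) := by
      rw [Instance.edited, hM, ← hlayer]
    have hreach (i : ℕ) (hi : i < I.ℓ) : I.Reach i (τ ⟨i, hi⟩) := by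
      induction i with
      | zero =>
        rw [Instance.Reach, hed 0 hi]
        exact (h1 _).2
      | succ i ih =>
        refine ⟨?_, τ ⟨i, by omega⟩, hτ _, ih (by omega), D i, (h3 i hi).1, ?_⟩
        · rw [hed _ hi]
          exact (h1 _).2
        · rw [hed _ hi, hed i (by omega)]
          exact (h3 i hi).2
    exact ⟨_, hτ _, hreach (I.ℓ - 1) (by omega)⟩
  · rintro ⟨t, -, h⟩
    obtain ⟨τ, -, h1, h2⟩ := h.exists_chain
    have hed (i : ℕ) (hi : i < I.ℓ) :
        I.edited i (τ i) = edit (I.layers ⟨i, hi⟩) (editSet I.n I.budget (τ i)) := by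
      rw [Instance.edited, ← hlayer]
    refine ⟨fun i => editSet I.n I.budget (τ i), fun i => ⟨fun e he =>
      not_isDiag_of_mem_editSet he, ?_⟩, fun i => (card_editSet_le _ _ _).trans (min_le_left _ _),
      ?_⟩
    · have := h1 i (by omega)
      rwa [hed i i.2] at this
    -- The deletion sets are indexed by all of `ℕ`; beyond the last pair of layers the empty set is
    -- a dummy.
    · have : ∀ i, ∃ D : Finset (Fin I.n), i < I.ℓ - 1 → D.card ≤ I.d ∧
          (I.edited i (τ i)).induce ((D : Set (Fin I.n))ᶜ) =
            (I.edited (i + 1) (τ (i + 1))).induce ((D : Set (Fin I.n))ᶜ) := by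
        intro i
        by_cases hi : i < I.ℓ - 1
        · obtain ⟨D, hD⟩ := h2 i hi
          exact ⟨D, fun _ => hD⟩
        · exact ⟨∅, fun h => absurd h hi⟩
      choose D hD using this
      refine ⟨D, fun i hi => ?_⟩
      have := hD i (by omega)
      rwa [hed i (by omega), hed (i + 1) hi] at this

end TCE

namespace TCE

open Finset WordRAM ArrayMachine PartitionMatching

variable {B : ℕ} {inp : ℕ → ℕ} {I : Instance}

/-! ### Decoding an edit set -/

/-- `inp` is the encoding of `I`. -/
structure IsInput (I : Instance) (inp : ℕ → ℕ) : Prop where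
  n_eq : inp 0 = I.n
  ℓ_eq : inp 1 = I.ℓ
  k_eq : inp 2 = I.k
  d_eq : inp 3 = I.d
  adj : ∀ i < I.ℓ, ∀ u v : Fin I.n, inp (4 + i * (I.n * I.n) + (u * I.n + v)) =
    open Classical in if (I.layer i).Adj u v then 1 else 0

/-- `B` is large enough for the instance. -/
structure IsBound (I : Instance) (B : ℕ) : Prop where
  n_le : 2 * I.n + 2 ≤ B
  sq_le : I.n * I.n ≤ B
  codes_le : I.codes ≤ B
  ℓ_le : I.ℓ ≤ B
  k_le : I.k ≤ B
  d_le : I.d ≤ B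

/-- The registers holding global quantities. -/
structure Ctx (I : Instance) (σ : Store) : Prop where
  n_eq : σ.r 0 = I.n
  budget_eq : σ.r 2 = I.budget
  d_eq : σ.r 3 = I.d
  sq_eq : σ.r 4 = I.n * I.n
  codes_eq : σ.r 5 = I.codes
  last_eq : σ.r 27 = I.ℓ - 1

theorem Ctx.frame {σ σ' : Store} {R A} (h : Ctx I σ) (hf : Frame R A σ σ')
    (hR : ∀ r ∈ [0, 2, 3, 4, 5, 27], r ∉ R) : Ctx I σ' where
  n_eq := (hf.r _ (hR _ (by decide))).trans h.n_eq
  budget_eq := (hf.r _ (hR _ (by decide))).trans h.budget_eq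
  d_eq := (hf.r _ (hR _ (by decide))).trans h.d_eq
  sq_eq := (hf.r _ (hR _ (by decide))).trans h.sq_eq
  codes_eq := (hf.r _ (hR _ (by decide))).trans h.codes_eq
  last_eq := (hf.r _ (hR _ (by decide))).trans h.last_eq

/-- Compares, for the vertices in registers `10` and `11`, the adjacency in the layer given by
register `25` with the edits marked in array `0`. -/
def unedited : Ex :=
  .op .eq (.inp (.op .add (.op .add (.c 4) (.op .mul (.v 25) (.v 4)))
      (.op .add (.op .mul (.v 10) (.v 0)) (.v 11))))
    (.op .lt (.c 0) (.op .add (.get 0 (.op .add (.op .mul (.v 10) (.v 0)) (.v 11)))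
      (.get 0 (.op .add (.op .mul (.v 11) (.v 0)) (.v 10)))))

/-- Mark the edits coded by register `26` in array `0`. -/
def markCm : Cm :=
  .for_ 13 4 (.put 0 (.v 13) (.c 0)) ;; .set 15 (.v 26) ;;
  .for_ 13 2 (.put 0 (.op .mod (.v 15) (.v 4)) (.c 1) ;; .set 15 (.op .div (.v 15) (.v 4)))

/-- Compute the labels of the layer given by register `25`, edited according to the code in
register `26`, and check in register `14` whether it is a cluster graph. -/
def decodeCm (A : Fin 16) : Cm :=
  markCm ;;
  tabulate 0 A (.op .add (.op .eq (.v 10) (.v 11)) (.op .eq unedited (.c 0))) (.v 10) ;;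
  tabulate 0 10 (.op .mul (.op .eq (.op .eq (.v 10) (.v 11)) (.c 0))
    (.op .eq unedited (.op .eq (.get A (.v 10)) (.get A (.v 11))))) (.c 1) ;;
  scan 0 (.get 10 (.v 10)) (.c 1) ;; .set 14 (.op .eq (.v 12) (.c 0))

-- The digits are split off by repeated division: after `k` rounds register `15` holds `t / (n * n)
-- ^ k`. The cap `budget ≤ n * n` makes this quadratic whatever the size of `k`.
open Classical in
theorem runs_mark {σ : Store} {t : ℕ} (hB : IsBound I B) (hctx : Ctx I σ) (ht : σ.r 26 = t)
    (htB : t ≤ B) :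
    Runs B inp markCm σ (60 * ((I.n + 1) * (I.n + 1))) fun σ' =>
      ∀ e < I.n * I.n, σ'.a 0 e = if HasDigit I.n I.budget t e then 1 else 0 := by
  have hK : I.budget ≤ I.n * I.n := min_le_right _ _
  have hsq := hB.sq_le
  have hn := I.n_pos
  refine Runs.seq (T₁ := I.n * I.n * 17 + 6) (T₂ := I.n * I.n * 30 + 8)
    (fun σ' => ∀ e < I.n * I.n, σ'.a 0 e = 0)
    (Runs.for_ (Tb := 9) (I.n * I.n) (fun k σ' => ∀ e < k, σ'.a 0 e = 0) hctx.sq_eq hsq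
      (by simp) (by simp) (by simp) ?_ (fun _ _ h => h) le_rfl) ?_ (by nlinarith)
  · intro k hk σ' hf hi hI
    refine Runs.of_wp ?_ (by simp)
    simp only [Cm.wp, Ex.val]
    refine ⟨by omega, fun b hb => ?_⟩
    by_cases hbk : b = k
    · simp [hi, hbk]
    · have := hI b (by omega)
      simp [hi, Function.update_of_ne hbk, this]
  intro σ₁ hf₁ hI₁
  have hctx₁ := hctx.frame hf₁ (by decide)
  have h26 : σ₁.r 26 = t := (hf₁.r 26 (by decide)).trans ht
  refine Runs.seq (T₁ := 2) (T₂ := I.n * I.n * 30 + 6) (fun σ' => σ' = σ₁.setR 15 t)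
    (Runs.of_wp (by simp [h26, htB]) (by simp)) ?_ (by omega)
  rintro _ - rfl
  have hdig (e : ℕ) : ¬ HasDigit I.n 0 t e := by
    rintro ⟨j, hj, -⟩
    omega
  refine Runs.for_ (Tb := 15) I.budget
    (fun k σ' => σ'.r 15 = t / (I.n * I.n) ^ k ∧
      ∀ e < I.n * I.n, σ'.a 0 e = if HasDigit I.n k t e then 1 else 0)
    (by simpa using hctx₁.budget_eq) (hK.trans hsq) (by simp) (by simp) ?_ ?_
    (fun _ _ h => h.2) (by have := Nat.mul_le_mul_right 23 hK; omega)
  · refine ⟨by simp, fun e he => ?_⟩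
    simpa [hdig] using hI₁ e he
  · rintro k hk σ' hf hi ⟨h15, hI⟩
    have h4 : σ'.r 4 = I.n * I.n := by
      rw [hf.r 4 (by decide)]
      simpa using hctx₁.sq_eq
    refine Runs.of_wp ?_ (by simp)
    simp only [Cm.wp, Ex.val, BinOp.eval, h15, h4, Store.setA_r, Nat.div_div_eq_div_mul,
      ← pow_succ]
    refine ⟨by omega, (Nat.div_le_self _ _).trans htB, by simp, fun e he => ?_⟩
    have hiff : HasDigit I.n (k + 1) t e ↔ editDigit I.n t k = e ∨ HasDigit I.n k t e := by
      constructor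
      · rintro ⟨j, hj, h⟩
        obtain rfl | hj' := Nat.eq_or_lt_of_le (Nat.le_of_lt_succ hj)
        · exact .inl h
        · exact .inr ⟨j, hj', h⟩
      · rintro (h | ⟨j, hj, h⟩)
        · exact ⟨k, by omega, h⟩
        · exact ⟨j, by omega, h⟩
    rw [if_congr hiff rfl rfl]
    by_cases hek : e = editDigit I.n t k
    · simp [hek, editDigit]
    · have := hI e he
      have hek' : e ≠ t / (I.n * I.n) ^ k % (I.n * I.n) := hek
      simp [Function.update_of_ne hek', Ne.symm hek, this]

/-- Adjacency after editing is the exclusive or of adjacency and edit mark, and the mark may stand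
at either order of the pair. The case `u = v` must be excluded since padding digits may mark the
diagonal. -/
theorem unedited_val {σ : Store} {i t u v : ℕ} (hinp : IsInput I inp) (hctx : Ctx I σ)
    (hi : i < I.ℓ) (h25 : σ.r 25 = i)
    (hF : ∀ e < I.n * I.n, σ.a 0 e = open Classical in
      if HasDigit I.n I.budget t e then 1 else 0)
    (hu : u < I.n) (hv : v < I.n) (h10 : σ.r 10 = u) (h11 : σ.r 11 = v) (huv : u ≠ v) :
    unedited.val inp σ =
      open Classical in if (I.edited i t).Adj ⟨u, hu⟩ ⟨v, hv⟩ then 0 else 1 := by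
  classical
  have h1 := hinp.adj i hi ⟨u, hu⟩ ⟨v, hv⟩
  have h2 := hF _ (pair_lt ⟨u, hu⟩ ⟨v, hv⟩)
  have h3 := hF _ (pair_lt ⟨v, hv⟩ ⟨u, hu⟩)
  have hne : (⟨u, hu⟩ : Fin I.n) ≠ ⟨v, hv⟩ := by simpa using huv
  simp only [unedited, Ex.val, BinOp.eval, h25, h10, h11, hctx.n_eq, hctx.sq_eq] at *
  have hadj : (I.edited i t).Adj ⟨u, hu⟩ ⟨v, hv⟩ ↔ _ := edit_adj (I.layer i)
  rw [h1, h2, h3]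
  by_cases e1 : (I.layer i).Adj ⟨u, hu⟩ ⟨v, hv⟩ <;>
    by_cases e2 : HasDigit I.n I.budget t (u * I.n + v) <;>
    by_cases e3 : HasDigit I.n I.budget t (v * I.n + u) <;>
    simp [hadj, e1, e2, e3, huv]

-- Labels first, then for each vertex a flag whether it violates `isClusterGraph_iff_label`, then a
-- scan of the flags: quadratic in total. The array `A` is a parameter because the two layers being
-- compared keep their labels in arrays `2` and `3`. Array `10` is only scratch space.
open Classical in
theorem runs_decode {A : Fin 16} (hA : A ≠ 0) (hA' : A ≠ 10) {σ : Store} {i t : ℕ}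
    (hB : IsBound I B) (hinp : IsInput I inp) (hctx : Ctx I σ) (hi : i < I.ℓ)
    (h25 : σ.r 25 = i) (h26 : σ.r 26 = t) (htB : t ≤ B) :
    Runs B inp (decodeCm A) σ (500 * ((I.n + 1) * (I.n + 1))) fun σ' =>
      σ'.r 14 = (if IsClusterGraph (I.edited i t) then 1 else 0) ∧
        ∀ v < I.n, σ'.a A v = label (I.edited i t) v := by
  have hnB := hB.n_le
  set H := I.edited i t with hH
  refine Runs.seq (T₁ := 60 * ((I.n + 1) * (I.n + 1))) (T₂ := 440 * ((I.n + 1) * (I.n + 1))) _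
    (runs_mark hB hctx h26 htB) ?_ (by omega)
  intro σ₁ hf₁ hI₁
  have hctx₁ := hctx.frame hf₁ (by decide)
  have h25₁ : σ₁.r 25 = i := (hf₁.r 25 (by decide)).trans h25
  have hscan (P : ℕ → Prop) (m : ℕ) : scanF P (fun k _ => k) m ≤ m := by
    rw [scanF_last]
    have := lastF_le P m
    omega
  have hscan' (P : ℕ → Prop) (m : ℕ) : scanF P (fun _ _ => 1) m ≤ 1 := by
    rcases scanF_const P m with ⟨h, -⟩ | ⟨h, -⟩ <;> omega
  refine Runs.seq (T₁ := I.n * (I.n * 72 + 25) + 6) (T₂ := 330 * ((I.n + 1) * (I.n + 1)))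
    (fun σ' => ∀ v < I.n, σ'.a A v = label H v)
    (runs_tabulate I.n (Nbr H) (fun k _ => k) hctx₁.n_eq (by omega)
      (by simp) (fun i _ k hk => (hscan _ _).trans (by omega)) ?_ ?_
      (by simp [unedited])) ?_ (by nlinarith)
  · intro σ' hf v hv u hu h11 h10
    have hctx' := hctx₁.frame hf (by decide)
    have h25' : σ'.r 25 = i := (hf.r 25 (by decide)).trans h25₁
    have h0 : σ'.a 0 = σ₁.a 0 := hf.a 0 (by simpa using hA.symm)
    refine ⟨?_, by simp [h10]⟩
    by_cases huv : u = v
    · subst huv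
      have : Nbr H u u := ⟨hu, hu, .inl rfl⟩
      simp [BinOp.eval, h10, h11, this]
    · have hval := unedited_val (t := t) hinp hctx' hi h25' (by rw [h0]; exact hI₁) hu hv h10 h11
        huv
      have hiff : Nbr H v u ↔ H.Adj ⟨u, hu⟩ ⟨v, hv⟩ :=
        ⟨fun ⟨_, _, h⟩ => h.resolve_left huv, fun h => ⟨hv, hu, .inr h⟩⟩
      simp only [Ex.val, BinOp.eval, h10, h11, hval, huv, if_false, hiff]
      by_cases ha : H.Adj ⟨u, hu⟩ ⟨v, hv⟩ <;> simp [ha, ← hH]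
  · intro σ' hf h v hv
    rw [h v hv, scanF_last]
    rfl
  intro σ₂ hf₂ hI₂
  have hctx₂ := hctx₁.frame hf₂ (by rw [wr_tabulate]; decide)
  have h25₂ : σ₂.r 25 = i := (hf₂.r 25 (by simp)).trans h25₁
  have h0₂ : σ₂.a 0 = σ₁.a 0 := hf₂.a 0 (by simpa using hA.symm)
  refine Runs.seq (T₁ := I.n * (I.n * 90 + 25) + 6) (T₂ := 200 * ((I.n + 1) * (I.n + 1)))
    (fun σ' => ∀ v < I.n, σ'.a 10 v = if ∃ (hv : v < I.n), ∃ u : Fin I.n, u ≠ ⟨v, hv⟩ ∧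
      ¬ (H.Adj u ⟨v, hv⟩ ↔ label H u = label H v) then 1 else 0)
    (runs_tabulate I.n (fun v u => ∃ (hv : v < I.n) (hu : u < I.n), u ≠ v ∧
        ¬ (H.Adj ⟨u, hu⟩ ⟨v, hv⟩ ↔ label H u = label H v)) (fun _ _ => 1) hctx₂.n_eq (by omega)
      (by simp) (fun i _ k hk => (hscan' _ _).trans (by omega)) ?_ ?_
      (by simp [unedited])) ?_ (by nlinarith)
  · intro σ' hf v hv u hu h11 h10
    have hctx' := hctx₂.frame hf (by decide)
    have h25' : σ'.r 25 = i := (hf.r 25 (by decide)).trans h25₂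
    have h0 : σ'.a 0 = σ₁.a 0 := (hf.a 0 (by decide)).trans h0₂
    have hAe : σ'.a A = σ₂.a A := hf.a A (by simpa using hA')
    refine ⟨?_, by simp⟩
    by_cases huv : u = v
    · subst huv
      simp [BinOp.eval, h10, h11]
    · have hval := unedited_val (t := t) hinp hctx' hi h25' (by rw [h0]; exact hI₁) hu hv h10 h11
        huv
      simp only [Ex.val, BinOp.eval, h10, h11, hval, huv, if_false, hAe, hI₂ u hu, hI₂ v hv, hu, hv,
        exists_true_left, ← hH]
      by_cases ha : H.Adj ⟨u, hu⟩ ⟨v, hv⟩ <;> by_cases hl : label H u = label H v <;>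
        simp [ha, hl, huv]
  · intro σ' hf h v hv
    rw [h v hv]
    rcases scanF_const (fun u => ∃ (hv : v < I.n) (hu : u < I.n), u ≠ v ∧
        ¬ (H.Adj ⟨u, hu⟩ ⟨v, hv⟩ ↔ label H u = label H v)) I.n with
      ⟨h0, u, hu, hv, _, h1, h2⟩ | ⟨h0, hne⟩
    · rw [h0, if_pos]
      exact ⟨hv, ⟨u, hu⟩, by simpa using h1, h2⟩
    · rw [h0, if_neg]
      rintro ⟨hv, u, h1, h2⟩
      exact hne ⟨u, u.2, hv, u.2, fun h => h1 (Fin.ext h), h2⟩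
  intro σ₃ hf₃ hI₃
  have hctx₃ := hctx₂.frame hf₃ (by rw [wr_tabulate]; decide)
  refine Runs.seq (T₁ := I.n * 20 + 8) (T₂ := 4)
    (fun σ' => σ'.r 12 = if IsClusterGraph H then 0 else 1)
    (runs_scan I.n (fun v => ∃ (hv : v < I.n), ∃ u : Fin I.n, u ≠ ⟨v, hv⟩ ∧
      ¬ (H.Adj u ⟨v, hv⟩ ↔ label H u = label H v)) (fun _ _ => 1) hctx₃.n_eq (by omega)
      (by simp) (fun k hk => (hscan' _ _).trans (by omega)) ?_ ?_
      (by simp)) ?_ (by nlinarith)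
  · intro σ' hf u hu h10
    have h10' : σ'.a 10 = σ₃.a 10 := hf.a 10 (by decide)
    simp only [Ex.val, h10, h10', hI₃ u hu, and_true]
    split_ifs with h
    · simp [h]
    · simp only [ne_eq, not_true, false_iff]; exact h
  · intro σ' hf h
    rw [h]
    rcases scanF_const (fun v => ∃ (hv : v < I.n), ∃ u : Fin I.n, u ≠ ⟨v, hv⟩ ∧
      ¬ (H.Adj u ⟨v, hv⟩ ↔ label H u = label H v)) I.n with ⟨h0, v, -, hv, u, h1, h2⟩ | ⟨h0, hne⟩
    · rw [h0, if_neg]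
      intro hc
      exact h2 (isClusterGraph_iff_label.1 hc u ⟨v, hv⟩ h1)
    · rw [h0, if_pos]
      rw [isClusterGraph_iff_label]
      intro u v huv
      by_contra h2
      exact hne ⟨v, v.2, v.2, u, huv, h2⟩
  intro σ₄ hf₄ hI₄
  have hA₃ : σ₃.a A = σ₂.a A := hf₃.a A (by simpa using hA')
  have hA₄ : σ₄.a A = σ₃.a A := hf₄.a A (by simp)
  refine Runs.of_wp ?_ (by simp)
  simp only [Cm.wp, Ex.val, BinOp.eval, hI₄]
  refine ⟨by split_ifs <;> omega, ?_, fun v hv => ?_⟩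
  · by_cases hc : IsClusterGraph H <;> simp [hc]
  · simp only [Store.setR_a, hA₄, hA₃, hI₂ v hv]

end TCE

namespace TCE

open Finset WordRAM ArrayMachine PartitionMatching

variable {B : ℕ} {inp : ℕ → ℕ} {I : Instance}

theorem classes_congr {n : ℕ} {f g f' g' : ℕ → ℕ} (h : Classes n f g) (hf : ∀ v < n, f' v = f v)
    (hg : ∀ v < n, g' v = g v) : Classes n f' g' where
  f_lt v hv := by rw [hf v hv]; exact h.f_lt v hv
  g_lt v hv := by rw [hg v hv]; exact h.g_lt v hv
  f_idem v hv := by rw [hf v hv, hf _ (h.f_lt v hv)]; exact h.f_idem v hv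
  le_f v hv := by rw [hf v hv]; exact h.le_f v hv

theorem isMaxAgree_congr {n : ℕ} {f g f' g' : ℕ → ℕ} {m : ℕ} (h : IsMaxAgree n f' g' m)
    (hf : ∀ v < n, f' v = f v) (hg : ∀ v < n, g' v = g v) : IsMaxAgree n f g m := by
  have hiff : ∀ X ⊆ range n, Agree f' g' X ↔ Agree f g X := fun X hX =>
    forall₂_congr fun u hu => forall₂_congr fun v hv => by
      have hu' := mem_range.1 (hX hu)
      have hv' := mem_range.1 (hX hv)
      rw [hf u hu', hf v hv', hg u hu', hg v hv']
  obtain ⟨⟨X, h1, h2, h3⟩, h4⟩ := h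
  exact ⟨⟨X, h1, (hiff X h1).1 h2, h3⟩, fun Y hY hA => h4 Y hY ((hiff Y hY).2 hA)⟩

/-! ### The main program

Entry `i * codes + t` of array `1` tells whether code `t` is reachable in layer `i`. Register `6` is
the layer, `7` and `8` are the codes for this and the next layer, `9` is the answer. -/

/-- Test whether the code in register `7` can precede the edited layer with labels in array `3`. -/
def pairCm : Cm :=
  .ite (.get 1 (.op .add (.op .mul (.v 6) (.v 5)) (.v 7)))
    (.set 25 (.v 6) ;; .set 26 (.v 7) ;; decodeCm 2 ;; matchCm ;;
      .ite (.op .lt (.op .add (.v 3) (.v 16)) (.v 0)) .skip (.set 9 (.c 1))) .skip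

/-- Compute whether the code in register `8` is reachable in the next layer. -/
def entryCm : Cm :=
  .set 25 (.op .add (.v 6) (.c 1)) ;; .set 26 (.v 8) ;; decodeCm 3 ;; .set 9 (.c 0) ;;
    .ite (.v 14) (.for_ 7 5 pairCm) .skip ;;
    .put 1 (.op .add (.op .mul (.op .add (.v 6) (.c 1)) (.v 5)) (.v 8)) (.v 9)

/-- Compute the global quantities. -/
def initCm : Cm :=
  (.set 0 (.inp (.c 0)) ;; .set 3 (.inp (.c 3)) ;; .set 4 (.op .mul (.v 0) (.v 0)) ;;
    .ite (.op .lt (.inp (.c 2)) (.v 4)) (.set 2 (.inp (.c 2))) (.set 2 (.v 4)) ;;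
    .set 27 (.op .sub (.inp (.c 1)) (.c 1)) ;; .set 5 (.c 1)) ;;
  .for_ 13 2 (.set 5 (.op .mul (.v 5) (.v 4)))

/-- Compute which codes are reachable in layer `0`. -/
def firstCm : Cm :=
  .set 25 (.c 0) ;; .for_ 7 5 (.set 26 (.v 7) ;; decodeCm 2 ;; .put 1 (.v 7) (.v 14))

/-- Find out whether a code is reachable in the last layer. -/
def answerCm : Cm :=
  .set 9 (.c 0) ;;
    .for_ 7 5 (.ite (.get 1 (.op .add (.op .mul (.v 27) (.v 5)) (.v 7))) (.set 9 (.c 1)) .skip)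

/-- The whole algorithm. -/
def mainCm : Cm := initCm ;; firstCm ;; .for_ 6 27 (.for_ 8 5 entryCm) ;; answerCm

/-- The first `k` entries for layer `i` are correct. -/
def RowCorrect (I : Instance) (i k : ℕ) (σ : Store) : Prop :=
  ∀ t < k, σ.a 1 (i * I.codes + t) = open Classical in if I.Reach i t then 1 else 0

/-- Lets additive constants in running times be absorbed into multiples of `(n + 1) ^ 2`. -/
theorem four_le_sq (I : Instance) : 4 ≤ (I.n + 1) * (I.n + 1) := by
  have := I.n_pos
  nlinarith

-- Codes that are not reachable are skipped. This also ensures that the matching program, which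
-- needs class functions of a partition, only meets cluster graphs.
open Classical in
theorem runs_pair {σ : Store} {i t : ℕ} {H' : SimpleGraph (Fin I.n)}
    (hB : IsBound I B) (hinp : IsInput I inp) (hctx : Ctx I σ) (hi : i < I.ℓ)
    (h6 : σ.r 6 = i) (h7 : σ.r 7 = t) (ht : t < I.codes)
    (hrow : σ.a 1 (i * I.codes + t) = if I.Reach i t then 1 else 0)
    (hH' : IsClusterGraph H') (h3 : ∀ v < I.n, σ.a 3 v = label H' v) :
    Runs B inp pairCm σ (2900 * ((I.n + 1) * (I.n + 1))) fun σ' =>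
      σ'.r 9 = if I.Reach i t ∧ AgreeUpTo I.d (I.edited i t) H' then 1 else σ.r 9 := by
  have hW := four_le_sq I
  have hcodes := hB.codes_le
  have hℓ := hB.ℓ_le
  refine Runs.ite (T₁ := 2850 * ((I.n + 1) * (I.n + 1))) (fun he => ?_) (fun he => ?_)
    (by simp; omega)
  · simp only [Ex.val, BinOp.eval, h6, h7, hctx.codes_eq, hrow] at he
    have hR : I.Reach i t := by
      by_contra hR
      simp [hR] at he
    have hH := hR.cluster
    refine Runs.seq (T₁ := 2) (T₂ := 2840 * ((I.n + 1) * (I.n + 1))) (fun σ' => σ' = σ.setR 25 i)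
      (Runs.of_wp (by simp [h6]; omega) (by simp)) ?_ (by omega)
    rintro _ - rfl
    refine Runs.seq (T₁ := 2) (T₂ := 2830 * ((I.n + 1) * (I.n + 1)))
      (fun σ' => σ' = (σ.setR 25 i).setR 26 t)
      (Runs.of_wp (by simp [h7]; omega) (by simp)) ?_ (by omega)
    rintro _ - rfl
    have hctx' : Ctx I ((σ.setR 25 i).setR 26 t) := hctx.frame (R := [25, 26]) (A := [])
      (Frame.setR (Frame.setR (.refl σ) (by simp) _) (by simp) _) (by decide)
    refine Runs.seq (T₂ := 2320 * ((I.n + 1) * (I.n + 1))) _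
      (runs_decode (A := 2) (t := t) (by decide) (by decide) hB hinp hctx' hi (by simp) (by simp)
        (by omega)) ?_ (by omega)
    rintro σ₁ hf₁ ⟨-, hl⟩
    have hctx₁ := hctx'.frame hf₁ (by decide)
    have h3₁ : ∀ v < I.n, σ₁.a 3 v = label H' v := by
      rw [hf₁.a 3 (by decide)]
      exact h3
    have h9₁ : σ₁.r 9 = σ.r 9 := by
      rw [hf₁.r 9 (by decide)]
      simp
    refine Runs.seq (T₂ := 20 * ((I.n + 1) * (I.n + 1))) _
      (runs_match hB.n_le (classes_congr (classes_label hH (H' := H')) hl h3₁) hctx₁.n_eq rfl rfl)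
      ?_ (by omega)
    intro σ₂ hf₂ hm
    have hctx₂ := hctx₁.frame hf₂ (by decide)
    have h9₂ : σ₂.r 9 = σ.r 9 := (hf₂.r 9 (by decide)).trans h9₁
    have hiff := consistent_iff (d := I.d) hH hH' (isMaxAgree_congr hm hl h3₁)
    refine Runs.of_wp ?_ (by simp; omega)
    simp only [Cm.wp, Ex.val, BinOp.eval, hctx₂.n_eq, hctx₂.d_eq, h9₂]
    refine ⟨fun hlt => ?_, fun hge => ⟨by omega, ?_⟩⟩
    · have hlt' : I.d + σ₂.r 16 < I.n := by
        by_contra hne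
        simp [hne] at hlt
      rw [if_neg]
      rintro ⟨-, hA⟩
      exact absurd (hiff.1 hA) (by omega)
    · have hge' : I.n ≤ I.d + σ₂.r 16 := by
        by_contra hne
        push Not at hne
        simp [hne] at hge
      rw [if_pos ⟨hR, hiff.2 hge'⟩]
      simp
  · simp only [Ex.val, BinOp.eval, h6, h7, hctx.codes_eq, hrow] at he
    have hR : ¬ I.Reach i t := by
      intro hR
      simp [hR] at he
    refine Runs.of_wp ?_ (by simp; omega)
    simp [hR]

theorem codes_pos (I : Instance) : 0 < I.codes := by
  have := I.n_pos
  unfold Instance.codes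
  positivity

-- The labels of the new layer are computed once, in array `3`, which testing the predecessors
-- leaves intact. The conclusion describes all of array `1`, so that the other entries are seen to
-- be kept.
open Classical in
theorem runs_entry {σ : Store} {i t : ℕ} (hB : IsBound I B) (hinp : IsInput I inp)
    (hctx : Ctx I σ) (hi : i + 1 < I.ℓ) (h6 : σ.r 6 = i) (h8 : σ.r 8 = t) (ht : t < I.codes)
    (hrow : RowCorrect I i I.codes σ) :
    Runs B inp entryCm σ (I.codes * (3500 * ((I.n + 1) * (I.n + 1)))) fun σ' =>
      σ'.a 1 = Function.update (σ.a 1) ((i + 1) * I.codes + t)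
        (if I.Reach (i + 1) t then 1 else 0) := by
  have hW := four_le_sq I
  have hcodes := hB.codes_le
  have hS := codes_pos I
  have hℓ := hB.ℓ_le
  set W := (I.n + 1) * (I.n + 1) with hWdef
  have hSW : W ≤ I.codes * W := Nat.le_mul_of_pos_left _ hS
  have hS4 : I.codes * 4 ≤ I.codes * W := Nat.mul_le_mul_left _ hW
  refine Runs.seq (T₁ := 4) (T₂ := I.codes * W * 3499) (fun σ' => σ' = σ.setR 25 (i + 1))
    (Runs.of_wp (by simp [h6, BinOp.eval]; omega) (by simp)) ?_ (by linarith)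
  rintro _ - rfl
  refine Runs.seq (T₁ := 2) (T₂ := I.codes * W * 3498)
    (fun σ' => σ' = (σ.setR 25 (i + 1)).setR 26 t)
    (Runs.of_wp (by simp [h8]; omega) (by simp)) ?_ (by linarith)
  rintro _ - rfl
  have hctx' : Ctx I ((σ.setR 25 (i + 1)).setR 26 t) := hctx.frame (R := [25, 26]) (A := [])
    (Frame.setR (Frame.setR (.refl σ) (by simp) _) (by simp) _) (by decide)
  refine Runs.seq (T₂ := I.codes * W * 2998) _
    (runs_decode (A := 3) (t := t) (by decide) (by decide) hB hinp hctx' hi (by simp) (by simp)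
      (by omega)) ?_ (by rw [← hWdef]; linarith)
  rintro σ₁ hf₁ ⟨h14, hl⟩
  have hctx₁ := hctx'.frame hf₁ (by decide)
  have h6₁ : σ₁.r 6 = i := by rw [hf₁.r 6 (by decide)]; simp [h6]
  have h8₁ : σ₁.r 8 = t := by rw [hf₁.r 8 (by decide)]; simp [h8]
  have h1₁ : σ₁.a 1 = σ.a 1 := by rw [hf₁.a 1 (by decide)]; simp
  refine Runs.seq (T₁ := 2) (T₂ := I.codes * W * 2997) (fun σ' => σ' = σ₁.setR 9 0)
    (Runs.of_wp (by simp) (by simp)) ?_ (by linarith)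
  rintro _ - rfl
  refine Runs.seq (T₁ := I.codes * W * 2990) (T₂ := 15)
    (fun σ' => σ'.r 9 = if I.Reach (i + 1) t then 1 else 0)
    (Runs.ite (T₁ := I.codes * W * 2980) (fun he => ?_) (fun he => ?_) ?_) ?_ ?_
  · have hH : IsClusterGraph (I.edited (i + 1) t) := by
      by_contra hne
      simp [h14, hne] at he
    refine Runs.for_ (Tb := 2900 * W) I.codes (fun k σ' => σ'.r 9 = if ∃ t' < k, I.Reach i t' ∧
        AgreeUpTo I.d (I.edited i t') (I.edited (i + 1) t) then 1 else 0)
      (by simpa using hctx₁.codes_eq) hcodes (by decide) (by decide) (by simp) ?_ ?_ ?_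
    · intro k hk σ' hf h7 hI
      have hctx'' : Ctx I σ' := (hctx₁.frame (R := [9]) (A := [])
        (Frame.setR (.refl σ₁) (by simp) _) (by decide)).frame hf (by decide)
      have h6' : σ'.r 6 = i := by rw [hf.r 6 (by decide)]; simpa using h6₁
      have h1' : σ'.a 1 = σ.a 1 := by rw [hf.a 1 (by decide)]; simpa using h1₁
      refine (runs_pair hB hinp hctx'' (by omega) h6' h7 hk (by rw [h1']; exact hrow k hk) hH
        (by rw [hf.a 3 (by decide)]; exact hl)).mono le_rfl fun σ'' _ h => ?_
      have : (∃ t' < k + 1, I.Reach i t' ∧ AgreeUpTo I.d (I.edited i t') (I.edited (i + 1) t)) ↔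
          (I.Reach i k ∧ AgreeUpTo I.d (I.edited i k) (I.edited (i + 1) t)) ∨
          ∃ t' < k, I.Reach i t' ∧ AgreeUpTo I.d (I.edited i t') (I.edited (i + 1) t) := by
        constructor
        · rintro ⟨t', h1, h2⟩
          obtain rfl | h1' := Nat.eq_or_lt_of_le (Nat.le_of_lt_succ h1)
          · exact .inl h2
          · exact .inr ⟨t', h1', h2⟩
        · rintro (h | ⟨t', h1, h2⟩)
          · exact ⟨k, by omega, h⟩
          · exact ⟨t', by omega, h2⟩
      simp only [Store.setR_r, Nat.reduceEqDiff, if_false]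
      rw [h, hI, if_congr this rfl rfl]
      by_cases c1 : I.Reach i k ∧ AgreeUpTo I.d (I.edited i k) (I.edited (i + 1) t)
      · rw [if_pos c1, if_pos (.inl c1)]
      · rw [if_neg c1]
        by_cases c2 : ∃ t' < k, I.Reach i t' ∧ AgreeUpTo I.d (I.edited i t') (I.edited (i + 1) t)
        · rw [if_pos c2, if_pos (.inr c2)]
        · rw [if_neg c2, if_neg (not_or.2 ⟨c1, c2⟩)]
    · intro σ' _ h
      rw [h]
      refine if_congr ?_ rfl rfl
      rw [Instance.Reach, and_iff_right hH]
    · linarith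
  · have hH : ¬ IsClusterGraph (I.edited (i + 1) t) := by
      intro hc
      simp [h14, hc] at he
    refine Runs.of_wp ?_ (by simp; linarith)
    simp [Instance.Reach, hH]
  · simp only [Ex.cost]; linarith
  · intro σ₂ hf₂ h9
    have hctx₂ : Ctx I σ₂ := (hctx₁.frame (R := [9]) (A := [])
        (Frame.setR (.refl σ₁) (by simp) _) (by decide)).frame hf₂ (by decide)
    have h6₂ : σ₂.r 6 = i := by rw [hf₂.r 6 (by decide)]; simpa using h6₁
    have h8₂ : σ₂.r 8 = t := by rw [hf₂.r 8 (by decide)]; simpa using h8₁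
    have h1₂ : σ₂.a 1 = σ.a 1 := by rw [hf₂.a 1 (by decide)]; simpa using h1₁
    refine Runs.of_wp ?_ (by simp)
    simp only [Cm.wp, Ex.val, BinOp.eval, h6₂, h8₂, h9, hctx₂.codes_eq]
    refine ⟨by split_ifs <;> omega, ?_⟩
    simp [h1₂]
  · linarith

open Classical in
theorem runs_layer {σ : Store} {i : ℕ} (hB : IsBound I B) (hinp : IsInput I inp)
    (hctx : Ctx I σ) (hi : i + 1 < I.ℓ) (h6 : σ.r 6 = i) (hrow : RowCorrect I i I.codes σ) :
    Runs B inp (.for_ 8 5 entryCm) σ (I.codes * (I.codes * (3600 * ((I.n + 1) * (I.n + 1)))))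
      (RowCorrect I (i + 1) I.codes) := by
  have hW := four_le_sq I
  have hS := codes_pos I
  set W := (I.n + 1) * (I.n + 1) with hWdef
  refine Runs.for_ (Tb := I.codes * (3500 * W)) I.codes
    (fun k σ' => RowCorrect I i I.codes σ' ∧ RowCorrect I (i + 1) k σ') hctx.codes_eq hB.codes_le
    (by decide) (by decide) ⟨hrow, fun t ht => by omega⟩ ?_ (fun _ _ h => h.2) ?_
  · rintro k hk σ' hf h8 ⟨hI₁, hI₂⟩
    have hctx' := hctx.frame hf (by decide)
    have h6' : σ'.r 6 = i := (hf.r 6 (by decide)).trans h6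
    refine (runs_entry hB hinp hctx' hi h6' h8 hk hI₁).mono le_rfl fun σ'' _ h => ⟨?_, ?_⟩
    · intro t ht
      have hne : i * I.codes + t ≠ (i + 1) * I.codes + k := by rw [add_mul]; omega
      rw [Store.setR_a, h, Function.update_of_ne hne]
      exact hI₁ t ht
    · intro t ht
      rw [Store.setR_a, h]
      obtain rfl | ht' := Nat.eq_or_lt_of_le (Nat.le_of_lt_succ ht)
      · rw [Function.update_self]
      · have hne : (i + 1) * I.codes + t ≠ (i + 1) * I.codes + k := by omega
        rw [Function.update_of_ne hne]
        exact hI₂ t ht'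
  · have h1 : I.codes * 4 ≤ I.codes * W := Nat.mul_le_mul_left _ hW
    have h2 : I.codes * (I.codes * 4) ≤ I.codes * (I.codes * W) := Nat.mul_le_mul_left _ h1
    have h3 : I.codes ≤ I.codes * I.codes := Nat.le_mul_of_pos_left _ hS
    linarith

theorem runs_init {σ : Store} (hB : IsBound I B) (hinp : IsInput I inp) :
    Runs B inp initCm σ (100 * ((I.n + 1) * (I.n + 1))) (Ctx I) := by
  have h1 := hB.n_le
  have h2 := hB.sq_le
  have h3 := hB.ℓ_le
  have h4 := hB.k_le
  have h5 := hB.d_le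
  have hn := I.n_pos
  have hK : I.budget ≤ I.n * I.n := min_le_right _ _
  refine Runs.seq (T₁ := 60) (T₂ := I.n * I.n * 12 + 6)
    (fun σ' => σ'.r 0 = I.n ∧ σ'.r 2 = I.budget ∧ σ'.r 3 = I.d ∧ σ'.r 4 = I.n * I.n ∧
      σ'.r 27 = I.ℓ - 1 ∧ σ'.r 5 = 1) (Runs.of_wp ?_ (by simp)) ?_ (by nlinarith)
  · simp only [Cm.wp, Ex.val, BinOp.eval, hinp.n_eq, hinp.ℓ_eq, hinp.k_eq, hinp.d_eq,
      Store.setR_r, Nat.reduceEqDiff, if_true, if_false]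
    refine ⟨by omega, h5, h2, fun h => ?_, fun h => ?_⟩
    · have hlt : I.k < I.n * I.n := by
        by_contra hne
        simp [hne] at h
      exact ⟨h4, by omega, by omega, trivial, (min_eq_left hlt.le).symm, trivial, trivial, trivial,
        trivial⟩
    · have hge : I.n * I.n ≤ I.k := by
        by_contra hne
        push Not at hne
        simp [hne] at h
      exact ⟨h2, by omega, by omega, trivial, (min_eq_right hge).symm, trivial, trivial, trivial,
        trivial⟩
  rintro σ₁ - ⟨e0, e2, e3, e4, e27, e5⟩
  refine Runs.for_ (Tb := 4) I.budget (fun k σ' => σ'.r 5 = (I.n * I.n) ^ k) e2 (hK.trans h2)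
    (by simp) (by simp) (by simpa using e5) ?_ ?_ (by have := Nat.mul_le_mul_right 12 hK; omega)
  · intro k hk σ' hf hi hI
    have h4' : σ'.r 4 = I.n * I.n := (hf.r 4 (by decide)).trans e4
    refine Runs.of_wp ?_ (by simp)
    simp only [Cm.wp, Ex.val, BinOp.eval, hI, h4', ← pow_succ]
    -- The intermediate powers are at most the final one, hence storable.
    refine ⟨(Nat.pow_le_pow_right (by positivity) hk).trans hB.codes_le, by simp⟩
  · intro σ' hf hI
    exact ⟨(hf.r 0 (by decide)).trans e0, (hf.r 2 (by decide)).trans e2,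
      (hf.r 3 (by decide)).trans e3, (hf.r 4 (by decide)).trans e4, hI,
      (hf.r 27 (by decide)).trans e27⟩

open Classical in
theorem runs_first {σ : Store} (hB : IsBound I B) (hinp : IsInput I inp) (hctx : Ctx I σ) :
    Runs B inp firstCm σ (I.codes * (600 * ((I.n + 1) * (I.n + 1))))
      (RowCorrect I 0 I.codes) := by
  have hW := four_le_sq I
  have hS := codes_pos I
  have hcodes := hB.codes_le
  have hn := hB.n_le
  set W := (I.n + 1) * (I.n + 1) with hWdef
  have h1 : I.codes * 4 ≤ I.codes * W := Nat.mul_le_mul_left _ hW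
  refine Runs.seq (T₁ := 2) (T₂ := I.codes * W * 599) (fun σ' => σ' = σ.setR 25 0)
    (Runs.of_wp (by simp) (by simp)) ?_ (by linarith)
  rintro _ - rfl
  have hctx₀ : Ctx I (σ.setR 25 0) := hctx.frame (R := [25]) (A := [])
    (Frame.setR (.refl σ) (by simp) _) (by decide)
  refine Runs.for_ (Tb := 500 * W + 11) I.codes (RowCorrect I 0) hctx₀.codes_eq hB.codes_le
    (by decide) (by decide) (fun t ht => by omega) ?_ (fun _ _ h => h) (by linarith)
  intro k hk σ' hf h7 hI
  have hctx' := hctx₀.frame hf (by decide)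
  refine Runs.seq (T₁ := 2) (T₂ := 500 * W + 9) (fun σ'' => σ'' = σ'.setR 26 k)
    (Runs.of_wp (by simp [h7]; omega) (by simp)) ?_ (by omega)
  rintro _ - rfl
  have hctx'' : Ctx I (σ'.setR 26 k) := hctx'.frame (R := [26]) (A := [])
    (Frame.setR (.refl σ') (by simp) _) (by decide)
  have h25 : (σ'.setR 26 k).r 25 = 0 := by
    have := hf.r 25 (by decide)
    simpa using this
  refine Runs.seq (T₂ := 9) _ (runs_decode (A := 2) (t := k) (by decide) (by decide) hB hinp hctx''
    I.ℓ_pos h25 (by simp) (by omega)) ?_ (by omega)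
  rintro σ₁ hf₁ ⟨h14, -⟩
  have h7₁ : σ₁.r 7 = k := by rw [hf₁.r 7 (by decide)]; simpa using h7
  have h1₁ : σ₁.a 1 = σ'.a 1 := by rw [hf₁.a 1 (by decide)]; simp
  refine Runs.of_wp ?_ (by simp)
  simp only [Cm.wp, Ex.val, h14, h7₁]
  refine ⟨by split_ifs <;> omega, fun t ht => ?_⟩
  obtain rfl | ht' := Nat.eq_or_lt_of_le (Nat.le_of_lt_succ ht)
  · by_cases hc : IsClusterGraph (I.edited 0 t) <;> simp [Instance.Reach, hc]
  · have := hI t ht'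
    have hne : t ≠ k := by omega
    simpa [h1₁, Function.update_of_ne hne] using this

open Classical in
theorem runs_answer {σ : Store} (hB : IsBound I B) (hctx : Ctx I σ)
    (hrow : RowCorrect I (I.ℓ - 1) I.codes σ) :
    Runs B inp answerCm σ (I.codes * 40) fun σ' => σ'.r 9 = if I.IsYes then 1 else 0 := by
  have hS := codes_pos I
  have hn := hB.n_le
  refine Runs.seq (T₁ := 2) (T₂ := I.codes * 38) (fun σ' => σ' = σ.setR 9 0)
    (Runs.of_wp (by simp) (by simp)) ?_ (by omega)
  rintro _ - rfl
  have hctx₀ : Ctx I (σ.setR 9 0) := hctx.frame (R := [9]) (A := [])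
    (Frame.setR (.refl σ) (by simp) _) (by decide)
  refine Runs.for_ (Tb := 16) I.codes
    (fun k σ' => σ'.r 9 = if ∃ t < k, I.Reach (I.ℓ - 1) t then 1 else 0) hctx₀.codes_eq hB.codes_le
    (by decide) (by decide) (by simp) ?_ ?_ (by omega)
  · intro k hk σ' hf h7 hI
    have hctx' := hctx₀.frame hf (by decide)
    have h1 : σ'.a 1 = σ.a 1 := by rw [hf.a 1 (by decide)]; simp
    refine Runs.of_wp ?_ (by simp)
    simp only [Cm.wp, Ex.val, BinOp.eval, h7, hctx'.last_eq, hctx'.codes_eq, h1, hrow k hk]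
    have hiff : (∃ t < k + 1, I.Reach (I.ℓ - 1) t) ↔
        I.Reach (I.ℓ - 1) k ∨ ∃ t < k, I.Reach (I.ℓ - 1) t := by
      constructor
      · rintro ⟨t, h1, h2⟩
        obtain rfl | h1' := Nat.eq_or_lt_of_le (Nat.le_of_lt_succ h1)
        · exact .inl h2
        · exact .inr ⟨t, h1', h2⟩
      · rintro (h | ⟨t, h1, h2⟩)
        · exact ⟨k, by omega, h⟩
        · exact ⟨t, by omega, h2⟩
    by_cases hR : I.Reach (I.ℓ - 1) k
    · have : ∃ t < k + 1, I.Reach (I.ℓ - 1) t := ⟨k, by omega, hR⟩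
      rw [if_pos hR, if_pos this]
      exact ⟨fun _ => ⟨by omega, by simp⟩, fun h => absurd h one_ne_zero⟩
    · rw [if_neg hR, if_congr (hiff.trans (or_iff_right hR)) rfl rfl]
      exact ⟨fun h => absurd rfl h, fun _ => by simpa using hI⟩
  · intro σ' _ h
    rw [h]
    exact if_congr I.isYes_iff.symm rfl rfl

open Classical in
theorem runs_main {σ : Store} (hB : IsBound I B) (hinp : IsInput I inp) :
    Runs B inp mainCm σ (I.ℓ * (I.codes * (I.codes * (4500 * ((I.n + 1) * (I.n + 1))))))
      fun σ' => σ'.r 9 = if I.IsYes then 1 else 0 := by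
  have hW := four_le_sq I
  have hS := codes_pos I
  have hℓ := I.ℓ_pos
  have hℓB := hB.ℓ_le
  set W := (I.n + 1) * (I.n + 1) with hWdef
  -- There are `l = ℓ - 1` transitions between layers; the share of the remaining layer in the time
  -- bound pays for initialization, first row and answer.
  obtain ⟨l, hl⟩ : ∃ l, I.ℓ = l + 1 := ⟨I.ℓ - 1, by omega⟩
  set V := I.codes * (I.codes * W) with hV
  have e1 : I.codes * W ≤ V := Nat.le_mul_of_pos_left _ hS
  have e2 : W ≤ I.codes * W := Nat.le_mul_of_pos_left _ hS
  have e3 : I.codes * 4 ≤ I.codes * W := Nat.mul_le_mul_left _ hW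
  have e4 : l * 4 ≤ l * V := Nat.mul_le_mul_left _ (by omega)
  have e5 : I.ℓ * (I.codes * (I.codes * (4500 * W))) = 4500 * (l * V) + 4500 * V := by
    rw [hl, hV]; ring
  rw [e5]
  refine Runs.seq (T₁ := 100 * W) (T₂ := 4500 * (l * V) + 4400 * V) _
    (runs_init hB hinp) ?_ (by omega)
  intro σ₁ hf₁ hctx₁
  refine Runs.seq (T₂ := 4500 * (l * V) + 3800 * V) _
    (runs_first hB hinp hctx₁) ?_ (by rw [← hWdef]; linarith)
  intro σ₂ hf₂ hrow₂
  have hctx₂ := hctx₁.frame hf₂ (by decide)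
  refine Runs.seq (T₁ := 4500 * (l * V) + 6) (T₂ := I.codes * 40)
    (RowCorrect I (I.ℓ - 1) I.codes) ?_ ?_ (by omega)
  · refine Runs.for_ (Tb := I.codes * (I.codes * (3600 * W))) (I.ℓ - 1)
      (fun i σ' => RowCorrect I i I.codes σ') hctx₂.last_eq (by omega) (by decide) (by decide)
      hrow₂ ?_ (fun _ _ h => h) ?_
    · intro i hi σ' hf h6 hI
      exact (runs_layer hB hinp (hctx₂.frame hf (by decide)) (by omega) h6 hI).mono le_rfl
        fun _ _ h => h
    · have e6 : I.codes * (I.codes * (3600 * W)) = 3600 * V := by rw [hV]; ring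
      rw [e6, show I.ℓ - 1 = l by omega]
      linarith
  · intro σ₃ hf₃ hrow₃
    exact runs_answer hB (hctx₂.frame hf₃ (by decide)) hrow₃

end TCE

namespace TCE

open Finset WordRAM ArrayMachine

/-! ### The encoding of instances -/

theorem getElem?_flatMap_of_length {α β : Type*} {f : α → List β} {L : ℕ}
    (hf : ∀ a, (f a).length = L) (l : List α) {i j : ℕ} (hi : i < l.length) (hj : j < L) :
    (l.flatMap f)[i * L + j]? = (f l[i])[j]? := by
  induction l generalizing i with
  | nil => simp at hi
  | cons a l ih =>
    rw [List.flatMap_cons]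
    cases i with
    | zero => rw [List.getElem?_append_left (by rw [hf]; omega)]; simp
    | succ i =>
      rw [List.getElem?_append_right (by rw [hf, add_mul]; omega), hf]
      rw [show (i + 1) * L + j - L = i * L + j by rw [add_mul]; omega]
      rw [ih (by simpa using hi)]
      simp

theorem length_flatMap_of_length {α β : Type*} {f : α → List β} {L : ℕ}
    (hf : ∀ a, (f a).length = L) (l : List α) : (l.flatMap f).length = l.length * L := by
  simp [List.length_flatMap, hf]

theorem length_encode (I : Instance) : I.encode.length = 4 + I.ℓ * (I.n * I.n) := by
  classical
  rw [Instance.encode, List.length_append, length_flatMap_of_length (L := I.n * I.n)]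
  · simp
  · intro i
    rw [length_flatMap_of_length (L := I.n)]
    · simp
    · simp

theorem isInput_encode (I : Instance) : IsInput I fun x => I.encode.getD x 0 where
  n_eq := rfl
  ℓ_eq := rfl
  k_eq := rfl
  d_eq := rfl
  adj i hi u v := by
    classical
    have hu := u.2
    have hv := v.2
    have h1 := pair_lt u v
    rw [List.getD_eq_getElem?_getD, Instance.encode,
      List.getElem?_append_right (by simp; omega)]
    have h2 : 4 + i * (I.n * I.n) + (u * I.n + v) - [I.n, I.ℓ, I.k, I.d].length =
        i * (I.n * I.n) + (u * I.n + v) := by simp; omega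
    rw [h2, getElem?_flatMap_of_length _ _ (by simpa using hi) h1,
      getElem?_flatMap_of_length _ _ (by simp) hv]
    · simp [Instance.layer, hi]
    · simp
    · intro i
      rw [length_flatMap_of_length (L := I.n)]
      · simp
      · simp

theorem le_sum_encode (I : Instance) : I.n + I.ℓ + I.k + I.d ≤ I.encode.sum := by
  classical
  rw [Instance.encode, List.sum_append]
  simp only [List.sum_cons, List.sum_nil]
  omega

/-! ### The word RAM program -/

/-- The program: store the input length in register `0`, run the algorithm, copy the answer. -/
def program : Prog :=
  .seq (.assign 0 (.bin .add (.const 4)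
      (.bin .mul (.load (.const 1)) (.bin .mul (.load (.const 0)) (.load (.const 0))))))
    (.seq mainCm.compile (.assign 0 (.reg 10)))

/-- The time bound in terms of the number of edits that matter. -/
def timeBound (I : Instance) : ℕ := 20000 * (I.ℓ * I.n ^ (4 * I.budget + 2))

/-- The bound is the quantity whose logarithm governs the word length in `DecidesInTime`. The number
of codes fits because it is below the running time. -/
theorem isBound (I : Instance) : IsBound I (I.encode.length + I.encode.sum + timeBound I) := by
  have h1 := le_sum_encode I
  have h2 := length_encode I
  have hn := I.n_pos
  have hℓ := I.ℓ_pos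
  have h3 : I.n * I.n ≤ I.ℓ * (I.n * I.n) := Nat.le_mul_of_pos_left _ hℓ
  have h4 : I.n ≤ I.n * I.n := Nat.le_mul_of_pos_left _ hn
  have h5 : I.codes ≤ timeBound I := by
    have e1 : I.codes = I.n ^ (2 * I.budget) := by
      rw [Instance.codes, ← sq, ← pow_mul]
    have e2 : I.n ^ (2 * I.budget) ≤ I.n ^ (4 * I.budget + 2) :=
      Nat.pow_le_pow_right hn (by omega)
    have e3 : I.n ^ (4 * I.budget + 2) ≤ I.ℓ * I.n ^ (4 * I.budget + 2) :=
      Nat.le_mul_of_pos_left _ hℓ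
    rw [timeBound]
    omega
  constructor <;> omega

/-- Here `codes ^ 2 = n ^ (4 * budget)`, and `(n + 1) ^ 2 ≤ 4 * n ^ 2` raises the constant to
`18000`. The `14` covers the first and last assignment of `program`. -/
theorem main_time_le (I : Instance) :
    I.ℓ * (I.codes * (I.codes * (4500 * ((I.n + 1) * (I.n + 1))))) + 14 ≤ timeBound I := by
  have hn := I.n_pos
  have hℓ := I.ℓ_pos
  have e1 : I.codes * I.codes = I.n ^ (4 * I.budget) := by
    rw [Instance.codes, ← sq, ← sq, ← pow_mul, ← pow_mul]
    congr 1
    ring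
  have e2 : (I.n + 1) * (I.n + 1) ≤ 4 * (I.n * I.n) := by nlinarith
  have e3 : 1 ≤ I.ℓ * I.n ^ (4 * I.budget + 2) := Nat.succ_le_of_lt (by positivity)
  calc I.ℓ * (I.codes * (I.codes * (4500 * ((I.n + 1) * (I.n + 1))))) + 14
      ≤ I.ℓ * (I.codes * (I.codes * (4500 * (4 * (I.n * I.n))))) + 14 := by gcongr
    _ = 18000 * (I.ℓ * (I.codes * I.codes * (I.n * I.n))) + 14 := by ring
    _ = 18000 * (I.ℓ * I.n ^ (4 * I.budget + 2)) + 14 := by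
        rw [e1, pow_add, sq]
    _ ≤ timeBound I := by rw [timeBound]; omega

/-- The machine is not told the length of its input, which is needed to place the arrays; it is
recovered as `4 + ℓ * (n * n)` from the first two cells. -/
theorem program_exec {B w : ℕ} (I : Instance) (hB : IsBound I B)
    (hBi : ∀ x, I.encode.getD x 0 ≤ B) (hlen : I.encode.length ≤ B)
    (hw : (B + 2) ^ progDeg program < 2 ^ w) :
    ∃ (s : State) (t : ℕ), Exec w program (startState I.encode) s t ∧ t ≤ timeBound I ∧
      (I.IsYes → s.regs 0 = 1) ∧ (¬ I.IsYes → s.regs 0 = 0) := by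
  classical
  have hD : progDeg mainCm.compile ≤ progDeg program := by
    simp only [program, progDeg, exprDeg]
    omega
  obtain ⟨h1, -⟩ := expr_eval_eq (s := startState I.encode) hw (by simp [startState])
    hBi (.bin .add (.const 4)
      (.bin .mul (.load (.const 1)) (.bin .mul (.load (.const 0)) (.load (.const 0)))))
    (by simp only [program, progDeg, exprDeg]; omega)
  have h2 : exprVal (startState I.encode) (.bin .add (.const 4)
      (.bin .mul (.load (.const 1)) (.bin .mul (.load (.const 0)) (.load (.const 0))))) =
      I.encode.length := by
    rw [length_encode]
    rfl
  rw [h2] at h1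
  have hrep : Rep B I.encode ⟨Function.update (startState I.encode).regs 0 I.encode.length,
      (startState I.encode).mem⟩ ⟨fun _ => 0, fun _ _ => 0⟩ := by
    refine ⟨by simp, fun r => by simp [startState], fun j i => ?_, fun x _ => rfl, fun r => ?_, hBi⟩
    · exact List.getD_eq_default _ _ (by omega)
    · cases r with
      | zero => simpa using hlen
      | succ r => simp [startState]
  obtain ⟨σ', t, h3, h4, h5⟩ :=
    runs_main (σ := ⟨fun _ => 0, fun _ _ => 0⟩) hB (isInput_encode I)
  obtain ⟨s', h6, h7⟩ := h3.exec hw (by omega) hrep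
  -- Compilation shifts registers by one, so the answer in register `9` is found in register `10`.
  have h8 : s'.regs 10 = if I.IsYes then 1 else 0 := (h7.regs 9).trans h5
  have h9 := main_time_le I
  refine ⟨_, _, .seq (.assign h1) (.seq h6 (.assign (r := 0) (e := .reg 10) rfl)), ?_, ?_, ?_⟩
  · simp only [Expr.cost]
    omega
  · intro h
    simp [h8, h]
  · intro h
    simp [h8, h]

theorem getD_le_sum (l : List ℕ) (x : ℕ) : l.getD x 0 ≤ l.sum := by
  rw [List.getD_eq_getElem?_getD]
  by_cases hx : x < l.length
  · rw [List.getElem?_eq_getElem hx]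
    exact List.le_sum_of_mem (List.getElem_mem hx)
  · rw [List.getElem?_eq_none (by omega)]
    simp

theorem program_decides :
    DecidesInTime program Instance.encode Instance.IsYes timeBound := by
  -- `B + 2 ≤ 2 ^ (2 * Nat.size B)` accounts for the factor `2 * progDeg program`; the summand `1`
  -- makes the inequality strict.
  refine ⟨2 * progDeg program + 1, fun I w hw => ?_⟩
  set B := I.encode.length + I.encode.sum + timeBound I with hBdef
  refine program_exec I (isBound I) (fun x => ?_) ?_ ?_
  · have := getD_le_sum I.encode x
    omega
  · omega
  · have hpos : 4 ≤ B := by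
      have := length_encode I
      omega
    have h1 : B < 2 ^ Nat.size B := Nat.lt_size_self B
    have hs : 1 ≤ Nat.size B := Nat.size_pos.2 (by omega)
    have h2 : B + 2 ≤ 2 ^ (2 * Nat.size B) := by
      have : 2 ^ 1 ≤ 2 ^ Nat.size B := Nat.pow_le_pow_right (by omega) hs
      rw [two_mul, pow_add]
      nlinarith
    calc (B + 2) ^ progDeg program ≤ (2 ^ (2 * Nat.size B)) ^ progDeg program :=
          Nat.pow_le_pow_left h2 _
      _ = 2 ^ (2 * Nat.size B * progDeg program) := by rw [← pow_mul]
      _ < 2 ^ ((2 * progDeg program + 1) * Nat.size B) := by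
          refine Nat.pow_lt_pow_right (by omega) ?_
          nlinarith
      _ ≤ 2 ^ w := Nat.pow_le_pow_right (by omega) hw

/-- A larger time bound also strengthens the assumption on the word length, so the same constant `c`
works. -/
theorem decidesInTime_mono {X : Type*} {P : Prog} {enc : X → List ℕ} {L : X → Prop}
    {T T' : X → ℕ} (h : DecidesInTime P enc L T) (hT : ∀ x, T x ≤ T' x) :
    DecidesInTime P enc L T' := by
  obtain ⟨c, h⟩ := h
  refine ⟨c, fun x w hw => ?_⟩
  obtain ⟨s, t, h1, h2, h3⟩ := h x w (le_trans (Nat.mul_le_mul_left _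
    (Nat.size_le_size (Nat.add_le_add_left (hT x) _))) hw)
  exact ⟨s, t, h1, h2.trans (hT x), h3⟩

theorem length_le_bitSize (l : List ℕ) : l.length ≤ bitSize l := by
  induction l with
  | nil => simp [bitSize]
  | cons a l ih =>
    simp only [bitSize, List.map_cons, List.sum_cons, List.length_cons] at ih ⊢
    omega

theorem n_le_bitSize (I : Instance) : I.n ≤ bitSize I.encode := by
  have h1 := length_le_bitSize I.encode
  have hn := I.n_pos
  have hℓ := I.ℓ_pos
  have h3 : I.n * I.n ≤ I.ℓ * (I.n * I.n) := Nat.le_mul_of_pos_left _ hℓ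
  have h4 : I.n ≤ I.n * I.n := Nat.le_mul_of_pos_left _ hn
  rw [length_encode] at h1
  omega

theorem ℓ_le_bitSize (I : Instance) : I.ℓ ≤ bitSize I.encode := by
  have h1 := length_le_bitSize I.encode
  have hn := I.n_pos
  have h3 : I.ℓ ≤ I.ℓ * (I.n * I.n) := Nat.le_mul_of_pos_right _ (by positivity)
  rw [length_encode] at h1
  omega

end TCE

/-! ### The three time bounds. -/

theorem theorem2 :
    (∃ (P : WordRAM.Prog) (C : ℕ),
      WordRAM.DecidesInTime P TCE.Instance.encode TCE.Instance.IsYes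
        (fun I => C * (I.ℓ * I.n ^ (4 * I.k + 2) * max 1 (Nat.log 2 I.n)))) ∧
    WordRAM.InXP TCE.Instance.encode (fun I => I.k) TCE.Instance.IsYes ∧
    WordRAM.InFPT TCE.Instance.encode (fun I => I.n) TCE.Instance.IsYes := by
  have hk (I : TCE.Instance) : I.n ^ (4 * I.budget + 2) ≤ I.n ^ (4 * I.k + 2) :=
    Nat.pow_le_pow_right I.n_pos (by have : I.budget ≤ I.k := min_le_left _ _; omega)
  refine ⟨⟨TCE.program, 20000, TCE.decidesInTime_mono TCE.program_decides fun I => ?_⟩,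
    -- Both `n` and `ℓ` are at most the input size, so `ℓ * n ^ (4 * k + 2)` is at most its power
    -- with exponent `4 * k + 3`.
    ⟨TCE.program, fun _ => 20000, fun k => 4 * k + 3, .const _, ?_,
      TCE.decidesInTime_mono TCE.program_decides fun I => ?_⟩,
    -- The cap `budget ≤ n * n` removes `k` from the exponent, and `ℓ` is at most the input size, to
    -- the power `1`.
    ⟨TCE.program, fun n => 20000 * n ^ (4 * (n * n) + 2), 1, ?_,
      TCE.decidesInTime_mono TCE.program_decides fun I => ?_⟩⟩
  · refine Nat.mul_le_mul_left _ ((Nat.mul_le_mul_left _ (hk I)).trans ?_)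
    -- The program does not need the logarithmic factor; it is at least `1` and may be added.
    exact Nat.le_mul_of_pos_right _ (by omega)
  · exact (Primrec.nat_add.comp (Primrec.nat_mul.comp (.const 4) .id) (.const 3)).to_comp
  · refine Nat.mul_le_mul_left _ ?_
    calc I.ℓ * I.n ^ (4 * I.budget + 2) ≤ I.ℓ * I.n ^ (4 * I.k + 2) :=
          Nat.mul_le_mul_left _ (hk I)
      _ ≤ WordRAM.bitSize I.encode * WordRAM.bitSize I.encode ^ (4 * I.k + 2) :=
          Nat.mul_le_mul (TCE.ℓ_le_bitSize I) (Nat.pow_le_pow_left (TCE.n_le_bitSize I) _)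
      _ = WordRAM.bitSize I.encode ^ (4 * I.k + 3) := (pow_succ' _ _).symm
  · have hpow : Primrec₂ fun a b : ℕ => a ^ b :=
      Primrec₂.unpaired'.1 Nat.Primrec.pow
    exact (Primrec.nat_mul.comp (.const 20000) (hpow.comp .id (Primrec.nat_add.comp
      (Primrec.nat_mul.comp (.const 4) (Primrec.nat_mul.comp .id .id)) (.const 2)))).to_comp
  · rw [pow_one, mul_assoc]
    refine Nat.mul_le_mul_left _ ?_
    rw [mul_comm]
    refine Nat.mul_le_mul (Nat.pow_le_pow_right I.n_pos ?_) (TCE.ℓ_le_bitSize I)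
    have : I.budget ≤ I.n * I.n := min_le_right _ _
    dsimp only
    omega
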